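/- **Setting.** Let $d\in\{2,3\}$ and let $\Omega\subset\mathbb R^d$ be a polyhedral domain divided into disjoint polyhedral subdomains $\Omega_1,\Omega_2$ by the interface $\Gamma=\partial\Omega_1\cap\partial\Omega_2$, i.e. $\Omega\setminus\Gamma=\Omega_1\cup\Omega_2$, with $\partial\Omega\cap\Gamma\neq\emptyset$. (A polyhedral domain is a nonempty bounded connected open set that equals the interior of its closure and whose closure is a finite union of nondegenerate $d$-simplices.) Let $A:\Omega\to\mathbb R^{d\times d}$ be symmetric with $\lambda_{\min}|\xi|^2\le \xi\cdot A(x)\xi\le\lambda_{\max}|\xi|^2$ for $x\in\Omega$, $\xi\in\mathbb R^d$ ($\lambda_{\min},\lambda_{\max}>0$), such that each $A|_{\Omega_i}$ is $C^1$ and has a continuous extension to $\overline{\Omega_i}$. Put $\alpha=\max_{i=1,2}\sup_{x\in\Omega_i}\sup_{\xi}|A(x)\xi|/|\xi|$. Let $\{\mathcal T_h\}_h$ be a quasi-uniform family of conforming simplicial triangulations of $\Omega$, such that $\Gamma$ is a union of faces (edges if $d=2$) of $\mathcal T_h$ for every $h$. Let $\mathcal E_h$ be the set of faces, $S_h=\bigcup_{e\in\mathcal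 E_h}e$, $h_K,h_e$ the diameters of $K$ and $e$, and $\rho_K$ the diameter of the inscribed ball of $K$; assume that $\max\{h_e/\rho_K,\;h_K/h_e\}\le\nu_1$ for all $e\subset\partial K$, $K\in\mathcal T_h$ and all $h$. Let $\eta_e$ ($e\in\mathcal E_h$) be penalty parameters with $\eta_{\min}=\inf_h\min_{e\in\mathcal E_h}\eta_e>0$ and $\sup_h\max_{e\in\mathcal E_h}\eta_e<\infty$. Let $H^2(\mathcal T_h)=\{v\in L^2(\Omega): v|_K\in H^2(K),\ K\in\mathcal T_h\}$ and $\boldsymbol V^2(h)=H^2(\mathcal T_h)\times\{\hat v\in H^{1/2}(S_h):\hat v|_e=0 \text{ if } e\subset\partial\Omega\}$. For integers $k,l\ge1$ let $\boldsymbol V_h=V_{h,k}\times\hat V_{h,l}$, where $V_{h,k}$ is the space of functions in $L^2(\Omega)$ that are polynomials of degree $\le k$ on each $K$, and $\hat V_{h,l}$ the space of $\hat v\in L^2(S_h)$ with $\hat v|_e=0$ for $e\subset\partial\Omega$ and $\hat v|_e$ a polynomial of degree $\le l$ on each other face $e\in\mathcal E_h$. For pairs $\boldsymbol w=(w,\hat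 w)$, $\boldsymbol v=(v,\hat v)$ put $$B_h(\boldsymbol w,\boldsymbol v)=\sum_{K}\int_K A\nabla w\cdot\nabla v\,dx-\sum_K\int_{\partial K}(A\nabla w\cdot n_K)(v-\hat v)\,dS-\sum_K\int_{\partial K}(A\nabla v\cdot n_K)(w-\hat w)\,dS+\sum_K\sum_{e\subset\partial K}\int_e\frac{\eta_e}{h_e}(w-\hat w)(v-\hat v)\,dS,$$ $$\|\boldsymbol v\|_{2,h}^2=\sum_K|v|_{H^1(K)}^2+\sum_K h_K^2|v|_{H^2(K)}^2+\sum_K\sum_{e\subset\partial K}\frac{\eta_e}{h_e}\|\hat v-v\|_{L^2(e)}^2,$$ where $K$ runs over $\mathcal T_h$, $n_K$ is the outer unit normal to $\partial K$, and $A$, $v$, $w$, $\nabla v$, $\nabla w$ on $\partial K$ denote the traces from inside $K$. Let $C_{1,\mathrm T}>0$ and $C_{\mathrm{IV}}>0$ denote any constants such that, for all $h$, $K\in\mathcal T_h$ and $e\subset\partial K$, $$\|\nabla v\|_{L^2(e)}^2\le C_{1,\mathrm T}h_e^{-1}\bigl(|v|_{H^1(K)}^2+h_K^2|v|_{H^2(K)}^2\bigr)\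 (v\in H^2(K)),\qquad |v_h|_{H^1(K)}\le C_{\mathrm{IV}}h_K^{-1}\|v_h\|_{L^2(K)}\ (v_h\in V_{h,k}).$$ **Statement.** Such constants exist; $C_{1,\mathrm T}$ can be chosen depending only on $d,\nu_1$, and $C_{\mathrm{IV}}$ depending only on $d,k,\nu_1$. Moreover: (Boundedness) For any $\eta_{\min}>0$ there is a constant $C_{\mathrm b}=C_{\mathrm b}(\alpha,\eta_{\min},d,C_{1,\mathrm T})>0$ such that, for all $h$, $$B_h(\boldsymbol w,\boldsymbol v)\le C_{\mathrm b}\|\boldsymbol w\|_{2,h}\|\boldsymbol v\|_{2,h}\qquad(\boldsymbol w,\boldsymbol v\in\boldsymbol V^2(h)).$$ (Coercivity) There are constants $\eta^*=\eta^*(\alpha,\lambda_{\min},d,C_{1,\mathrm T},C_{\mathrm{IV}})>0$ and $C_{\mathrm c}=C_{\mathrm c}(\lambda_{\min},C_{\mathrm{IV}})>0$ such that, if $\eta_{\min}\ge\eta^*$, then for all $h$, $$B_h(\boldsymbol v_h,\boldsymbol v_h)\ge C_{\mathrm c}\|\boldsymbol v_h\|_{2,h}^2\qquad(\boldsymbol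 v_h\in\boldsymbol V_h).$$ -/

import Mathlib

open MeasureTheory Filter Topology
open scoped ContDiff

noncomputable section

namespace HDG

/-- Euclidean space `ℝ^d` with its Euclidean norm and scalar product. -/
abbrev E (d : ℕ) : Type := EuclideanSpace ℝ (Fin d)

/-! ### Weak derivatives and Sobolev spaces on an open set -/

/-- `g` is the weak partial derivative `∂ᵢ v` in the open set `U`. -/
def IsWeakPartial {d : ℕ} (U : Set (E d)) (i : Fin d) (v g : E d → ℝ) : Prop :=
  ∀ φ : E d → ℝ, ContDiff ℝ ∞ φ → HasCompactSupport φ → tsupport φ ⊆ U →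
    ∫ x in U, v x * fderiv ℝ φ x (EuclideanSpace.single i 1) = - ∫ x in U, g x * φ x

/-- `v` has a weak partial derivative `∂ᵢ v` in `L²(U)`. -/
def HasL2Partial {d : ℕ} (U : Set (E d)) (i : Fin d) (v : E d → ℝ) : Prop :=
  ∃ g : E d → ℝ, MemLp g 2 (volume.restrict U) ∧ IsWeakPartial U i v g

open Classical in
/-- A representative of the weak partial derivative `∂ᵢ v ∈ L²(U)`; it is unique up to equality
almost everywhere in `U`. -/
def weakPartial {d : ℕ} (U : Set (E d)) (i : Fin d) (v : E d → ℝ) : E d → ℝ :=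
  if h : HasL2Partial U i v then h.choose else 0

/-- The weak gradient `∇ v` in `U`. -/
def weakGrad {d : ℕ} (U : Set (E d)) (v : E d → ℝ) (x : E d) : E d :=
  WithLp.toLp 2 fun i => weakPartial U i v x

/-- `v ∈ H¹(U)`. -/
def MemH1 {d : ℕ} (U : Set (E d)) (v : E d → ℝ) : Prop :=
  MemLp v 2 (volume.restrict U) ∧ ∀ i, HasL2Partial U i v

/-- `v ∈ H²(U)`. -/
def MemH2 {d : ℕ} (U : Set (E d)) (v : E d → ℝ) : Prop :=
  MemH1 U v ∧ ∀ i, MemH1 U (weakPartial U i v)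

/-- `|v|²` for the seminorm of `H¹(U)`: `∑ᵢ ‖∂ᵢ v‖²` in `L²(U)`. -/
def h1SemiSq {d : ℕ} (U : Set (E d)) (v : E d → ℝ) : ℝ :=
  ∑ i : Fin d, ∫ x in U, weakPartial U i v x ^ 2

/-- `|v|²` for the seminorm of `H²(U)`: `∑ᵢⱼ ‖∂ⱼ ∂ᵢ v‖²` in `L²(U)`. -/
def h2SemiSq {d : ℕ} (U : Set (E d)) (v : E d → ℝ) : ℝ :=
  ∑ i : Fin d, h1SemiSq U (weakPartial U i v)

/-! ### Simplices, their faces, and traces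

A simplex (an element `K`, or a face `e` of an element) is given by the finite set of its
vertices. -/

/-- The closed simplex with the given vertices. -/
def closedSimplex {d : ℕ} (s : Finset (E d)) : Set (E d) := convexHull ℝ (s : Set (E d))

/-- The open `d`-simplex: the interior of the element `K`. -/
def openElement {d : ℕ} (K : Finset (E d)) : Set (E d) := interior (closedSimplex K)

/-- The faces (`d = 3`) or edges (`d = 2`) of the element `K`: the simplices spanned by `d` of its
`d + 1` vertices. -/
def facets {d : ℕ} (K : Finset (E d)) : Finset (Finset (E d)) := K.powersetCard d

/-- The diameter of a simplex: `h_K` for an element `K`, and `h_e` for a face `e`. -/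
def size {d : ℕ} (s : Finset (E d)) : ℝ := Metric.diam (closedSimplex s)

/-- `ρ_K`: the diameter of the inscribed (largest contained) ball of `K`. -/
def inballDiam {d : ℕ} (K : Finset (E d)) : ℝ :=
  sSup {t : ℝ | ∃ (c : E d) (r : ℝ), 0 ≤ r ∧ Metric.closedBall c r ⊆ closedSimplex K ∧ t = 2 * r}

/-- The `(d-1)`-dimensional surface measure on a subset of `ℝ^d`. -/
def surfaceOn {d : ℕ} (S : Set (E d)) : Measure (E d) :=
  (Measure.euclideanHausdorffMeasure (d - 1)).restrict S

/-- The surface measure `dS` on the face `e`. -/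
def faceMeasure {d : ℕ} (e : Finset (E d)) : Measure (E d) := surfaceOn (closedSimplex e)

/-- The barycentre of the vertices of a simplex. -/
def barycentre {d : ℕ} (s : Finset (E d)) : E d := (s.card : ℝ)⁻¹ • ∑ x ∈ s, x

/-- The vector from the barycentre of `K` to the barycentre of its face `e`, projected to the
orthogonal complement of the directions of `e`. It is orthogonal to `e` and points out of `K`. -/
def outerVector {d : ℕ} (K e : Finset (E d)) : E d :=
  (vectorSpan ℝ (e : Set (E d)))ᗮ.starProjection (barycentre e - barycentre K)

/-- The outer unit normal vector `n_K` to `∂K` on the face `e` of `K`. -/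
def outerNormal {d : ℕ} (K e : Finset (E d)) : E d := ‖outerVector K e‖⁻¹ • outerVector K e

/-- `τ ∈ L²(e)` is the trace on the face `e` of the function `v ∈ H¹(K)`: there are smooth functions
converging to `v` in `H¹(K)` whose restrictions to `e` converge to `τ` in `L²(e)`. -/
def IsTrace {d : ℕ} (K e : Finset (E d)) (v τ : E d → ℝ) : Prop :=
  MemLp τ 2 (faceMeasure e) ∧ ∃ φ : ℕ → E d → ℝ, (∀ n, ContDiff ℝ ∞ (φ n)) ∧
    Tendsto (fun n => eLpNorm (fun x => φ n x - v x) 2 (volume.restrict (openElement K)))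
      atTop (𝓝 0) ∧
    (∀ i : Fin d, Tendsto (fun n => eLpNorm (fun x =>
        fderiv ℝ (φ n) x (EuclideanSpace.single i 1) - weakPartial (openElement K) i v x) 2
        (volume.restrict (openElement K))) atTop (𝓝 0)) ∧
    Tendsto (fun n => eLpNorm (fun x => φ n x - τ x) 2 (faceMeasure e)) atTop (𝓝 0)

open Classical in
/-- A representative of the trace on `e` of `v ∈ H¹(K)`, unique up to equality almost everywhere
on `e`. -/
def trace {d : ℕ} (K e : Finset (E d)) (v : E d → ℝ) : E d → ℝ :=
  if h : ∃ τ, IsTrace K e v τ then h.choose else 0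

/-- The trace on `e` of the gradient of `v ∈ H²(K)`. -/
def traceGrad {d : ℕ} (K e : Finset (E d)) (v : E d → ℝ) (x : E d) : E d :=
  WithLp.toLp 2 fun i => trace K e (weakPartial (openElement K) i v) x

/-! ### The interface problem -/

/-- A polyhedral domain: a nonempty bounded connected open set without slits or punctures, the
closure of which is a finite union of nondegenerate `d`-simplices. -/
structure IsPolyhedralDomain {d : ℕ} (Ω : Set (E d)) : Prop where
  isOpen : IsOpen Ω
  isConnected : IsConnected Ω
  isBounded : Bornology.IsBounded Ω
  interior_closure : interior (closure Ω) = Ω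
  polyhedral : ∃ T : Finset (Finset (E d)),
    (∀ s ∈ T, s.card = d + 1 ∧ AffineIndependent ℝ ((↑) : s → E d)) ∧
      closure Ω = ⋃ s ∈ T, closedSimplex s

/-- The geometry and the diffusion coefficient of the interface problem. A matrix `A x` is
regarded as a linear map of `ℝ^d`. -/
structure InterfaceProblem (d : ℕ) where
  /-- the whole domain -/
  Ω : Set (E d)
  /-- the first subdomain -/
  Ω₁ : Set (E d)
  /-- the second subdomain -/
  Ω₂ : Set (E d)
  polyhedral : IsPolyhedralDomain Ω
  polyhedral₁ : IsPolyhedralDomain Ω₁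
  polyhedral₂ : IsPolyhedralDomain Ω₂
  disjoint : Disjoint Ω₁ Ω₂
  /-- `Ω` is divided into `Ω₁` and `Ω₂` by the interface. -/
  divided : Ω \ (frontier Ω₁ ∩ frontier Ω₂) = Ω₁ ∪ Ω₂
  /-- The interface meets the boundary. -/
  meets : (frontier Ω ∩ (frontier Ω₁ ∩ frontier Ω₂)).Nonempty
  /-- the coefficient matrix -/
  A : E d → E d →L[ℝ] E d
  contDiffOn₁ : ContDiffOn ℝ 1 A Ω₁
  contDiffOn₂ : ContDiffOn ℝ 1 A Ω₂
  /-- The one-sided boundary values of `A` exist, so that `A` may be evaluated on the faces of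
  elements lying on the interface or on the boundary. -/
  boundary₁ : ∀ x ∈ frontier Ω₁, ∃ M, Tendsto A (𝓝[Ω₁] x) (𝓝 M)
  boundary₂ : ∀ x ∈ frontier Ω₂, ∃ M, Tendsto A (𝓝[Ω₂] x) (𝓝 M)
  symm : ∀ x ∈ Ω, ∀ ξ ζ : E d, inner ℝ ξ (A x ζ) = inner ℝ (A x ξ) ζ
  /-- the lower ellipticity constant -/
  lamMin : ℝ
  /-- the upper ellipticity constant -/
  lamMax : ℝ
  lamMin_pos : 0 < lamMin
  lamMax_pos : 0 < lamMax
  elliptic : ∀ x ∈ Ω, ∀ ξ : E d,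
    lamMin * ‖ξ‖ ^ 2 ≤ inner ℝ ξ (A x ξ) ∧ inner ℝ ξ (A x ξ) ≤ lamMax * ‖ξ‖ ^ 2

/-- The interface `Γ = ∂Ω₁ ∩ ∂Ω₂`. -/
def InterfaceProblem.Γ {d : ℕ} (P : InterfaceProblem d) : Set (E d) :=
  frontier P.Ω₁ ∩ frontier P.Ω₂

/-- `α`: the maximum over `i = 1, 2` of the supremum of `|A(x) ξ| / |ξ|` over `x ∈ Ωᵢ` and `ξ`. -/
def InterfaceProblem.alpha {d : ℕ} (P : InterfaceProblem d) : ℝ :=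
  max (⨆ x : P.Ω₁, ⨆ ξ : E d, ‖P.A x ξ‖ / ‖ξ‖) (⨆ x : P.Ω₂, ⨆ ξ : E d, ‖P.A x ξ‖ / ‖ξ‖)

/-! ### Triangulations -/

/-- A (conforming, simplicial) triangulation of `Ω`: a finite simplicial complex, all of whose
simplices are faces of `d`-simplices, which covers exactly the closure of `Ω`. -/
structure Triangulation {d : ℕ} (Ω : Set (E d)) where
  /-- the simplicial complex -/
  complex : Geometry.SimplicialComplex ℝ (E d)
  finite : complex.faces.Finite
  pure : ∀ s ∈ complex.faces, ∃ K ∈ complex.faces, s ⊆ K ∧ K.card = d + 1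
  space_eq : complex.space = closure Ω

/-- The elements `K ∈ 𝒯_h`. -/
def Triangulation.elements {d : ℕ} {Ω : Set (E d)} (T : Triangulation Ω) : Finset (Finset (E d)) :=
  T.finite.toFinset.filter fun s => s.card = d + 1

/-- The set `ℰ_h` of all faces or edges of elements. -/
def Triangulation.edges {d : ℕ} {Ω : Set (E d)} (T : Triangulation Ω) : Set (Finset (E d)) :=
  {e | ∃ K ∈ T.elements, e ∈ facets K}

/-- The set of the faces contained in `∂Ω`. -/
def Triangulation.boundaryEdges {d : ℕ} {Ω : Set (E d)} (T : Triangulation Ω) :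
    Set (Finset (E d)) :=
  {e | e ∈ T.edges ∧ closedSimplex e ⊆ frontier Ω}

/-- The skeleton `S_h`: the union of all faces. -/
def Triangulation.skeleton {d : ℕ} {Ω : Set (E d)} (T : Triangulation Ω) : Set (E d) :=
  ⋃ e ∈ T.edges, closedSimplex e

/-- A quasi-uniform family of triangulations of `Ω` that satisfies the geometric assumptions and is
equipped with penalty parameters. -/
structure MeshFamily {d : ℕ} (P : InterfaceProblem d) where
  /-- the index set of the family -/
  ι : Type
  /-- the triangulations -/
  mesh : ι → Triangulation P.Ω
  /-- The diameters of all inscribed balls are comparable with the mesh size. -/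
  quasiUniform : ∃ ρ : ℝ, 0 < ρ ∧ ∀ h, ∀ K ∈ (mesh h).elements, ∀ K' ∈ (mesh h).elements,
    ρ * size K' ≤ inballDiam K
  /-- the bound for the ratios `h_e / ρ_K` and `h_K / h_e` -/
  ν₁ : ℝ
  ratio : ∀ h, ∀ K ∈ (mesh h).elements, ∀ e ∈ facets K,
    max (size e / inballDiam K) (size K / size e) ≤ ν₁
  /-- The interface is a union of faces. -/
  resolves : ∀ h, ∃ EΓ ⊆ (mesh h).edges, P.Γ = ⋃ e ∈ EΓ, closedSimplex e
  /-- the penalty parameters `η_e` -/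
  η : ι → Finset (E d) → ℝ
  η_bddAbove : BddAbove {t : ℝ | ∃ h, ∃ e ∈ (mesh h).edges, t = η h e}
  η_pos : 0 < sInf {t : ℝ | ∃ h, ∃ e ∈ (mesh h).edges, t = η h e}

/-- `η_min`: the infimum of all the penalty parameters of the family. -/
def MeshFamily.etaMin {d : ℕ} {P : InterfaceProblem d} (F : MeshFamily P) : ℝ :=
  sInf {t : ℝ | ∃ h, ∃ e ∈ (F.mesh h).edges, t = F.η h e}

/-! ### Function spaces -/

/-- `v ∈ H²(𝒯_h)`. -/
def MemBrokenH2 {d : ℕ} {Ω : Set (E d)} (T : Triangulation Ω) (v : E d → ℝ) : Prop :=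
  MemLp v 2 (volume.restrict Ω) ∧ ∀ K ∈ T.elements, MemH2 (openElement K) v

/-- `v̂ ∈ L²(S_h)` with `v̂ = 0` on the faces in `∂Ω`. -/
def MemSkeletonL2 {d : ℕ} {Ω : Set (E d)} (T : Triangulation Ω) (vh : E d → ℝ) : Prop :=
  MemLp vh 2 (surfaceOn T.skeleton) ∧
    ∀ e ∈ T.boundaryEdges, ∀ᵐ x ∂faceMeasure e, vh x = 0

/-- `v̂ ∈ H^{1/2}(S_h)` with `v̂ = 0` on the faces in `∂Ω`; as `S_h` has dimension `d - 1`, the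
exponent in the Sobolev-Slobodeckij seminorm is `(d - 1) + 2 * (1/2) = d`. -/
def MemSkeletonHHalf {d : ℕ} {Ω : Set (E d)} (T : Triangulation Ω) (vh : E d → ℝ) : Prop :=
  MemSkeletonL2 T vh ∧
    ∫⁻ x, ∫⁻ y, ‖vh x - vh y‖ₑ ^ 2 / edist x y ^ d ∂surfaceOn T.skeleton
      ∂surfaceOn T.skeleton < ⊤

/-- A pair `(v, v̂)` of a function in the elements and a function on the skeleton. -/
abbrev HPair (d : ℕ) : Type := (E d → ℝ) × (E d → ℝ)

/-- The space `V²(h)`. -/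
def V2 {d : ℕ} {Ω : Set (E d)} (T : Triangulation Ω) : Set (HPair d) :=
  {v | MemBrokenH2 T v.1 ∧ MemSkeletonHHalf T v.2}

/-- `v` agrees `μ`-almost everywhere with a polynomial of degree at most `k`. -/
def IsPolyAE {d : ℕ} (k : ℕ) (μ : Measure (E d)) (v : E d → ℝ) : Prop :=
  ∃ p : MvPolynomial (Fin d) ℝ, p.totalDegree ≤ k ∧ ∀ᵐ x ∂μ, v x = p.eval fun i => x i

/-- The finite element space `V_{h,k}` of piecewise polynomials. -/
def MemVh {d : ℕ} {Ω : Set (E d)} (T : Triangulation Ω) (k : ℕ) (v : E d → ℝ) : Prop :=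
  MemLp v 2 (volume.restrict Ω) ∧
    ∀ K ∈ T.elements, MemH1 (openElement K) v ∧ IsPolyAE k (volume.restrict (openElement K)) v

/-- The finite element space `V̂_{h,l}` on the skeleton. -/
def MemVhHat {d : ℕ} {Ω : Set (E d)} (T : Triangulation Ω) (l : ℕ) (vh : E d → ℝ) : Prop :=
  MemSkeletonL2 T vh ∧ ∀ e ∈ T.edges, e ∉ T.boundaryEdges → IsPolyAE l (faceMeasure e) vh

/-- The discrete space `V_{h,k} × V̂_{h,l}`. -/
def Vh {d : ℕ} {Ω : Set (E d)} (T : Triangulation Ω) (k l : ℕ) : Set (HPair d) :=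
  {v | MemVh T k v.1 ∧ MemVhHat T l v.2}

/-! ### The bilinear form and the norm -/

/-- `∫_e (A ∇w · n_K) (v - v̂) dS`, with all values on `e` taken from inside `K`. -/
def fluxTerm {d : ℕ} (A : E d → E d →L[ℝ] E d) (K e : Finset (E d)) (w : E d → ℝ) (v : HPair d) :
    ℝ :=
  ∫ x, inner ℝ (extendFrom (openElement K) A x (traceGrad K e w x)) (outerNormal K e) *
    (trace K e v.1 x - v.2 x) ∂faceMeasure e

/-- The bilinear form `B_h`. -/
def B {d : ℕ} {P : InterfaceProblem d} (F : MeshFamily P) (h : F.ι) (w v : HPair d) : ℝ :=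
  (∑ K ∈ (F.mesh h).elements, ∫ x in openElement K,
      inner ℝ (P.A x (weakGrad (openElement K) w.1 x)) (weakGrad (openElement K) v.1 x))
  - (∑ K ∈ (F.mesh h).elements, ∑ e ∈ facets K, fluxTerm P.A K e w.1 v)
  - (∑ K ∈ (F.mesh h).elements, ∑ e ∈ facets K, fluxTerm P.A K e v.1 w)
  + ∑ K ∈ (F.mesh h).elements, ∑ e ∈ facets K, ∫ x, F.η h e / size e *
      ((trace K e w.1 x - w.2 x) * (trace K e v.1 x - v.2 x)) ∂faceMeasure e

/-- The square of the norm `‖(v, v̂)‖_{2,h}`. -/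
def norm2Sq {d : ℕ} {P : InterfaceProblem d} (F : MeshFamily P) (h : F.ι) (v : HPair d) : ℝ :=
  (∑ K ∈ (F.mesh h).elements, h1SemiSq (openElement K) v.1)
  + (∑ K ∈ (F.mesh h).elements, size K ^ 2 * h2SemiSq (openElement K) v.1)
  + ∑ K ∈ (F.mesh h).elements, ∑ e ∈ facets K,
      F.η h e / size e * ∫ x, (v.2 x - trace K e v.1 x) ^ 2 ∂faceMeasure e

/-- The norm `‖(v, v̂)‖_{2,h}`. -/
def norm2 {d : ℕ} {P : InterfaceProblem d} (F : MeshFamily P) (h : F.ι) (v : HPair d) : ℝ :=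
  Real.sqrt (norm2Sq F h v)

/-! ### The constants of the inverse and the trace inequality -/

/-- `C` is a constant for the trace inequality
`‖∇v‖²_{L²(e)} ≤ C h_e⁻¹ (|v|²_{H¹(K)} + h_K² |v|²_{H²(K)})`, `v ∈ H²(K)`, on all elements of the
family. -/
def IsTraceConst {d : ℕ} {P : InterfaceProblem d} (F : MeshFamily P) (C : ℝ) : Prop :=
  ∀ h, ∀ K ∈ (F.mesh h).elements, ∀ e ∈ facets K, ∀ v : E d → ℝ, MemH2 (openElement K) v →
    ∫ x, ‖traceGrad K e v x‖ ^ 2 ∂faceMeasure e ≤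
      C * (size e)⁻¹ * (h1SemiSq (openElement K) v + size K ^ 2 * h2SemiSq (openElement K) v)

/-- `C` is a constant for the inverse inequality `|v|_{H¹(K)} ≤ C h_K⁻¹ ‖v‖_{L²(K)}`, `v ∈ V_{h,k}`,
on all elements of the family. -/
def IsInverseConst {d : ℕ} {P : InterfaceProblem d} (F : MeshFamily P) (k : ℕ) (C : ℝ) : Prop :=
  ∀ h, ∀ K ∈ (F.mesh h).elements, ∀ v : E d → ℝ, MemVh (F.mesh h) k v →
    Real.sqrt (h1SemiSq (openElement K) v) ≤
      C * (size K)⁻¹ * Real.sqrt (∫ x in openElement K, v x ^ 2)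

end HDG

end

/-! Everything rests on controlling the flux terms. On a face e of K, Cauchy-Schwarz bounds the flux
by α times the product of the L²(e)-norms of ∇w and of the jump of v. The trace inequality bounds
the first norm by the root of c₁/h_e times the local energy; the factor h_e^{-1/2} is handed to the
jump, where it forms the penalty term at the cost of η_min^{-1/2}. Summation over the d + 1 faces of
each element gives `sum_abs_fluxTerm_le`. With the Cauchy-Schwarz bounds for the volume and penalty
terms this yields boundedness (`B_le`).

For coercivity, the inverse inequality applied to the partial derivatives of a piecewise polynomial
absorbs the H² part of the norm into the H¹ part (`h2SemiSq_le`). The two flux sums coincide when w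
= v, and for large η_min Young's inequality hides them in half of the volume term and half of the
penalty term (`le_B`).

The constants are obtained as follows. The trace inequality is proved for smooth functions by
integrating along rays from the vertex opposite to the face (`IsCone.trace_inequality`). Density of
smooth functions in H¹(K), by contraction and mollification (`exists_contDiff_eLpNorm_sub_le`), then
gives both the existence of traces, which are L² limits, and the inequality for them. The inverse
inequality is the equivalence of norms on polynomials of bounded degree over two fixed concentric
balls, transported by scaling: K lies between two concentric balls whose radii have a ratio
controlled by ν₁ (`inverse_inequality`).

Finally, the mesh resolves the interface, so each open element lies in one subdomain. There A is
continuous, and its one-sided boundary values inherit the bound α (`MeshFamily.norm_extendFrom_le`).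
-/

namespace HDG

/-! ### Geometry of simplices: faces, heights and inscribed balls -/

theorem mem_facets {d : ℕ} {K e : Finset (E d)} (he : e ∈ facets K) (hK : K.card = d + 1) :
    ∃ p ∈ K, p ∉ e ∧ K = insert p e := by
  classical
  obtain ⟨h1, h2⟩ := Finset.mem_powersetCard.1 he
  have hc : (K \ e).card = 1 := by rw [Finset.card_sdiff_of_subset h1]; omega
  obtain ⟨p, hp⟩ := Finset.card_eq_one.1 hc
  have hpK : p ∈ K \ e := by simp [hp]
  refine ⟨p, (Finset.mem_sdiff.1 hpK).1, (Finset.mem_sdiff.1 hpK).2, ?_⟩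
  rw [← Finset.sdiff_union_of_subset h1, hp, Finset.singleton_union]

theorem facets_card {d : ℕ} {K : Finset (E d)} (hK : K.card = d + 1) :
    (facets K).card = d + 1 := by
  rw [facets, Finset.card_powersetCard, hK, Nat.choose_succ_self_right]

/-- A nondegenerate `d`-simplex in `ℝ^d`. -/
def IsElement {d : ℕ} (K : Finset (E d)) : Prop :=
  K.card = d + 1 ∧ AffineIndependent ℝ ((↑) : K → E d)

theorem Triangulation.isElement {d : ℕ} {Ω : Set (E d)} (T : Triangulation Ω) {K : Finset (E d)}
    (hK : K ∈ T.elements) : IsElement K := by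
  obtain ⟨h1, h2⟩ := Finset.mem_filter.1 hK
  exact ⟨h2, T.complex.indep (by simpa using h1)⟩

namespace IsElement

variable {d : ℕ} {K : Finset (E d)}

theorem affineSpan_eq_top (hK : IsElement K) : affineSpan ℝ (K : Set (E d)) = ⊤ := by
  have := (hK.2.affineSpan_eq_top_iff_card_eq_finrank_add_one).2 (by simp [hK.1])
  simpa using this

theorem openElement_nonempty (hK : IsElement K) : (openElement K).Nonempty :=
  interior_convexHull_nonempty_iff_affineSpan_eq_top.2 hK.affineSpan_eq_top

theorem closure_openElement (hK : IsElement K) : closure (openElement K) = closedSimplex K := by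
  have hc : Convex ℝ (closedSimplex K) := convex_convexHull ℝ _
  have hcl : IsClosed (closedSimplex K) := K.finite_toSet.isClosed_convexHull ℝ
  rw [openElement, hc.closure_interior_eq_closure_of_nonempty_interior hK.openElement_nonempty,
    hcl.closure_eq]

/-- The convex hull of a proper subset of the vertices does not meet the interior. -/
theorem disjoint_openElement (hK : IsElement K) {s : Set (E d)} (hs : s ⊂ (K : Set (E d))) :
    Disjoint (convexHull ℝ s) (openElement K) := by
  obtain ⟨hsub, q, hqK, hqs⟩ := Set.ssubset_iff_exists.1 hs
  obtain ⟨b, hbj⟩ : ∃ b : AffineBasis K ℝ (E d), ∀ j : K, b j = (j : E d) :=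
    ⟨⟨((↑) : K → E d), hK.2, by simpa using hK.affineSpan_eq_top⟩, fun _ => rfl⟩
  have hb : Set.range b = (K : Set (E d)) := by
    ext x; simp [hbj]
  rw [Set.disjoint_left]
  intro x hx hxo
  rw [openElement, closedSimplex, ← hb, b.interior_convexHull] at hxo
  have hq := hxo ⟨q, hqK⟩
  have hss : s ⊆ {y | b.coord ⟨q, hqK⟩ y = 0} := by
    intro y hy
    have hyq : (⟨y, hsub hy⟩ : K) ≠ ⟨q, hqK⟩ := by
      intro h; apply hqs; rw [← Subtype.mk.inj h]; exact hy
    have := b.coord_apply_ne hyq.symm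
    rwa [hbj] at this
  have hcv : Convex ℝ {y | b.coord ⟨q, hqK⟩ y = 0} :=
    (convex_singleton (𝕜 := ℝ) (0 : ℝ)).affine_preimage (b.coord ⟨q, hqK⟩)
  have := convexHull_min hss hcv hx
  simp only [Set.mem_ofPred_eq] at this
  linarith

end IsElement

theorem convex_closedSimplex {d : ℕ} (s : Finset (E d)) : Convex ℝ (closedSimplex s) :=
  convex_convexHull ℝ _

theorem isCompact_closedSimplex {d : ℕ} (s : Finset (E d)) : IsCompact (closedSimplex s) :=
  s.finite_toSet.isCompact_convexHull ℝ

theorem measurableSet_closedSimplex {d : ℕ} (s : Finset (E d)) :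
    MeasurableSet (closedSimplex s) :=
  (isCompact_closedSimplex s).isClosed.measurableSet

theorem isOpen_openElement {d : ℕ} (K : Finset (E d)) : IsOpen (openElement K) := isOpen_interior

theorem convex_openElement {d : ℕ} (K : Finset (E d)) : Convex ℝ (openElement K) :=
  (convex_closedSimplex K).interior

theorem openElement_subset {d : ℕ} (K : Finset (E d)) : openElement K ⊆ closedSimplex K :=
  interior_subset

theorem volume_openElement_ne_top {d : ℕ} (K : Finset (E d)) : volume (openElement K) ≠ ⊤ :=
  ((measure_mono (openElement_subset K)).trans_lt (isCompact_closedSimplex K).measure_lt_top).ne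

instance {d : ℕ} (K : Finset (E d)) : IsFiniteMeasure (volume.restrict (openElement K)) :=
  isFiniteMeasure_restrict.2 (volume_openElement_ne_top K)

/-- The frontier of a convex set is a null set. Integrals over the open element may thus be taken
over the compact simplex. -/
theorem openElement_ae_eq {d : ℕ} (K : Finset (E d)) :
    openElement K =ᵐ[volume] closedSimplex K := by
  refine interior_ae_eq_of_null_frontier ?_
  exact (convex_closedSimplex K).addHaar_frontier volume

theorem size_nonneg {d : ℕ} (s : Finset (E d)) : 0 ≤ size s := Metric.diam_nonneg

theorem norm_sub_le_size {d : ℕ} {s : Finset (E d)} {x y : E d} (hx : x ∈ closedSimplex s)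
    (hy : y ∈ closedSimplex s) : ‖x - y‖ ≤ size s := by
  rw [← dist_eq_norm]
  exact Metric.dist_le_diam_of_mem (isCompact_closedSimplex s).isBounded hx hy

theorem size_pos {d : ℕ} {s : Finset (E d)} (hs : 2 ≤ s.card) : 0 < size s := by
  obtain ⟨a, ha, b, hb, hab⟩ := Finset.one_lt_card.1 (show 1 < s.card by omega)
  have h := norm_sub_le_size (subset_convexHull ℝ (s : Set (E d)) ha)
    (subset_convexHull ℝ (s : Set (E d)) hb)
  exact lt_of_lt_of_le (norm_pos_iff.2 (sub_ne_zero.2 hab)) h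

/-- Two antipodal points of a ball contained in K are at most `size K` apart. A direction is needed
for this, hence the positive dimension. Boundedness is what gives the real supremum in `inballDiam`
its meaning. -/
theorem bddAbove_inball {d : ℕ} (hd : 0 < d) (K : Finset (E d)) :
    BddAbove {t : ℝ | ∃ (c : E d) (r : ℝ), 0 ≤ r ∧ Metric.closedBall c r ⊆ closedSimplex K ∧
      t = 2 * r} := by
  refine ⟨size K, ?_⟩
  rintro _ ⟨c, r, hr, hb, rfl⟩
  have : Nonempty (Fin d) := ⟨⟨0, hd⟩⟩
  let u : E d := EuclideanSpace.single ⟨0, hd⟩ 1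
  have hu : ‖u‖ = 1 := by simp [u]
  have h1 : c + r • u ∈ closedSimplex K := hb (by simp [norm_smul, hu, abs_of_nonneg hr])
  have h2 : c - r • u ∈ closedSimplex K := hb (by simp [norm_smul, hu, abs_of_nonneg hr])
  have h := norm_sub_le_size h1 h2
  have : (c + r • u) - (c - r • u) = (2 * r) • u := by module
  rw [this, norm_smul, hu, Real.norm_eq_abs, abs_of_nonneg (by positivity), mul_one] at h
  exact h

theorem IsElement.inballDiam_pos {d : ℕ} (hd : 0 < d) {K : Finset (E d)} (hK : IsElement K) :
    0 < inballDiam K := by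
  obtain ⟨c, hc⟩ := hK.openElement_nonempty
  obtain ⟨r, hr, hb⟩ := Metric.nhds_basis_closedBall.mem_iff.1 ((isOpen_openElement K).mem_nhds hc)
  have : 2 * r ≤ inballDiam K :=
    le_csSup (bddAbove_inball hd K) ⟨c, r, hr.le, hb.trans (openElement_subset K), rfl⟩
  linarith

/-- Attainment of the supremum is avoided by settling for half of the optimal radius, that is, a
quarter of the diameter. -/
theorem IsElement.exists_ball {d : ℕ} (hd : 0 < d) {K : Finset (E d)} (hK : IsElement K) :
    ∃ c r, inballDiam K / 4 ≤ r ∧ 0 < r ∧ Metric.closedBall c r ⊆ closedSimplex K := by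
  have hpos := hK.inballDiam_pos hd
  have hne : {t : ℝ | ∃ (c : E d) (r : ℝ), 0 ≤ r ∧ Metric.closedBall c r ⊆ closedSimplex K ∧
      t = 2 * r}.Nonempty := by
    by_contra h
    rw [Set.not_nonempty_iff_eq_empty] at h
    rw [inballDiam, h, Real.sSup_empty] at hpos
    exact lt_irrefl _ hpos
  obtain ⟨_, ⟨c, r, hr, hb, rfl⟩, hlt⟩ := exists_lt_of_lt_csSup hne
    (show inballDiam K / 2 < inballDiam K by linarith)
  exact ⟨c, r, by linarith, by linarith, hb⟩

/-- The vector `v` from the apex `p` to the foot of the height of a simplex over its face `e`. -/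
theorem exists_height {d : ℕ} (hd : 0 < d) {K e : Finset (E d)} (hK : IsElement K)
    (he : e ∈ facets K) :
    ∃ p ∈ K, K = insert p e ∧ ∃ v : E d, v ≠ 0 ∧ ∀ y ∈ closedSimplex e, inner ℝ (y - p) v = ‖v‖ ^ 2 := by
  classical
  obtain ⟨p, hpK, hpe, hKe⟩ := mem_facets he hK.1
  have hec : e.card = d := (Finset.mem_powersetCard.1 he).2
  obtain ⟨y₀, hy₀⟩ := Finset.card_pos.1 (by omega : 0 < e.card)
  set W := vectorSpan ℝ (e : Set (E d)) with hW
  set v := Wᗮ.starProjection (y₀ - p) with hv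
  have hsum : W.starProjection (y₀ - p) + v = y₀ - p :=
    Submodule.starProjection_add_starProjection_orthogonal (K := W) (y₀ - p)
  have hvW : v ∈ Wᗮ := Submodule.starProjection_apply_mem _ _
  have hpW : W.starProjection (y₀ - p) ∈ W := Submodule.starProjection_apply_mem _ _
  refine ⟨p, hpK, hKe, v, ?_, ?_⟩
  -- A vanishing height would put p into the affine span of e, against affine independence.
  · intro hv0
    rw [hv0, add_zero] at hsum
    rw [hsum] at hpW
    have hmem : p ∈ affineSpan ℝ (e : Set (E d)) := by
      have h1 : -(y₀ - p) +ᵥ y₀ ∈ affineSpan ℝ (e : Set (E d)) := by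
        refine AffineSubspace.vadd_mem_of_mem_direction ?_ (subset_affineSpan ℝ _ hy₀)
        rw [direction_affineSpan]
        exact neg_mem hpW
      simpa using h1
    have hind := hK.2
    have := (hind.mem_affineSpan_iff ⟨p, hpK⟩ {x : K | (x : E d) ∈ e}).1 (by
      convert hmem using 2
      ext x
      simp only [Set.mem_image, Set.mem_ofPred_eq, Subtype.exists, exists_and_left, exists_prop,
        exists_eq_right_right, SetLike.mem_coe]
      constructor
      · rintro ⟨h, -⟩; exact h
      · intro h; exact ⟨h, by rw [hKe]; exact Finset.mem_insert_of_mem h⟩)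
    exact hpe this
  · have hcv : Convex ℝ {y : E d | inner ℝ (y - p) v = ‖v‖ ^ 2} := by
      have h1 : {y : E d | inner ℝ (y - p) v = ‖v‖ ^ 2} =
          {y : E d | (innerSL ℝ v) y = ‖v‖ ^ 2 + inner ℝ p v} := by
        ext y
        simp only [Set.mem_ofPred_eq, inner_sub_left, innerSL_apply_apply, real_inner_comm v y]
        constructor <;> intro h <;> linarith
      rw [h1]
      exact convex_hyperplane (innerSL ℝ v).toLinearMap.isLinear _
    intro y hy
    refine convexHull_min ?_ hcv hy
    intro z hz
    have hzW : z - y₀ ∈ W := vsub_mem_vectorSpan ℝ hz hy₀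
    have e1 : z - p = (z - y₀ + W.starProjection (y₀ - p)) + v := by
      rw [add_assoc, hsum]; abel
    have e2 : inner ℝ (z - y₀ + W.starProjection (y₀ - p)) v = 0 :=
      Submodule.inner_right_of_mem_orthogonal (add_mem hzW hpW) hvW
    change inner ℝ (z - p) v = ‖v‖ ^ 2
    rw [e1, inner_add_left, e2, zero_add, real_inner_self_eq_norm_sq]

/-- The diameter of the inscribed ball is at most the height of the simplex. -/
theorem inballDiam_le_height {d : ℕ} {K e : Finset (E d)} {p v : E d}
    (hKe : ∀ x ∈ K, x = p ∨ x ∈ e) (hv : v ≠ 0)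
    (hev : ∀ y ∈ closedSimplex e, inner ℝ (y - p) v = ‖v‖ ^ 2) : inballDiam K ≤ ‖v‖ := by
  have hvp : 0 < ‖v‖ := norm_pos_iff.2 hv
  -- The simplex lies in the slab between the hyperplane of e and its parallel through p. A ball of
  -- radius r inside needs width 2r in the direction of v.
  have hslab : closedSimplex K ⊆ {x : E d | inner ℝ (x - p) v ∈ Set.Icc 0 (‖v‖ ^ 2)} := by
    have hcv : Convex ℝ {x : E d | inner ℝ (x - p) v ∈ Set.Icc 0 (‖v‖ ^ 2)} := by
      have h1 : {x : E d | inner ℝ (x - p) v ∈ Set.Icc 0 (‖v‖ ^ 2)} =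
          (innerSL ℝ v).toLinearMap ⁻¹' Set.Icc (inner ℝ p v) (‖v‖ ^ 2 + inner ℝ p v) := by
        ext y
        simp only [Set.mem_ofPred_eq, inner_sub_left, Set.mem_preimage, Set.mem_Icc,
          ContinuousLinearMap.coe_coe, innerSL_apply_apply, real_inner_comm v y]
        constructor <;> rintro ⟨h, h'⟩ <;> constructor <;> linarith
      rw [h1]
      exact (convex_Icc _ _).linear_preimage _
    refine convexHull_min ?_ hcv
    intro x hx
    rcases hKe x hx with rfl | hxe
    · simp
    · simp [hev x (subset_convexHull ℝ _ hxe)]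
  refine Real.sSup_le ?_ (norm_nonneg _)
  rintro _ ⟨c, r, hr, hb, rfl⟩
  have hn : ‖r • ‖v‖⁻¹ • v‖ = r := by
    rw [norm_smul, norm_smul, norm_inv, norm_norm, inv_mul_cancel₀ hvp.ne', mul_one,
      Real.norm_eq_abs, abs_of_nonneg hr]
  have h1 := (hslab (hb (show c + r • ‖v‖⁻¹ • v ∈ _ by simp [hn]))).2
  have h2 := (hslab (hb (show c - r • ‖v‖⁻¹ • v ∈ _ by simp [hn]))).1
  have e1 : inner ℝ (r • ‖v‖⁻¹ • v) v = r * ‖v‖ := by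
    rw [real_inner_smul_left, real_inner_smul_left, real_inner_self_eq_norm_sq]
    field_simp
  rw [inner_sub_left, inner_add_left, e1] at h1
  rw [inner_sub_left, inner_sub_left, e1] at h2
  have : 2 * r * ‖v‖ ≤ ‖v‖ * ‖v‖ := by nlinarith
  exact le_of_mul_le_mul_right this hvp

/-! ### Polar integration about the apex of a cone; the trace inequality for smooth functions -/

/-- A compact cone in `ℝ^d` with apex `p`, containing the set `S` of a hyperplane; `v` is the vector
from `p` to the foot of the height. -/
structure IsCone {d : ℕ} (p v : E d) (S C : Set (E d)) : Prop where
  ne : v ≠ 0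
  compact : IsCompact C
  closed : IsClosed S
  convex : Convex ℝ C
  apex : p ∈ C
  subset : S ⊆ C
  height : ∀ y ∈ S, inner ℝ (y - p) v = ‖v‖ ^ 2

namespace IsCone

variable {m : ℕ} {p v : E (m + 1)} {S C : Set (E (m + 1))}

theorem homothety_mem (h : IsCone p v S C) {t : ℝ} (ht : t ∈ Set.Ioo (0 : ℝ) 1) {y : E (m + 1)}
    (hy : y ∈ S) : p + t • (y - p) ∈ C :=
  h.convex.add_smul_sub_mem h.apex (h.subset hy) ⟨ht.1.le, ht.2.le⟩

/-- The homothety with centre p and ratio t carries S into the slice of the cone at relative height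
t and multiplies m-dimensional measure by t ^ m. -/
theorem slice_le (h : IsCone p v S C) {t : ℝ} (ht : t ∈ Set.Ioo (0 : ℝ) 1) (A : Set (E (m + 1))) :
    ENNReal.ofReal (t ^ m) * surfaceOn S ((fun y => p + t • (y - p)) ⁻¹' A ∩ S) ≤
      μHE[m] ((A ∩ C) ∩ AffineSubspace.mk' (t • v +ᵥ p) (ℝ ∙ v)ᗮ) := by
  have hh := euclideanHausdorffMeasure_homothety_image m p ht.1.ne'
    ((fun y => p + t • (y - p)) ⁻¹' A ∩ S)
  have e1 : ENNReal.ofReal (t ^ m) * surfaceOn S ((fun y => p + t • (y - p)) ⁻¹' A ∩ S) =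
      ‖t‖₊ ^ m • μHE[m] ((fun y => p + t • (y - p)) ⁻¹' A ∩ S) := by
    rw [surfaceOn, Measure.restrict_apply' h.closed.measurableSet, Set.inter_assoc, Set.inter_self,
      Nat.add_sub_cancel, ENNReal.smul_def, smul_eq_mul, ENNReal.coe_pow, ENNReal.ofReal_pow ht.1.le]
    congr 2
    rw [← Real.enorm_of_nonneg ht.1.le]; rfl
  rw [e1, ← hh]
  refine measure_mono ?_
  rintro _ ⟨y, ⟨hyA, hyS⟩, rfl⟩
  have e2 : AffineMap.homothety p t y = p + t • (y - p) := by
    rw [AffineMap.homothety_apply, vsub_eq_sub, vadd_eq_add]; abel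
  rw [e2]
  refine ⟨⟨hyA, h.homothety_mem ht hyS⟩, ?_⟩
  rw [SetLike.mem_coe, AffineSubspace.mem_mk', Submodule.mem_orthogonal_singleton_iff_inner_left]
  have e3 : (p + t • (y - p)) -ᵥ (t • v +ᵥ p) = t • ((y - p) - v) := by
    rw [vsub_eq_sub, vadd_eq_add]; module
  rw [e3, real_inner_smul_left, inner_sub_left, h.height y hyS, real_inner_self_eq_norm_sq, sub_self,
    mul_zero]

theorem volume_eq (h : IsCone p v S C) {A : Set (E (m + 1))} (hA : MeasurableSet A) :
    volume A = ‖v‖ₑ * ∫⁻ t : ℝ, μHE[m] (A ∩ AffineSubspace.mk' (t • v +ᵥ p) (ℝ ∙ v)ᗮ) := by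
  have := EuclideanGeometry.euclideanHausdorffMeasure_eq_lintegral p h.ne hA
  simpa [EuclideanSpace.euclideanHausdorffMeasure_eq_volume] using this

theorem lintegral_slice_le (h : IsCone p v S C) {A : Set (E (m + 1))} (hA : MeasurableSet A) :
    ‖v‖ₑ * ∫⁻ t in Set.Ioo (0 : ℝ) 1, ENNReal.ofReal (t ^ m) *
      surfaceOn S ((fun y => p + t • (y - p)) ⁻¹' A ∩ S) ≤ volume (A ∩ C) := by
  rw [h.volume_eq (hA.inter h.compact.isClosed.measurableSet)]
  refine mul_le_mul_right ?_ _
  refine (setLIntegral_mono' measurableSet_Ioo fun t ht => h.slice_le ht A).trans ?_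
  exact setLIntegral_le_lintegral _ _

/-- If S had infinite surface measure, every slice would too, and the compact cone would have
infinite volume. Finiteness is needed for Fubini's theorem and to place continuous functions in L²
of a face. -/
theorem isFiniteMeasure (h : IsCone p v S C) : IsFiniteMeasure (surfaceOn S) := by
  refine ⟨?_⟩
  by_contra htop
  rw [not_lt, top_le_iff] at htop
  have h1 := h.lintegral_slice_le MeasurableSet.univ
  have hS : surfaceOn S S = ⊤ := by
    rw [← htop, surfaceOn, Measure.restrict_apply_self, Measure.restrict_apply_univ]
  simp only [Set.preimage_univ, Set.univ_inter, hS] at h1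
  have h2 : ∫⁻ t in Set.Ioo (0 : ℝ) 1, ENNReal.ofReal (t ^ m) * ⊤ = ⊤ := by
    have : ∫⁻ t in Set.Ioo (0 : ℝ) 1, ENNReal.ofReal (t ^ m) * ⊤ =
        ∫⁻ _ in Set.Ioo (0 : ℝ) 1, ⊤ := by
      refine setLIntegral_congr_fun measurableSet_Ioo fun t ht => ?_
      exact ENNReal.mul_top (by simpa using pow_pos ht.1 m)
    rw [this]; simp
  rw [h2, ENNReal.mul_top (by simpa using h.ne), top_le_iff] at h1
  exact h.compact.measure_lt_top.ne h1

/-- Integration in polar coordinates about the apex. -/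
theorem lintegral_le (h : IsCone p v S C) {f : E (m + 1) → ENNReal} (hf : Measurable f) :
    ‖v‖ₑ * ∫⁻ y, (∫⁻ t in Set.Ioo (0 : ℝ) 1, ENNReal.ofReal (t ^ m) * f (p + t • (y - p)))
      ∂surfaceOn S ≤ ∫⁻ x in C, f x := by
  have := h.isFiniteMeasure
  set μ : Measure ℝ := (volume.restrict (Set.Ioo (0 : ℝ) 1)).withDensity
    fun t => ENNReal.ofReal (t ^ m) with hμ
  have hden : Measurable fun t : ℝ => ENNReal.ofReal (t ^ m) := by fun_prop
  have : SFinite μ := by rw [hμ]; infer_instance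
  set g : E (m + 1) × ℝ → E (m + 1) := fun q => p + q.2 • (q.1 - p) with hg
  have hgm : Measurable g := by fun_prop
  set ν := ((surfaceOn S).prod μ).map g with hν
  -- It suffices to compare measures: the image of dS ⊗ t ^ m dt under (y, t) ↦ p + t (y - p),
  -- multiplied by the height, is dominated by volume on the cone. The slice bound says this on
  -- measurable sets.
  have hle : ‖v‖ₑ • ν ≤ volume.restrict C := by
    refine Measure.le_iff.2 fun A hA => ?_
    rw [Measure.restrict_apply hA]
    refine le_trans (le_of_eq ?_) (h.lintegral_slice_le hA)
    rw [Measure.smul_apply, smul_eq_mul, hν, Measure.map_apply hgm hA,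
      Measure.prod_apply_symm (hgm hA), hμ,
      lintegral_withDensity_eq_lintegral_mul₀ hden.aemeasurable
        (measurable_measure_prodMk_right (hgm hA)).aemeasurable]
    congr 1
    refine lintegral_congr fun t => ?_
    simp only [Pi.mul_apply]
    congr 1
    rw [surfaceOn, Measure.restrict_apply' h.closed.measurableSet,
      Measure.restrict_apply' h.closed.measurableSet, Set.inter_assoc, Set.inter_self]
    rfl
  have h2 := lintegral_mono' hle (le_refl f)
  refine le_trans (le_of_eq ?_) h2
  rw [lintegral_smul_measure, smul_eq_mul, hν, lintegral_map hf hgm,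
    lintegral_prod (fun z => f (g z)) (hf.comp hgm).aemeasurable]
  congr 1
  refine lintegral_congr fun y => ?_
  have hfy : Measurable fun t : ℝ => f (p + t • (y - p)) := by fun_prop
  rw [hμ, lintegral_withDensity_eq_lintegral_mul₀ hden.aemeasurable hfy.aemeasurable]
  rfl

/-- Fundamental theorem of calculus for t ^ (m + 1) f² along the segment from p to y. In the
coefficient m + 2, the part m + 1 comes from differentiating the power and 1 from 2ab ≤ a² + b². -/
theorem sq_le (f : E (m + 1) → ℝ) (hf : ContDiff ℝ 1 f) (p y : E (m + 1)) (D : ℝ)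
    (hD : ‖y - p‖ ≤ D) :
    ENNReal.ofReal (f y ^ 2) ≤ ∫⁻ t in Set.Ioo (0 : ℝ) 1, ENNReal.ofReal (t ^ m) *
      ENNReal.ofReal ((m + 2) * f (p + t • (y - p)) ^ 2 +
        D ^ 2 * ‖fderiv ℝ f (p + t • (y - p))‖ ^ 2) := by
  set γ : ℝ → E (m + 1) := fun t => p + t • (y - p) with hγ
  have hγc : Continuous γ := by fun_prop
  -- The exponent m + 1 makes the contribution of the apex t = 0 vanish, while the derivative still
  -- carries the polar weight t ^ m.
  have hd : ∀ t : ℝ, HasDerivAt (fun t => t ^ (m + 1) * f (γ t) ^ 2)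
      (((m + 1 : ℕ) : ℝ) * t ^ m * f (γ t) ^ 2 +
        t ^ (m + 1) * (2 * f (γ t) * fderiv ℝ f (γ t) (y - p))) t := by
    intro t
    have h1 : HasDerivAt γ (y - p) t := by
      have := ((hasDerivAt_id t).smul_const (y - p)).const_add p
      rwa [one_smul] at this
    have h2 : HasDerivAt (fun t => f (γ t)) (fderiv ℝ f (γ t) (y - p)) t :=
      ((hf.differentiable one_ne_zero) (γ t)).hasFDerivAt.comp_hasDerivAt t h1
    have h3 := (hasDerivAt_pow (m + 1) t).mul (h2.pow 2)
    refine h3.congr_deriv ?_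
    simp
  have hfd : Continuous fun t => fderiv ℝ f (γ t) := (hf.continuous_fderiv one_ne_zero).comp hγc
  have hfc : Continuous fun t => f (γ t) := hf.continuous.comp hγc
  have hfe : Continuous fun t => fderiv ℝ f (γ t) (y - p) := hfd.clm_apply continuous_const
  have hint : Continuous fun t : ℝ => ((m + 1 : ℕ) : ℝ) * t ^ m * f (γ t) ^ 2 +
        t ^ (m + 1) * (2 * f (γ t) * fderiv ℝ f (γ t) (y - p)) := by fun_prop
  have hFTC := intervalIntegral.integral_eq_sub_of_hasDerivAt (fun t _ => hd t)
    (hint.intervalIntegrable 0 1)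
  have hγ1 : γ 1 = y := by simp [hγ]
  have hfn : Continuous fun t => t ^ m * ((m + 2) * f (γ t) ^ 2 + D ^ 2 * ‖fderiv ℝ f (γ t)‖ ^ 2) := by
    fun_prop
  have hle : f y ^ 2 ≤ ∫ t in (0 : ℝ)..1, t ^ m * ((m + 2) * f (γ t) ^ 2 +
      D ^ 2 * ‖fderiv ℝ f (γ t)‖ ^ 2) := by
    have : f y ^ 2 = (fun t => t ^ (m + 1) * f (γ t) ^ 2) 1 - (fun t => t ^ (m + 1) * f (γ t) ^ 2) 0 := by
      simp [hγ1]
    rw [this, ← hFTC]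
    refine intervalIntegral.integral_mono_on zero_le_one (hint.intervalIntegrable 0 1)
      (hfn.intervalIntegrable 0 1) fun t ht => ?_
    set a := f (γ t)
    set b := fderiv ℝ f (γ t) (y - p)
    have hb : b ^ 2 ≤ D ^ 2 * ‖fderiv ℝ f (γ t)‖ ^ 2 := by
      have h1 : |b| ≤ ‖fderiv ℝ f (γ t)‖ * ‖y - p‖ := (fderiv ℝ f (γ t)).le_opNorm _
      have h2 : |b| ≤ D * ‖fderiv ℝ f (γ t)‖ := by
        refine h1.trans ?_
        rw [mul_comm]; gcongr
      rw [← mul_pow, ← sq_abs b]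
      gcongr
    have htm : 0 ≤ t ^ m := pow_nonneg ht.1 m
    have h3 : t * (2 * a * b) ≤ a ^ 2 + b ^ 2 := by
      have : t * (2 * a * b) ≤ |2 * a * b| := by
        calc t * (2 * a * b) ≤ |t * (2 * a * b)| := le_abs_self _
          _ = t * |2 * a * b| := by rw [abs_mul, abs_of_nonneg ht.1]
          _ ≤ 1 * |2 * a * b| := by gcongr; exact ht.2
          _ = _ := one_mul _
      refine this.trans (abs_le.2 ⟨by nlinarith [sq_nonneg (a + b)], by nlinarith [sq_nonneg (a - b)]⟩)
    have h4 : ((m + 1 : ℕ) : ℝ) * t ^ m * a ^ 2 + t ^ (m + 1) * (2 * a * b) =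
        t ^ m * ((m + 1) * a ^ 2 + t * (2 * a * b)) := by push_cast; ring
    rw [h4]
    refine mul_le_mul_of_nonneg_left ?_ htm
    linarith
  refine (ENNReal.ofReal_le_ofReal hle).trans (le_of_eq ?_)
  rw [intervalIntegral.integral_of_le zero_le_one, integral_Ioc_eq_integral_Ioo,
    ofReal_integral_eq_lintegral_ofReal]
  · refine setLIntegral_congr_fun measurableSet_Ioo fun t ht => ?_
    exact ENNReal.ofReal_mul (pow_nonneg ht.1.le m)
  · exact (hfn.integrableOn_Icc (a := 0) (b := 1)).mono_set Set.Ioo_subset_Icc_self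
  · refine (ae_restrict_iff' measurableSet_Ioo).2 (Eventually.of_forall fun t ht => ?_)
    have := pow_nonneg ht.1.le m
    change 0 ≤ t ^ m * _
    positivity

/-- The trace inequality for smooth functions on a cone. -/
theorem trace_inequality (h : IsCone p v S C) {f : E (m + 1) → ℝ} (hf : ContDiff ℝ 1 f) {D : ℝ}
    (hD : ∀ y ∈ S, ‖y - p‖ ≤ D) :
    ‖v‖ * ∫ y, f y ^ 2 ∂surfaceOn S ≤
      ∫ x in C, ((m + 2) * f x ^ 2 + D ^ 2 * ‖fderiv ℝ f x‖ ^ 2) := by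
  have := h.isFiniteMeasure
  have hfd : Continuous fun x => fderiv ℝ f x := hf.continuous_fderiv one_ne_zero
  have hfc := hf.continuous
  set G : E (m + 1) → ℝ := fun x => (m + 2) * f x ^ 2 + D ^ 2 * ‖fderiv ℝ f x‖ ^ 2 with hG
  have hGc : Continuous G := by fun_prop
  have hG0 : ∀ x, 0 ≤ G x := fun x => by simp only [hG]; positivity
  have hGi : IntegrableOn G C := hGc.continuousOn.integrableOn_compact h.compact
  have key : ‖v‖ₑ * ∫⁻ y, ENNReal.ofReal (f y ^ 2) ∂surfaceOn S ≤
      ∫⁻ x in C, ENNReal.ofReal (G x) := by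
    refine le_trans ?_ (h.lintegral_le (f := fun x => ENNReal.ofReal (G x))
      hGc.measurable.ennreal_ofReal)
    refine mul_le_mul_right ?_ _
    refine lintegral_mono_ae ?_
    rw [surfaceOn]
    refine (ae_restrict_iff' h.closed.measurableSet).2 (Eventually.of_forall fun y hy => ?_)
    exact sq_le f hf p y D (hD y hy)
  rw [← ofReal_integral_eq_lintegral_ofReal hGi (Eventually.of_forall hG0)] at key
  rw [integral_eq_lintegral_of_nonneg_ae (Eventually.of_forall fun y => sq_nonneg _)
    (hfc.pow 2).aestronglyMeasurable]
  have h2 := ENNReal.toReal_mono ENNReal.ofReal_ne_top key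
  rwa [ENNReal.toReal_mul, toReal_enorm,
    ENNReal.toReal_ofReal (integral_nonneg hG0)] at h2

end IsCone
-- Weak derivatives: uniqueness and agreement with classical ones
section WeakDerivative

variable {d : ℕ} {U : Set (E d)} {i : Fin d} {v w g g' : E d → ℝ}

/-- The fundamental lemma of the calculus of variations. Since `weakPartial` is an arbitrary choice,
uniqueness is the only way to identify it. -/
theorem IsWeakPartial.ae_eq (hU : IsOpen U) (hg : MemLp g 2 (volume.restrict U))
    (hg' : MemLp g' 2 (volume.restrict U)) (h : IsWeakPartial U i v g)
    (h' : IsWeakPartial U i v g') : g =ᵐ[volume.restrict U] g' := by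
  have hli : LocallyIntegrable (fun x => g x - g' x) (volume.restrict U) :=
    (hg.sub hg').locallyIntegrable one_le_two
  have hlo : LocallyIntegrableOn (fun x => g x - g' x) U volume := by
    intro x hx
    obtain ⟨s, hs, hi⟩ := hli x
    refine ⟨U ∩ s, inter_mem_nhdsWithin U hs, ?_⟩
    rw [IntegrableOn, ← Measure.restrict_restrict_of_subset (Set.inter_subset_left)]
    exact hi.mono_set Set.inter_subset_right
  have := hU.ae_eq_zero_of_integral_contDiff_smul_eq_zero hlo (fun φ hφ hc hs => by
    have e1 := h φ hφ hc hs
    have e2 := h' φ hφ hc hs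
    have hφL : MemLp φ 2 (volume.restrict U) :=
      (hφ.continuous.memLp_of_hasCompactSupport hc).restrict U
    have e3 : ∫ x in U, φ x * g x = ∫ x in U, φ x * g' x := by
      simp only [mul_comm (φ _)]
      linarith
    rw [← setIntegral_eq_integral_of_forall_compl_eq_zero (s := U)]
    · simp only [smul_eq_mul, mul_sub]
      have e4 := integral_sub (hφL.integrable_mul hg) (hφL.integrable_mul hg')
      simp only [Pi.mul_apply] at e4
      rw [e4, e3, sub_self]
    · intro x hx
      rw [image_eq_zero_of_notMem_tsupport (fun h => hx (hs h)), zero_smul])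
  rw [Filter.EventuallyEq, ae_restrict_iff' hU.measurableSet]
  filter_upwards [this] with x hx hxU
  exact sub_eq_zero.1 (hx hxU)

theorem IsWeakPartial.congr (hv : v =ᵐ[volume.restrict U] w) (hg : g =ᵐ[volume.restrict U] g')
    (h : IsWeakPartial U i v g) : IsWeakPartial U i w g' := by
  intro φ hφ hc hs
  have e1 : ∫ x in U, w x * fderiv ℝ φ x (EuclideanSpace.single i 1) =
      ∫ x in U, v x * fderiv ℝ φ x (EuclideanSpace.single i 1) :=
    integral_congr_ae (by filter_upwards [hv] with x hx; rw [hx])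
  have e2 : ∫ x in U, g' x * φ x = ∫ x in U, g x * φ x :=
    integral_congr_ae (by filter_upwards [hg] with x hx; rw [hx])
  rw [e1, e2, h φ hφ hc hs]

theorem HasL2Partial.memLp (h : HasL2Partial U i v) :
    MemLp (weakPartial U i v) 2 (volume.restrict U) := by
  rw [weakPartial, dif_pos h]; exact h.choose_spec.1

theorem HasL2Partial.isWeakPartial (h : HasL2Partial U i v) :
    IsWeakPartial U i v (weakPartial U i v) := by
  rw [weakPartial, dif_pos h]; exact h.choose_spec.2

theorem IsWeakPartial.weakPartial_ae_eq (hU : IsOpen U) (hg : MemLp g 2 (volume.restrict U))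
    (h : IsWeakPartial U i v g) : weakPartial U i v =ᵐ[volume.restrict U] g := by
  have h1 : HasL2Partial U i v := ⟨g, hg, h⟩
  exact h1.isWeakPartial.ae_eq hU h1.memLp hg h

/-- The test function vanishes off U, so the integration by parts takes place on the whole space and
no regularity of the boundary of U enters. -/
theorem isWeakPartial_of_contDiff (hv : ContDiff ℝ 1 v) :
    IsWeakPartial U i v fun x => fderiv ℝ v x (EuclideanSpace.single i 1) := by
  intro φ hφ hc hs
  have hφ1 : ContDiff ℝ 1 φ := hφ.of_le (by exact_mod_cast le_top)
  have hfd : Continuous fun x => fderiv ℝ v x := hv.continuous_fderiv one_ne_zero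
  have hfd' : Continuous fun x => fderiv ℝ φ x := hφ1.continuous_fderiv one_ne_zero
  have hvc := hv.continuous
  have hφc := hφ.continuous
  have hc' : HasCompactSupport fun x => fderiv ℝ φ x (EuclideanSpace.single i 1) :=
    hc.fderiv_apply ℝ _
  rw [setIntegral_eq_integral_of_forall_compl_eq_zero,
    setIntegral_eq_integral_of_forall_compl_eq_zero]
  · refine integral_mul_fderiv_eq_neg_fderiv_mul_of_integrable ?_ ?_ ?_
      (fun x _ => hv.differentiable one_ne_zero x) (fun x _ => hφ1.differentiable one_ne_zero x)
    · exact Continuous.integrable_of_hasCompactSupport (by fun_prop) hc.mul_left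
    · exact Continuous.integrable_of_hasCompactSupport (by fun_prop) hc'.mul_left
    · exact Continuous.integrable_of_hasCompactSupport (by fun_prop) hc.mul_left
  · intro x hx
    rw [image_eq_zero_of_notMem_tsupport (fun h => hx (hs h)), mul_zero]
  · intro x hx
    have : fderiv ℝ φ x = 0 := by
      by_contra h
      exact hx (hs (support_fderiv_subset ℝ h))
    simp [this]

end WeakDerivative

/-! ### Continuous and C¹ functions on an element -/

section Elements

variable {d : ℕ} {K : Finset (E d)}

theorem memLp_openElement_of_continuous {f : E d → ℝ} (hf : Continuous f) (K : Finset (E d)) :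
    MemLp f 2 (volume.restrict (openElement K)) := by
  obtain ⟨C, hC⟩ := (isCompact_closedSimplex K).exists_bound_of_continuousOn hf.continuousOn
  refine MemLp.of_bound hf.aestronglyMeasurable C ?_
  exact (ae_restrict_iff' (isOpen_openElement K).measurableSet).2
    (Eventually.of_forall fun x hx => hC x (openElement_subset K hx))

theorem setIntegral_openElement (K : Finset (E d)) (f : E d → ℝ) :
    ∫ x in openElement K, f x = ∫ x in closedSimplex K, f x :=
  setIntegral_congr_set (openElement_ae_eq K)

theorem weakPartial_ae_eq_of_contDiff {v f : E d → ℝ} (hf : ContDiff ℝ 1 f)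
    (hv : v =ᵐ[volume.restrict (openElement K)] f) (i : Fin d) :
    HasL2Partial (openElement K) i v ∧ weakPartial (openElement K) i v =ᵐ[volume.restrict (openElement K)]
      fun x => fderiv ℝ f x (EuclideanSpace.single i 1) := by
  have hL : MemLp (fun x => fderiv ℝ f x (EuclideanSpace.single i 1)) 2
      (volume.restrict (openElement K)) :=
    memLp_openElement_of_continuous
      ((hf.continuous_fderiv one_ne_zero).clm_apply continuous_const) K
  have hW : IsWeakPartial (openElement K) i v fun x => fderiv ℝ f x (EuclideanSpace.single i 1) :=
    (isWeakPartial_of_contDiff hf).congr hv.symm (EventuallyEq.refl _ _)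
  exact ⟨⟨_, hL, hW⟩, hW.weakPartial_ae_eq (isOpen_openElement K) hL⟩

theorem memH1_of_contDiff {v f : E d → ℝ} (hf : ContDiff ℝ 1 f)
    (hv : v =ᵐ[volume.restrict (openElement K)] f) : MemH1 (openElement K) v :=
  ⟨(memLp_openElement_of_continuous hf.continuous K).ae_eq hv.symm,
    fun i => (weakPartial_ae_eq_of_contDiff hf hv i).1⟩

end Elements

/-! ### Polynomials as functions on elements and their weak derivatives -/

section Polynomials

variable {d : ℕ}

/-- The polynomial function on `ℝ^d` given by `p`. -/
noncomputable def polyFun (p : MvPolynomial (Fin d) ℝ) (x : E d) : ℝ := p.eval fun i => x i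

theorem contDiff_polyFun (p : MvPolynomial (Fin d) ℝ) {n : WithTop ℕ∞} :
    ContDiff ℝ n (polyFun p) := by
  induction p using MvPolynomial.induction_on with
  | C a =>
    have : polyFun (MvPolynomial.C a) = fun _ : E d => a := by ext; simp [polyFun]
    rw [this]; exact contDiff_const
  | add p q hp hq =>
    have : polyFun (p + q) = fun x => polyFun p x + polyFun q x := by ext; simp [polyFun]
    rw [this]; exact hp.add hq
  | mul_X p i hp =>
    have : polyFun (p * MvPolynomial.X i) = fun x => polyFun p x * x i := by ext; simp [polyFun]
    rw [this]; exact hp.mul (by fun_prop)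

theorem fderiv_polyFun (p : MvPolynomial (Fin d) ℝ) (i : Fin d) (x : E d) :
    fderiv ℝ (polyFun p) x (EuclideanSpace.single i 1) = polyFun (MvPolynomial.pderiv i p) x := by
  have hd : ∀ q : MvPolynomial (Fin d) ℝ, DifferentiableAt ℝ (polyFun q) x := fun q =>
    (contDiff_polyFun q (n := 1)).differentiable one_ne_zero x
  induction p using MvPolynomial.induction_on with
  | C a =>
    have : polyFun (MvPolynomial.C a) = fun _ : E d => a := by ext; simp [polyFun]
    rw [this]; simp [polyFun]
  | add p q hp hq =>
    have : polyFun (p + q) = fun x => polyFun p x + polyFun q x := by ext; simp [polyFun]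
    rw [this, fderiv_fun_add (hd p) (hd q), add_apply, hp, hq]
    simp [polyFun]
  | mul_X p j hp =>
    have : polyFun (p * MvPolynomial.X j) = fun x => polyFun p x * x j := by ext; simp [polyFun]
    have hj : HasFDerivAt (fun x : E d => x j) (EuclideanSpace.proj j : E d →L[ℝ] ℝ) x :=
      (EuclideanSpace.proj j : E d →L[ℝ] ℝ).hasFDerivAt
    rw [this, ((hd p).hasFDerivAt.fun_mul hj).fderiv]
    simp only [add_apply, smul_apply, hp, smul_eq_mul, Derivation.leibniz, MvPolynomial.pderiv_X]
    by_cases hij : j = i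
    · subst hij; simp [polyFun]
    · simp [polyFun, hij]

theorem totalDegree_pderiv_le (p : MvPolynomial (Fin d) ℝ) (i : Fin d) :
    (MvPolynomial.pderiv i p).totalDegree ≤ p.totalDegree := by
  classical
  refine Finset.sup_le fun s hs => ?_
  rw [MvPolynomial.mem_support_iff, MvPolynomial.coeff_pderiv] at hs
  have hmem : s + Finsupp.single i 1 ∈ p.support := MvPolynomial.mem_support_iff.2 (left_ne_zero_of_mul hs)
  refine le_trans ?_ (MvPolynomial.le_totalDegree hmem)
  rw [Finsupp.sum_add_index' (fun _ => rfl) (fun _ _ _ => rfl)]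
  exact Nat.le_add_right _ _

theorem memLp_polyFun (p : MvPolynomial (Fin d) ℝ) (K : Finset (E d)) :
    MemLp (polyFun p) 2 (volume.restrict (openElement K)) :=
  memLp_openElement_of_continuous (contDiff_polyFun p (n := 0)).continuous K

/-- Hypothesis and conclusion have the same almost-everywhere form, so the lemma can be iterated to
reach second derivatives. -/
theorem weakPartial_polyFun {K : Finset (E d)} {v : E d → ℝ} {p : MvPolynomial (Fin d) ℝ}
    (hv : v =ᵐ[volume.restrict (openElement K)] polyFun p) (i : Fin d) :
    weakPartial (openElement K) i v =ᵐ[volume.restrict (openElement K)]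
      polyFun (MvPolynomial.pderiv i p) := by
  have := (weakPartial_ae_eq_of_contDiff (contDiff_polyFun p) hv i).2
  simpa only [fderiv_polyFun] using this

theorem memH1_of_polyFun {K : Finset (E d)} {v : E d → ℝ} {p : MvPolynomial (Fin d) ℝ}
    (hv : v =ᵐ[volume.restrict (openElement K)] polyFun p) : MemH1 (openElement K) v :=
  memH1_of_contDiff (contDiff_polyFun p) hv

theorem memH2_of_polyFun {K : Finset (E d)} {v : E d → ℝ} {p : MvPolynomial (Fin d) ℝ}
    (hv : v =ᵐ[volume.restrict (openElement K)] polyFun p) : MemH2 (openElement K) v :=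
  ⟨memH1_of_polyFun hv, fun i => memH1_of_polyFun (weakPartial_polyFun hv i)⟩

theorem h1SemiSq_polyFun {K : Finset (E d)} {v : E d → ℝ} {p : MvPolynomial (Fin d) ℝ}
    (hv : v =ᵐ[volume.restrict (openElement K)] polyFun p) :
    h1SemiSq (openElement K) v =
      ∑ i, ∫ x in openElement K, polyFun (MvPolynomial.pderiv i p) x ^ 2 := by
  refine Finset.sum_congr rfl fun i _ => integral_congr_ae ?_
  filter_upwards [weakPartial_polyFun hv i] with x hx
  rw [hx]

end Polynomials

/-! ### Continuity of translations and dilations in L², and mollification -/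

section Mollification

theorem eLpNorm_two_sq {α : Type*} [MeasurableSpace α] (μ : Measure α) (f : α → ℝ) :
    eLpNorm f 2 μ ^ 2 = ∫⁻ x, ‖f x‖ₑ ^ 2 ∂μ := by
  have := eLpNorm_nnreal_pow_eq_lintegral (f := f) (μ := μ) (p := 2) two_ne_zero
  simpa using this

theorem eLpNorm_two_le_iff {α : Type*} [MeasurableSpace α] (μ : Measure α) (f : α → ℝ)
    (ε : ENNReal) : eLpNorm f 2 μ ≤ ε ↔ ∫⁻ x, ‖f x‖ₑ ^ 2 ∂μ ≤ ε ^ 2 := by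
  rw [← eLpNorm_two_sq]
  exact (ENNReal.pow_le_pow_left_iff two_ne_zero).symm

/-- Jensen's inequality, obtained from the monotonicity of L^p norms over a probability measure. -/
theorem enorm_integral_sq_le {α : Type*} [MeasurableSpace α] (μ : Measure α)
    [IsProbabilityMeasure μ] {f : α → ℝ} (hf : AEStronglyMeasurable f μ) :
    ‖∫ x, f x ∂μ‖ₑ ^ 2 ≤ ∫⁻ x, ‖f x‖ₑ ^ 2 ∂μ := by
  rw [← eLpNorm_two_sq]
  gcongr
  refine (enorm_integral_le_lintegral_enorm f).trans ?_
  rw [← eLpNorm_one_eq_lintegral_enorm]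
  exact eLpNorm_le_eLpNorm_of_exponent_le one_le_two hf

variable {d : ℕ}

theorem lintegral_comp_smul_add (F : E d → ENNReal) (hF : Measurable F) {t : ℝ} (ht : t ≠ 0)
    (b : E d) : ∫⁻ x, F (t • x + b) = ENNReal.ofReal |(t ^ d)⁻¹| * ∫⁻ x, F x := by
  have h1 : ∫⁻ x, F (t • x + b) = ∫⁻ y, F (y + b) ∂(Measure.map (t • ·) (volume : Measure (E d))) := by
    rw [lintegral_map (by fun_prop) (by fun_prop)]
  rw [h1, Measure.map_addHaar_smul _ ht, lintegral_smul_measure, lintegral_add_right_eq_self,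
    finrank_euclideanSpace_fin, smul_eq_mul]

/-- Continuity in `L²` of the action of dilations and translations. -/
theorem exists_eLpNorm_comp_sub_le {w : E d → ℝ} (hw : MemLp w 2 volume) (hwm : Measurable w)
    {U : Set (E d)} (hU : Bornology.IsBounded U) (hUm : MeasurableSet U) (c : E d) {ε : ℝ}
    (hε : 0 < ε) :
    ∃ δ > 0, ∀ t : ℝ, 1 - δ < t → t < 1 → ∀ z : E d, ‖z‖ ≤ δ →
      eLpNorm (fun x => w (c + t • (x - c) - z) - w x) 2 (volume.restrict U) ≤
        ENNReal.ofReal ε := by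
  obtain ⟨R, hR0, hR⟩ := hU.subset_closedBall_lt 0 c
  -- This bounds the Jacobian factor t ^ (-d) for the dilations considered, which have t ≥ 1/2.
  set M : ℝ := 2 ^ d with hM
  have hMpos : 0 < M := by positivity
  have hM1 : 1 ≤ M := one_le_pow₀ one_le_two
  set V := (volume U).toReal with hV
  have hUtop : volume U ≠ ⊤ := hU.measure_lt_top.ne
  set η := ε / (3 * M) with hη
  have hηpos : 0 < η := by positivity
  -- Three-part argument: w is replaced by a continuous compactly supported f before and after the
  -- change of variables, and f itself is uniformly continuous.
  obtain ⟨f, hfc, hfe, hfcont, hfL⟩ := hw.exists_hasCompactSupport_eLpNorm_sub_le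
    (by simp) (show ENNReal.ofReal η ≠ 0 by simpa using hηpos)
  have hfm : Measurable f := hfcont.measurable
  set κ := ε / (3 * (V + 1)) with hκ
  have hV0 : 0 ≤ V := ENNReal.toReal_nonneg
  have hκpos : 0 < κ := by positivity
  obtain ⟨δ₀, hδ₀, hfu⟩ := Metric.uniformContinuous_iff.1
    (hfc.uniformContinuous_of_continuous hfcont) κ hκpos
  -- A point of U lies within R of c, so it is displaced by at most (1 - t) R + δ ≤ δ (R + 1), which
  -- is less than δ₀.
  refine ⟨min (1 / 2) (δ₀ / (2 * (R + 1))), by positivity, fun t ht1 ht2 z hz => ?_⟩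
  set δ := min (1 / 2 : ℝ) (δ₀ / (2 * (R + 1))) with hδ
  have hδ1 : δ ≤ 1 / 2 := min_le_left _ _
  have hδ2 : δ * (2 * (R + 1)) ≤ δ₀ := by
    rw [← le_div_iff₀ (by positivity)]; exact min_le_right _ _
  have ht : 1 / 2 ≤ t := by linarith
  have htpos : 0 < t := by linarith
  have hz0 := norm_nonneg z
  set T : E d → E d := fun x => c + t • (x - c) - z with hT
  have hTm : Measurable T := by fun_prop
  have hTeq : ∀ x, T x = t • x + (c - t • c - z) := fun x => by simp only [hT]; module
  have e1 : eLpNorm (fun x => w (T x) - f (T x)) 2 (volume.restrict U) ≤ ENNReal.ofReal (ε / 3) := by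
    rw [eLpNorm_two_le_iff]
    calc ∫⁻ x in U, ‖w (T x) - f (T x)‖ₑ ^ 2 ≤ ∫⁻ x, ‖w (T x) - f (T x)‖ₑ ^ 2 :=
          setLIntegral_le_lintegral _ _
      _ = ENNReal.ofReal |(t ^ d)⁻¹| * ∫⁻ x, ‖w x - f x‖ₑ ^ 2 := by
          simp only [hTeq]
          exact lintegral_comp_smul_add (fun x => ‖w x - f x‖ₑ ^ 2)
            ((hwm.sub hfm).enorm.pow_const 2) htpos.ne' _
      _ ≤ ENNReal.ofReal M * ENNReal.ofReal η ^ 2 := by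
          refine mul_le_mul' (ENNReal.ofReal_le_ofReal ?_) ((eLpNorm_two_le_iff _ _ _).1 hfe)
          rw [abs_of_pos (by positivity), hM, ← inv_pow]
          refine pow_le_pow_left₀ (by positivity) ?_ d
          rw [inv_le_comm₀ htpos two_pos]
          linarith
      _ ≤ ENNReal.ofReal (ε / 3) ^ 2 := by
          rw [← ENNReal.ofReal_pow hηpos.le, ← ENNReal.ofReal_mul hMpos.le,
            ← ENNReal.ofReal_pow (by positivity)]
          refine ENNReal.ofReal_le_ofReal ?_
          have : M * η = ε / 3 := by rw [hη]; field_simp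
          calc M * η ^ 2 ≤ M * η ^ 2 * M := le_mul_of_one_le_right (by positivity) hM1
            _ = (M * η) ^ 2 := by ring
            _ = (ε / 3) ^ 2 := by rw [this]
  have e2 : eLpNorm (fun x => f (T x) - f x) 2 (volume.restrict U) ≤ ENNReal.ofReal (ε / 3) := by
    have hb : ∀ᵐ x ∂volume.restrict U, ‖f (T x) - f x‖ ≤ κ := by
      refine (ae_restrict_iff' hUm).2 (Eventually.of_forall fun x hx => ?_)
      have hxc : ‖x - c‖ ≤ R := by simpa [dist_eq_norm] using hR hx
      have hd : dist (T x) x < δ₀ := by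
        rw [dist_eq_norm]
        have : T x - x = (t - 1) • (x - c) - z := by simp only [hT]; module
        rw [this]
        have h1 : ‖(t - 1) • (x - c) - z‖ ≤ (1 - t) * R + δ := by
          refine (norm_sub_le _ _).trans ?_
          rw [norm_smul, Real.norm_eq_abs, abs_of_neg (by linarith)]
          have : -(t - 1) * ‖x - c‖ ≤ (1 - t) * R := by
            rw [neg_sub]
            exact mul_le_mul_of_nonneg_left hxc (by linarith)
          linarith
        nlinarith
      have := hfu hd
      rw [dist_eq_norm] at this
      exact this.le
    refine (eLpNorm_le_of_ae_bound hb).trans ?_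
    rw [Measure.restrict_apply_univ, ENNReal.toReal_ofNat]
    have hVe : volume U ≤ ENNReal.ofReal (V + 1) := by
      rw [← ENNReal.ofReal_toReal hUtop]
      exact ENNReal.ofReal_le_ofReal (by linarith)
    -- Replacing V by V + 1 ≥ 1 allows the square root to be dropped.
    have hp : volume U ^ (2 : ℝ)⁻¹ ≤ ENNReal.ofReal (V + 1) := by
      refine (ENNReal.rpow_le_rpow hVe (by norm_num)).trans ?_
      have h1 : 1 ≤ ENNReal.ofReal (V + 1) := by
        rw [← ENNReal.ofReal_one]; exact ENNReal.ofReal_le_ofReal (by linarith)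
      calc ENNReal.ofReal (V + 1) ^ (2 : ℝ)⁻¹ ≤ ENNReal.ofReal (V + 1) ^ (1 : ℝ) :=
            ENNReal.rpow_le_rpow_of_exponent_le h1 (by norm_num)
        _ = _ := ENNReal.rpow_one _
    refine (mul_le_mul_left hp _).trans ?_
    rw [← ENNReal.ofReal_mul (by positivity)]
    refine ENNReal.ofReal_le_ofReal (le_of_eq ?_)
    rw [hκ]; field_simp
  have e3 : eLpNorm (fun x => f x - w x) 2 (volume.restrict U) ≤ ENNReal.ofReal (ε / 3) := by
    refine (eLpNorm_restrict_le _ _ _ _).trans ?_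
    have : eLpNorm (fun x => f x - w x) 2 volume = eLpNorm (w - f) 2 volume :=
      eLpNorm_sub_comm f w 2 volume
    rw [this]
    refine hfe.trans (ENNReal.ofReal_le_ofReal ?_)
    rw [hη]
    gcongr
    linarith
  have hsum : (fun x => w (T x) - w x) =
      (fun x => w (T x) - f (T x)) + ((fun x => f (T x) - f x) + fun x => f x - w x) := by
    ext x; simp
  change eLpNorm (fun x => w (T x) - w x) 2 _ ≤ _
  have hm1 : AEStronglyMeasurable (fun x => w (T x) - f (T x)) (volume.restrict U) := by fun_prop
  have hm2 : AEStronglyMeasurable (fun x => f (T x) - f x) (volume.restrict U) := by fun_prop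
  have hm3 : AEStronglyMeasurable (fun x => f x - w x) (volume.restrict U) := by fun_prop
  rw [hsum]
  refine (eLpNorm_add_le hm1 (hm2.add hm3) one_le_two).trans ?_
  refine (add_le_add e1 ((eLpNorm_add_le hm2 hm3 one_le_two).trans (add_le_add e2 e3))).trans ?_
  rw [← ENNReal.ofReal_add (by positivity) (by positivity),
    ← ENNReal.ofReal_add (by positivity) (by positivity)]
  exact ENNReal.ofReal_le_ofReal (by linarith)

/-- The mollification error is the average of w (a x - z) - w x over the probability measure ψ dz.
Jensen's inequality and Tonelli's theorem reduce its L² norm to that of each single shift. -/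
theorem eLpNorm_mollify_sub_le {w : E d → ℝ} (hwm : Measurable w) (hwl : LocallyIntegrable w)
    {ψ : E d → ℝ} (hψc : Continuous ψ) (hψs : HasCompactSupport ψ) (hψ0 : ∀ z, 0 ≤ ψ z)
    (hψ1 : ∫ z, ψ z = 1) {s : ℝ} (hs : ∀ z, ψ z ≠ 0 → ‖z‖ ≤ s) {a : E d → E d} (ha : Measurable a)
    (U : Set (E d)) {ε : ENNReal}
    (hε : ∀ z, ‖z‖ ≤ s → eLpNorm (fun x => w (a x - z) - w x) 2 (volume.restrict U) ≤ ε) :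
    eLpNorm (fun x => (∫ z, w z * ψ (a x - z)) - w x) 2 (volume.restrict U) ≤ ε := by
  set μ : Measure (E d) := volume.withDensity fun z => ENNReal.ofReal (ψ z) with hμ
  have hψm : Measurable fun z => ENNReal.ofReal (ψ z) := hψc.measurable.ennreal_ofReal
  have hprob : IsProbabilityMeasure μ := by
    refine ⟨?_⟩
    rw [hμ, withDensity_apply _ MeasurableSet.univ, Measure.restrict_univ,
      ← ofReal_integral_eq_lintegral_ofReal (hψc.integrable_of_hasCompactSupport hψs)
        (Eventually.of_forall hψ0), hψ1, ENNReal.ofReal_one]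
  have hint : ∀ y, Integrable (fun z => w (y - z)) μ := by
    intro y
    rw [hμ, integrable_withDensity_iff_integrable_smul' hψm (Eventually.of_forall fun _ =>
      ENNReal.ofReal_lt_top)]
    have h1 : Integrable (fun z => w z * ψ (y - z)) := by
      have := hψs.convolutionExists_right (ContinuousLinearMap.mul ℝ ℝ) hwl hψc y
      exact this
    have h2 := h1.comp_sub_left y
    refine h2.congr (Eventually.of_forall fun z => ?_)
    simp [ENNReal.toReal_ofReal (hψ0 z), mul_comm]
  have hrep : ∀ x, (∫ z, w z * ψ (a x - z)) - w x = ∫ z, (w (a x - z) - w x) ∂μ := by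
    intro x
    rw [integral_sub (hint _) (integrable_const _), integral_const, probReal_univ, one_smul, hμ,
      integral_withDensity_eq_integral_toReal_smul hψm
        (Eventually.of_forall fun _ => ENNReal.ofReal_lt_top)]
    congr 1
    rw [← integral_sub_left_eq_self (fun z => w z * ψ (a x - z)) volume (a x)]
    refine integral_congr_ae (Eventually.of_forall fun z => ?_)
    simp [ENNReal.toReal_ofReal (hψ0 z), mul_comm]
  rw [eLpNorm_two_le_iff]
  have hm : Measurable fun q : E d × E d => ‖w (a q.1 - q.2) - w q.1‖ₑ ^ 2 := by fun_prop
  calc ∫⁻ x in U, ‖(∫ z, w z * ψ (a x - z)) - w x‖ₑ ^ 2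
      ≤ ∫⁻ x in U, ∫⁻ z, ‖w (a x - z) - w x‖ₑ ^ 2 ∂μ := by
        refine lintegral_mono fun x => ?_
        rw [hrep x]
        exact enorm_integral_sq_le μ (Measurable.aestronglyMeasurable (by fun_prop))
    _ = ∫⁻ z, (∫⁻ x in U, ‖w (a x - z) - w x‖ₑ ^ 2) ∂μ :=
        lintegral_lintegral_swap hm.aemeasurable
    _ ≤ ∫⁻ _, ε ^ 2 ∂μ := by
        refine lintegral_mono_ae ?_
        rw [hμ, ae_withDensity_iff hψm]
        refine Eventually.of_forall fun z hz => ?_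
        refine (eLpNorm_two_le_iff _ _ _).1 (hε z (hs z fun h => hz (by simp [h])))
    _ = ε ^ 2 := by simp

/-- The derivative falls on ψ, and z ↦ ψ (y - z) is a legitimate test function because its support
stays in a ball inside U. The sign from the inner derivative cancels the one in the definition of
the weak derivative. -/
theorem fderiv_mollify {U : Set (E d)} (hU : IsOpen U) {v g : E d → ℝ} {i : Fin d}
    (h : IsWeakPartial U i v g) (hv : LocallyIntegrable (U.indicator v)) {ψ : E d → ℝ}
    (hψ : ContDiff ℝ ∞ ψ) (hψc : HasCompactSupport ψ) {s : ℝ} (hs : ∀ z, ψ z ≠ 0 → ‖z‖ ≤ s) {y : E d}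
    (hy : Metric.closedBall y s ⊆ U) :
    fderiv ℝ (fun y => ∫ z, U.indicator v z * ψ (y - z)) y (EuclideanSpace.single i 1) =
      ∫ z, U.indicator g z * ψ (y - z) := by
  have hψ1 : ContDiff ℝ 1 ψ := hψ.of_le (by exact_mod_cast le_top)
  have h1 := (hψc.hasFDerivAt_convolution_right (ContinuousLinearMap.mul ℝ ℝ) hv hψ1 y).fderiv
  have h2 : (fun y => ∫ z, U.indicator v z * ψ (y - z)) =
      convolution (U.indicator v) ψ (ContinuousLinearMap.mul ℝ ℝ) volume := rfl
  rw [h2, h1, convolution_precompR_apply _ hv (hψc.fderiv ℝ) (hψ1.continuous_fderiv one_ne_zero)]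
  set χ : E d → ℝ := fun z => ψ (y - z) with hχ
  have hχd : ∀ z, fderiv ℝ χ z (EuclideanSpace.single i 1) =
      -fderiv ℝ ψ (y - z) (EuclideanSpace.single i 1) := by
    intro z
    have h3 : HasFDerivAt (fun z : E d => y - z) (-ContinuousLinearMap.id ℝ (E d)) z :=
      (hasFDerivAt_id z).const_sub y
    have h4 := ((hψ1.differentiable one_ne_zero (y - z)).hasFDerivAt).comp z h3
    have h5 : fderiv ℝ χ z = _ := h4.fderiv
    rw [h5]; simp
  have hsupp : tsupport χ ⊆ Metric.closedBall y s := by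
    refine closure_minimal ?_ Metric.isClosed_closedBall
    intro z hz
    have := hs (y - z) hz
    rwa [Metric.mem_closedBall, dist_comm, dist_eq_norm]
  have hχc : HasCompactSupport χ :=
    HasCompactSupport.of_support_subset_isCompact (isCompact_closedBall y s)
      ((subset_tsupport χ).trans hsupp)
  have h6 := h χ (hψ.comp (contDiff_const.sub contDiff_id)) hχc (hsupp.trans hy)
  simp only [hχd, mul_neg, integral_neg, neg_inj] at h6
  have e1 : ∫ z, U.indicator g z * ψ (y - z) = ∫ z in U, g z * χ z := by
    rw [← integral_indicator hU.measurableSet]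
    refine integral_congr_ae (Eventually.of_forall fun z => ?_)
    rw [hχ, Set.indicator_mul_left]
  rw [e1, ← h6, ← integral_indicator hU.measurableSet]
  refine integral_congr_ae (Eventually.of_forall fun z => ?_)
  rw [Set.indicator_mul_left]
  rfl

end Mollification

/-! ### Density of smooth functions in H¹ of a bounded convex open set -/

section Density

variable {d : ℕ}

/-- Smooth functions on `ℝ^d` are dense in `H¹(U)` for bounded convex open sets `U`. -/
theorem exists_contDiff_eLpNorm_sub_le {U : Set (E d)} (hU : IsOpen U) (hconv : Convex ℝ U)
    (hb : Bornology.IsBounded U) (hne : U.Nonempty) {v : E d → ℝ} {g : Fin d → E d → ℝ}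
    (hv : MemLp v 2 (volume.restrict U)) (hg : ∀ i, MemLp (g i) 2 (volume.restrict U))
    (h : ∀ i, IsWeakPartial U i v (g i)) {ε : ℝ} (hε : 0 < ε) :
    ∃ φ : E d → ℝ, ContDiff ℝ ∞ φ ∧
      eLpNorm (fun x => φ x - v x) 2 (volume.restrict U) ≤ ENNReal.ofReal ε ∧
      ∀ i, eLpNorm (fun x => fderiv ℝ φ x (EuclideanSpace.single i 1) - g i x) 2
        (volume.restrict U) ≤ ENNReal.ofReal ε := by
  wlog hmeas : Measurable v ∧ ∀ i, Measurable (g i) generalizing v g with H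
  · have hv' := hv.aestronglyMeasurable.ae_eq_mk
    have hg' := fun i => (hg i).aestronglyMeasurable.ae_eq_mk
    obtain ⟨φ, h1, h2, h3⟩ := H (v := hv.aestronglyMeasurable.mk v)
      (g := fun i => (hg i).aestronglyMeasurable.mk (g i)) (hv.ae_eq hv')
      (fun i => (hg i).ae_eq (hg' i)) (fun i => (h i).congr hv' (hg' i))
      ⟨hv.aestronglyMeasurable.stronglyMeasurable_mk.measurable,
        fun i => (hg i).aestronglyMeasurable.stronglyMeasurable_mk.measurable⟩
    refine ⟨φ, h1, (eLpNorm_congr_ae ?_).trans_le h2, fun i => (eLpNorm_congr_ae ?_).trans_le (h3 i)⟩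
    · filter_upwards [hv'] with x hx; rw [← hx]
    · filter_upwards [hg' i] with x hx; rw [← hx]
  obtain ⟨hvm, hgm⟩ := hmeas
  have hUm := hU.measurableSet
  obtain ⟨c, hc⟩ := hne
  obtain ⟨r, hr, hcr⟩ := Metric.nhds_basis_closedBall.mem_iff.1 (hU.mem_nhds hc)
  have hwL : MemLp (U.indicator v) 2 volume := (memLp_indicator_iff_restrict hUm).2 hv
  have hgL : ∀ i, MemLp (U.indicator (g i)) 2 volume := fun i =>
    (memLp_indicator_iff_restrict hUm).2 (hg i)
  have hwm : Measurable (U.indicator v) := hvm.indicator hUm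
  have hgm' : ∀ i, Measurable (U.indicator (g i)) := fun i => (hgm i).indicator hUm
  have hwl := hwL.locallyIntegrable one_le_two
  have hgl := fun i => (hgL i).locallyIntegrable one_le_two
  obtain ⟨δ₀, hδ₀, hδ₀'⟩ := exists_eLpNorm_comp_sub_le hwL hwm hb hUm c (half_pos hε)
  choose δ₁ hδ₁ hδ₁' using fun i =>
    exists_eLpNorm_comp_sub_le (hgL i) (hgm' i) hb hUm c (half_pos hε)
  obtain ⟨δ, hδ, hδle, hδle'⟩ : ∃ δ > 0, δ ≤ δ₀ ∧ ∀ i, δ ≤ δ₁ i := by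
    by_cases hemp : Nonempty (Fin d)
    · obtain ⟨j, hj⟩ := Finite.exists_min δ₁
      exact ⟨min δ₀ (δ₁ j), lt_min hδ₀ (hδ₁ j), min_le_left _ _,
        fun i => (min_le_right _ _).trans (hj i)⟩
    · exact ⟨δ₀, hδ₀, le_rfl, fun i => absurd ⟨i⟩ hemp⟩
  set Γ := ∑ i, (eLpNorm (g i) 2 (volume.restrict U)).toReal with hΓ
  have hΓ0 : 0 ≤ Γ := Finset.sum_nonneg fun i _ => ENNReal.toReal_nonneg
  -- The parameter τ measures the contraction towards c, and τ r is the mollification radius. Both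
  -- must lie below the moduli δ, and the last condition absorbs the error of the chain rule factor
  -- 1 - τ.
  obtain ⟨τ, hτ, hτ1, hτδ, hτr, hτΓ⟩ : ∃ τ > 0, τ < 1 ∧ τ < δ ∧ τ * r ≤ δ ∧ τ * Γ ≤ ε / 2 := by
    refine ⟨min (min (1 / 2) (δ / 2)) (min (δ / r) (ε / (2 * (Γ + 1)))), by positivity, ?_, ?_, ?_, ?_⟩
    · refine lt_of_le_of_lt ((min_le_left _ _).trans (min_le_left _ _)) (by norm_num)
    · refine lt_of_le_of_lt ((min_le_left _ _).trans (min_le_right _ _)) (by linarith)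
    · rw [← le_div_iff₀ hr]
      exact (min_le_right _ _).trans (min_le_left _ _)
    · have h1 : min (min (1 / 2) (δ / 2)) (min (δ / r) (ε / (2 * (Γ + 1)))) ≤ ε / (2 * (Γ + 1)) :=
        (min_le_right _ _).trans (min_le_right _ _)
      calc _ ≤ ε / (2 * (Γ + 1)) * Γ := mul_le_mul_of_nonneg_right h1 hΓ0
        _ ≤ ε / (2 * (Γ + 1)) * (Γ + 1) := by gcongr; linarith
        _ = ε / 2 := by field_simp
  set t := 1 - τ with ht
  set s := τ * r with hs
  have hspos : 0 < s := by positivity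
  let bump : ContDiffBump (0 : E d) := ⟨s / 2, s, by positivity, by linarith⟩
  set ψ : E d → ℝ := bump.normed volume with hψ
  have hψd : ContDiff ℝ ∞ ψ := bump.contDiff_normed
  have hψc : HasCompactSupport ψ := bump.hasCompactSupport_normed
  have hψ0 : ∀ z, 0 ≤ ψ z := bump.nonneg_normed
  have hψ1 : ∫ z, ψ z = 1 := bump.integral_normed
  have hψs : ∀ z, ψ z ≠ 0 → ‖z‖ ≤ s := by
    intro z hz
    have : z ∈ Function.support (bump.normed volume) := hz
    rw [bump.support_normed_eq, mem_ball_zero_iff] at this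
    exact this.le
  set a : E d → E d := fun x => c + t • (x - c) with ha
  have ham : Measurable a := by fun_prop
  -- By convexity, (1 - τ) x + τ B(c, r) ⊆ U, and this set is the ball of radius τ r about a x. Thus
  -- mollification at a x only sees values inside U, without any extension operator.
  have haU : ∀ x ∈ U, Metric.closedBall (a x) s ⊆ U := by
    intro x hx y hy
    have hy' : c + τ⁻¹ • (y - a x) ∈ U := by
      refine hcr ?_
      rw [Metric.mem_closedBall, dist_eq_norm] at hy ⊢
      rw [add_sub_cancel_left, norm_smul, Real.norm_eq_abs, abs_of_pos (by positivity),
        inv_mul_le_iff₀ hτ]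
      exact hy
    have := hconv hx hy' (show 0 ≤ t by linarith) hτ.le (by rw [ht]; ring)
    have e : t • x + τ • (c + τ⁻¹ • (y - a x)) = y := by
      rw [smul_add, smul_smul, mul_inv_cancel₀ hτ.ne', one_smul, ha, ht]
      module
    rwa [e] at this
  have hψL : ContDiff ℝ ∞ (fun y => ∫ z, U.indicator v z * ψ (y - z)) :=
    hψc.contDiff_convolution_right (ContinuousLinearMap.mul ℝ ℝ) hwl hψd
  have had : ContDiff ℝ ∞ a := contDiff_const.add ((contDiff_id.sub contDiff_const).const_smul t)
  have hzle : ∀ z : E d, ‖z‖ ≤ s → ‖z‖ ≤ δ := fun z hz => hz.trans hτr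
  have hEv : eLpNorm (fun x => (∫ z, U.indicator v z * ψ (a x - z)) - U.indicator v x) 2
      (volume.restrict U) ≤ ENNReal.ofReal (ε / 2) :=
    eLpNorm_mollify_sub_le hwm hwl hψd.continuous hψc hψ0 hψ1 hψs ham U fun z hz =>
      hδ₀' t (by linarith) (by linarith) z ((hzle z hz).trans hδle)
  have hEg : ∀ i, eLpNorm (fun x => (∫ z, U.indicator (g i) z * ψ (a x - z)) -
      U.indicator (g i) x) 2 (volume.restrict U) ≤ ENNReal.ofReal (ε / 2) := fun i =>
    eLpNorm_mollify_sub_le (hgm' i) (hgl i) hψd.continuous hψc hψ0 hψ1 hψs ham U fun z hz =>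
      hδ₁' i t (by have := hδle' i; linarith) (by linarith) z ((hzle z hz).trans (hδle' i))
  refine ⟨fun x => ∫ z, U.indicator v z * ψ (a x - z), hψL.comp had, ?_, fun i => ?_⟩
  · refine (eLpNorm_congr_ae ?_).trans_le (hEv.trans (ENNReal.ofReal_le_ofReal (by linarith)))
    refine (ae_restrict_iff' hUm).2 (Eventually.of_forall fun x hx => ?_)
    simp only [Set.indicator_of_mem hx]
  · have hgc : Continuous fun y => ∫ z, U.indicator (g i) z * ψ (y - z) :=
      (hψc.contDiff_convolution_right (ContinuousLinearMap.mul ℝ ℝ) (hgl i) hψd).continuous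
    have hgca : Continuous fun x => ∫ z, U.indicator (g i) z * ψ (a x - z) :=
      hgc.comp had.continuous
    -- The inner derivative of the contraction is t = 1 - τ. The error therefore splits into t times
    -- the mollification error of g i and the remainder -τ g i.
    have e : (fun x => fderiv ℝ (fun x => ∫ z, U.indicator v z * ψ (a x - z)) x
        (EuclideanSpace.single i 1) - g i x) =ᵐ[volume.restrict U]
        (fun x => t * ((∫ z, U.indicator (g i) z * ψ (a x - z)) - U.indicator (g i) x)) +
          fun x => -τ * g i x := by
      refine (ae_restrict_iff' hUm).2 (Eventually.of_forall fun x hx => ?_)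
      have h1 : HasFDerivAt a (t • ContinuousLinearMap.id ℝ (E d)) x :=
        (((hasFDerivAt_id x).sub_const c).const_smul t).const_add c
      have h2 := ((hψL.differentiable (by simp) (a x)).hasFDerivAt.comp x h1).fderiv
      have h3 := fderiv_mollify hU (h i) hwl hψd hψc hψs (haU x hx)
      have h4 : fderiv ℝ (fun x => ∫ z, U.indicator v z * ψ (a x - z)) x
          (EuclideanSpace.single i 1) = t * ∫ z, U.indicator (g i) z * ψ (a x - z) := by
        rw [← h3]
        change fderiv ℝ ((fun y => ∫ z, U.indicator v z * ψ (y - z)) ∘ a) x _ = _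
        rw [h2]
        simp
      simp only [h4, Pi.add_apply, Set.indicator_of_mem hx, ht]
      ring
    rw [eLpNorm_congr_ae e]
    have hm1 : AEStronglyMeasurable (fun x => t * ((∫ z, U.indicator (g i) z * ψ (a x - z)) -
        U.indicator (g i) x)) (volume.restrict U) :=
      ((hgca.measurable.sub (hgm' i)).const_mul t).aestronglyMeasurable
    refine (eLpNorm_add_le hm1 ((hgm i).const_mul _).aestronglyMeasurable one_le_two).trans ?_
    have e1 := eLpNorm_const_smul_le (c := t) (p := 2) (μ := volume.restrict U)
      (f := fun x => (∫ z, U.indicator (g i) z * ψ (a x - z)) - U.indicator (g i) x)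
    have e2 := eLpNorm_const_smul_le (c := -τ) (p := 2) (μ := volume.restrict U) (f := g i)
    have e3 : ‖t‖ₑ ≤ 1 := by
      rw [Real.enorm_of_nonneg (by linarith), ← ENNReal.ofReal_one]
      exact ENNReal.ofReal_le_ofReal (by linarith)
    have e4 : ‖-τ‖ₑ * eLpNorm (g i) 2 (volume.restrict U) ≤ ENNReal.ofReal (ε / 2) := by
      rw [enorm_neg, Real.enorm_of_nonneg hτ.le, ← ENNReal.ofReal_toReal (hg i).eLpNorm_ne_top,
        ← ENNReal.ofReal_mul hτ.le]
      refine ENNReal.ofReal_le_ofReal (le_trans ?_ hτΓ)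
      refine mul_le_mul_of_nonneg_left ?_ hτ.le
      exact Finset.single_le_sum (f := fun i => (eLpNorm (g i) 2 (volume.restrict U)).toReal)
        (fun i _ => ENNReal.toReal_nonneg) (Finset.mem_univ i)
    refine (add_le_add (e1.trans ((mul_le_mul' e3 (hEg i)).trans_eq (one_mul _)))
      (e2.trans e4)).trans ?_
    rw [← ENNReal.ofReal_add (by positivity) (by positivity), add_halves]

end Density

/-! ### Convergence of squared L² norms -/

section L2

variable {α : Type*} [MeasurableSpace α] {μ : Measure α}

theorem integral_sq_eq {f : α → ℝ} (hf : MemLp f 2 μ) :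
    ∫ x, f x ^ 2 ∂μ = (eLpNorm f 2 μ).toReal ^ 2 := by
  rw [← ENNReal.toReal_pow, eLpNorm_two_sq, integral_eq_lintegral_of_nonneg_ae
    (Eventually.of_forall fun x => sq_nonneg _) (hf.1.pow 2)]
  congr 1
  refine lintegral_congr fun x => ?_
  rw [← sq_abs, ENNReal.ofReal_pow (abs_nonneg _), Real.enorm_eq_ofReal_abs]

theorem tendsto_integral_sq {f : ℕ → α → ℝ} {g : α → ℝ} (hf : ∀ n, MemLp (f n) 2 μ)
    (hg : MemLp g 2 μ) (h : Tendsto (fun n => eLpNorm (fun x => f n x - g x) 2 μ) atTop (𝓝 0)) :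
    Tendsto (fun n => ∫ x, f n x ^ 2 ∂μ) atTop (𝓝 (∫ x, g x ^ 2 ∂μ)) := by
  simp only [integral_sq_eq (hf _), integral_sq_eq hg]
  refine Tendsto.pow ?_ 2
  have h0 : Tendsto (fun n => (eLpNorm (fun x => f n x - g x) 2 μ).toReal) atTop (𝓝 0) := by
    simpa [Function.comp_def] using (ENNReal.tendsto_toReal ENNReal.zero_ne_top).comp h
  rw [tendsto_iff_norm_sub_tendsto_zero]
  refine squeeze_zero (fun _ => norm_nonneg _) (fun n => ?_) h0
  have hfg : MemLp (fun x => f n x - g x) 2 μ := (hf n).sub hg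
  have e1 : (eLpNorm (f n) 2 μ).toReal ≤
      (eLpNorm (fun x => f n x - g x) 2 μ).toReal + (eLpNorm g 2 μ).toReal := by
    rw [← ENNReal.toReal_add hfg.eLpNorm_ne_top hg.eLpNorm_ne_top]
    refine ENNReal.toReal_mono (by simp [hfg.eLpNorm_ne_top, hg.eLpNorm_ne_top]) ?_
    have := eLpNorm_add_le hfg.1 hg.1 one_le_two
    convert this using 2
    ext x; simp
  have e2 : (eLpNorm g 2 μ).toReal ≤
      (eLpNorm (fun x => f n x - g x) 2 μ).toReal + (eLpNorm (f n) 2 μ).toReal := by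
    rw [← ENNReal.toReal_add hfg.eLpNorm_ne_top (hf n).eLpNorm_ne_top]
    refine ENNReal.toReal_mono (by simp [hfg.eLpNorm_ne_top, (hf n).eLpNorm_ne_top]) ?_
    have h3 := eLpNorm_add_le ((hg.sub (hf n)).1) (hf n).1 one_le_two
    have h4 : eLpNorm (g - f n) 2 μ = eLpNorm (fun x => f n x - g x) 2 μ :=
      eLpNorm_sub_comm g (f n) 2 μ
    rw [h4] at h3
    convert h3 using 2
    ext x; simp
  rw [Real.norm_eq_abs, abs_le]
  constructor <;> linarith

end L2

/-! ### Existence of traces and the trace inequality in H¹(K) -/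

section Trace

variable {d : ℕ} {K e : Finset (E d)}

theorem norm_sq_le_sum (L : E d →L[ℝ] ℝ) :
    ‖L‖ ^ 2 ≤ ∑ i, L (EuclideanSpace.single i 1) ^ 2 := by
  have h : ‖L‖ ≤ Real.sqrt (∑ i, L (EuclideanSpace.single i 1) ^ 2) := by
    refine L.opNorm_le_bound (Real.sqrt_nonneg _) fun x => ?_
    have hx : L x = ∑ i, x i * L (EuclideanSpace.single i 1) := by
      conv_lhs => rw [← (EuclideanSpace.basisFun (Fin d) ℝ).sum_repr x]
      simp
    rw [Real.norm_eq_abs, hx, EuclideanSpace.norm_eq, mul_comm]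
    refine (Real.abs_le_sqrt (Finset.sum_mul_sq_le_sq_mul_sq _ _ _)).trans (le_of_eq ?_)
    rw [Real.sqrt_mul (Finset.sum_nonneg fun i _ => sq_nonneg _)]
    simp
  calc ‖L‖ ^ 2 ≤ Real.sqrt (∑ i, L (EuclideanSpace.single i 1) ^ 2) ^ 2 := by gcongr
    _ = _ := Real.sq_sqrt (Finset.sum_nonneg fun i _ => sq_nonneg _)

theorem IsElement.exists_isCone (hd : 0 < d) (hK : IsElement K) (he : e ∈ facets K) :
    ∃ p v, IsCone p v (closedSimplex e) (closedSimplex K) ∧ inballDiam K ≤ ‖v‖ := by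
  obtain ⟨p, hpK, hKe, v, hv, hev⟩ := exists_height hd hK he
  refine ⟨p, v, ⟨hv, isCompact_closedSimplex K, (isCompact_closedSimplex e).isClosed,
    convex_closedSimplex K, subset_convexHull ℝ _ hpK, ?_, hev⟩, ?_⟩
  · exact convexHull_mono (by exact_mod_cast (Finset.mem_powersetCard.1 he).1)
  · refine inballDiam_le_height (fun x hx => ?_) hv hev
    rw [hKe] at hx
    exact Finset.mem_insert.1 hx

theorem IsElement.isFiniteMeasure_face (hd : 0 < d) (hK : IsElement K) (he : e ∈ facets K) :
    IsFiniteMeasure (faceMeasure e) := by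
  obtain ⟨m, rfl⟩ := Nat.exists_eq_succ_of_ne_zero hd.ne'
  obtain ⟨p, v, hc, -⟩ := hK.exists_isCone hd he
  exact hc.isFiniteMeasure

theorem memLp_face (hd : 0 < d) (hK : IsElement K) (he : e ∈ facets K) {f : E d → ℝ}
    (hf : Continuous f) : MemLp f 2 (faceMeasure e) := by
  have := hK.isFiniteMeasure_face hd he
  obtain ⟨C, hC⟩ := (isCompact_closedSimplex e).exists_bound_of_continuousOn hf.continuousOn
  refine MemLp.of_bound hf.aestronglyMeasurable C ?_
  exact (ae_restrict_iff' (measurableSet_closedSimplex e)).2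
    (Eventually.of_forall fun x hx => hC x hx)

/-- The trace inequality for smooth functions on a simplex. -/
theorem IsElement.smooth_trace_inequality (hd : 0 < d) (hK : IsElement K) (he : e ∈ facets K)
    {f : E d → ℝ} (hf : ContDiff ℝ 1 f) :
    inballDiam K * ∫ x, f x ^ 2 ∂faceMeasure e ≤ (d + 1) * (∫ x in openElement K, f x ^ 2) +
      size K ^ 2 * ∑ i, ∫ x in openElement K, fderiv ℝ f x (EuclideanSpace.single i 1) ^ 2 := by
  obtain ⟨p, v, hc, hle⟩ := hK.exists_isCone hd he
  have hfd : Continuous fun x => fderiv ℝ f x := hf.continuous_fderiv one_ne_zero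
  have hfi : ∀ i, Continuous fun x => fderiv ℝ f x (EuclideanSpace.single i 1) := fun i =>
    hfd.clm_apply continuous_const
  have hLf : Integrable (fun x => f x ^ 2) (volume.restrict (openElement K)) :=
    (memLp_openElement_of_continuous hf.continuous K).integrable_sq
  have hLi := fun i => (memLp_openElement_of_continuous (hfi i) K).integrable_sq
  have h1 : ‖v‖ * ∫ x, f x ^ 2 ∂faceMeasure e ≤
      ∫ x in closedSimplex K, ((d + 1) * f x ^ 2 + size K ^ 2 * ‖fderiv ℝ f x‖ ^ 2) := by
    obtain ⟨m, rfl⟩ := Nat.exists_eq_succ_of_ne_zero hd.ne'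
    have := hc.trace_inequality hf (D := size K)
      (fun y hy => norm_sub_le_size (hc.subset hy) hc.apex)
    have hm : ((m.succ : ℕ) : ℝ) + 1 = m + 2 := by push_cast; ring
    rw [hm]
    exact this
  have h2 : inballDiam K * ∫ x, f x ^ 2 ∂faceMeasure e ≤ ‖v‖ * ∫ x, f x ^ 2 ∂faceMeasure e :=
    mul_le_mul_of_nonneg_right hle (integral_nonneg fun x => sq_nonneg _)
  refine h2.trans (h1.trans ?_)
  rw [← setIntegral_openElement, ← integral_finsetSum _ (fun i _ => hLi i), ← integral_const_mul,
    ← integral_const_mul, ← integral_add (hLf.const_mul _)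
      ((integrable_finsetSum _ fun i _ => hLi i).const_mul _)]
  have hfin : Integrable (fun x => ‖fderiv ℝ f x‖ ^ 2) (volume.restrict (openElement K)) :=
    (memLp_openElement_of_continuous hfd.norm K).integrable_sq
  refine integral_mono ((hLf.const_mul _).add (hfin.const_mul _))
    ((hLf.const_mul _).add ((integrable_finsetSum _ fun i _ => hLi i).const_mul _)) fun x => ?_
  have := norm_sq_le_sum (fderiv ℝ f x)
  dsimp only
  gcongr

theorem toReal_le_of_le_ofReal {x : ENNReal} {a : ℝ} (ha : 0 ≤ a) (h : x ≤ ENNReal.ofReal a) :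
    x.toReal ≤ a := by
  have := ENNReal.toReal_mono ENNReal.ofReal_ne_top h
  rwa [ENNReal.toReal_ofReal ha] at this

/-- The smooth trace inequality in a form that transfers Cauchy sequences from H¹(K) to L²(e). -/
theorem IsElement.exists_eLpNorm_face_le (hd : 0 < d) (hK : IsElement K) (he : e ∈ facets K) :
    ∃ C : ℝ, 0 ≤ C ∧ ∀ f : E d → ℝ, ContDiff ℝ 1 f → ∀ a : ℝ, 0 ≤ a →
      eLpNorm f 2 (volume.restrict (openElement K)) ≤ ENNReal.ofReal a →
      (∀ i, eLpNorm (fun x => fderiv ℝ f x (EuclideanSpace.single i 1)) 2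
        (volume.restrict (openElement K)) ≤ ENNReal.ofReal a) →
      eLpNorm f 2 (faceMeasure e) ≤ ENNReal.ofReal (C * a) := by
  have hρ := hK.inballDiam_pos hd
  set M := ((d + 1) + size K ^ 2 * d) / inballDiam K with hM
  have hM0 : 0 ≤ M := by positivity
  refine ⟨Real.sqrt M, Real.sqrt_nonneg _, fun f hf a ha h1 h2 => ?_⟩
  have hfi : ∀ i, Continuous fun x => fderiv ℝ f x (EuclideanSpace.single i 1) := fun i =>
    (hf.continuous_fderiv one_ne_zero).clm_apply continuous_const
  have h3 := hK.smooth_trace_inequality hd he hf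
  have hface := memLp_face hd hK he hf.continuous
  rw [integral_sq_eq hface, integral_sq_eq (memLp_openElement_of_continuous hf.continuous K)] at h3
  have h4 : ∀ i, ∫ x in openElement K, fderiv ℝ f x (EuclideanSpace.single i 1) ^ 2 ≤ a ^ 2 := by
    intro i
    rw [integral_sq_eq (memLp_openElement_of_continuous (hfi i) K)]
    exact pow_le_pow_left₀ ENNReal.toReal_nonneg (toReal_le_of_le_ofReal ha (h2 i)) 2
  have h5 : ∑ i, ∫ x in openElement K, fderiv ℝ f x (EuclideanSpace.single i 1) ^ 2 ≤ d * a ^ 2 := by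
    refine (Finset.sum_le_sum fun i _ => h4 i).trans (le_of_eq ?_)
    simp
  have h6 : (eLpNorm f 2 (volume.restrict (openElement K))).toReal ^ 2 ≤ a ^ 2 :=
    pow_le_pow_left₀ ENNReal.toReal_nonneg (toReal_le_of_le_ofReal ha h1) 2
  have h7 : (eLpNorm f 2 (faceMeasure e)).toReal ^ 2 ≤ (Real.sqrt M * a) ^ 2 := by
    rw [mul_pow, Real.sq_sqrt hM0, hM, div_mul_eq_mul_div, le_div_iff₀ hρ, mul_comm]
    refine h3.trans ?_
    have : size K ^ 2 * ∑ i, ∫ x in openElement K, fderiv ℝ f x (EuclideanSpace.single i 1) ^ 2 ≤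
      size K ^ 2 * (d * a ^ 2) := by gcongr
    nlinarith
  have h8 := le_of_sq_le_sq h7 (by positivity)
  rw [← ENNReal.ofReal_toReal hface.eLpNorm_ne_top]
  exact ENNReal.ofReal_le_ofReal h8

/-- Functions in `H¹(K)` have traces on the faces of `K`. -/
theorem IsElement.exists_isTrace (hd : 0 < d) (hK : IsElement K) (he : e ∈ facets K) {v : E d → ℝ}
    (hv : MemH1 (openElement K) v) : ∃ τ, IsTrace K e v τ := by
  set U := openElement K with hU
  have hbdd : Bornology.IsBounded U :=
    (isCompact_closedSimplex K).isBounded.subset (openElement_subset K)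
  choose φ hφ1 hφ2 hφ3 using fun n : ℕ => exists_contDiff_eLpNorm_sub_le (isOpen_openElement K)
    (convex_openElement K) hbdd hK.openElement_nonempty hv.1 (fun i => (hv.2 i).memLp)
    (fun i => (hv.2 i).isWeakPartial) (show (0 : ℝ) < (1 / 2) ^ n by positivity)
  obtain ⟨C, hC, hface⟩ := hK.exists_eLpNorm_face_le hd he
  have hφd : ∀ n, ContDiff ℝ 1 (φ n) := fun n => (hφ1 n).of_le (by exact_mod_cast le_top)
  have hfi : ∀ n i, Continuous fun x => fderiv ℝ (φ n) x (EuclideanSpace.single i 1) := fun n i =>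
    ((hφd n).continuous_fderiv one_ne_zero).clm_apply continuous_const
  have hpow : Tendsto (fun n : ℕ => ENNReal.ofReal ((1 / 2 : ℝ) ^ n)) atTop (𝓝 0) := by
    rw [← ENNReal.ofReal_zero]
    exact ENNReal.tendsto_ofReal (tendsto_pow_atTop_nhds_zero_of_lt_one (by norm_num) (by norm_num))
  have hhalf : ∀ {N n : ℕ}, N ≤ n → ((1 : ℝ) / 2) ^ n ≤ (1 / 2) ^ N := fun h =>
    pow_le_pow_of_le_one (by norm_num) (by norm_num) h
  have key : ∀ {f g w : E d → ℝ}, AEStronglyMeasurable f (volume.restrict U) →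
      AEStronglyMeasurable g (volume.restrict U) → AEStronglyMeasurable w (volume.restrict U) →
      ∀ {N n m : ℕ}, N ≤ n → N ≤ m →
      eLpNorm (fun x => f x - w x) 2 (volume.restrict U) ≤ ENNReal.ofReal ((1 / 2) ^ n) →
      eLpNorm (fun x => g x - w x) 2 (volume.restrict U) ≤ ENNReal.ofReal ((1 / 2) ^ m) →
      eLpNorm (fun x => f x - g x) 2 (volume.restrict U) ≤ ENNReal.ofReal (2 * (1 / 2) ^ N) := by
    intro f g w hf hg hw N n m hn hm h1 h2
    have e : (fun x => f x - g x) = (fun x => f x - w x) - fun x => g x - w x := by ext; simp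
    rw [e, two_mul, ENNReal.ofReal_add (by positivity) (by positivity)]
    refine (eLpNorm_sub_le (hf.sub hw) (hg.sub hw) one_le_two).trans (add_le_add ?_ ?_)
    · exact h1.trans (ENNReal.ofReal_le_ofReal (hhalf hn))
    · exact h2.trans (ENNReal.ofReal_le_ofReal (hhalf hm))
  -- The approximants have H¹ errors 2 ^ (-n), so their restrictions to e form a fast Cauchy
  -- sequence. The summand 1 in the constant provides the strict inequality even if C = 0.
  have hcau : ∀ N n m : ℕ, N ≤ n → N ≤ m →
      eLpNorm (φ n - φ m) 2 (faceMeasure e) < ENNReal.ofReal ((C * 2 + 1) * (1 / 2) ^ N) := by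
    intro N n m hn hm
    have h1 := hface (φ n - φ m) ((hφd n).sub (hφd m)) (2 * (1 / 2) ^ N) (by positivity)
      (key (hφd n).continuous.aestronglyMeasurable (hφd m).continuous.aestronglyMeasurable
        hv.1.1 hn hm (hφ2 n) (hφ2 m)) (fun i => by
        have h2 := key (hfi n i).aestronglyMeasurable (hfi m i).aestronglyMeasurable
          (hv.2 i).memLp.1 hn hm (hφ3 n i) (hφ3 m i)
        refine le_trans (le_of_eq ?_) h2
        congr 1
        ext x
        rw [fderiv_sub ((hφd n).differentiable one_ne_zero x)
          ((hφd m).differentiable one_ne_zero x)]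
        rfl)
    refine h1.trans_lt ((ENNReal.ofReal_lt_ofReal_iff (by positivity)).2 ?_)
    have : (0 : ℝ) < (1 / 2) ^ N := by positivity
    nlinarith
  have hsum : Summable fun N : ℕ => (C * 2 + 1) * (1 / 2 : ℝ) ^ N :=
    (summable_geometric_of_lt_one (by norm_num) (by norm_num)).mul_left _
  obtain ⟨τ, hτ, hlim⟩ := Lp.cauchy_complete_eLpNorm one_le_two
    (fun n => memLp_face hd hK he (hφd n).continuous) hsum.tsum_ofReal_ne_top hcau
  refine ⟨τ, hτ, φ, hφ1, ?_, fun i => ?_, hlim⟩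
  · exact tendsto_of_tendsto_of_tendsto_of_le_of_le tendsto_const_nhds hpow
      (fun _ => zero_le) hφ2
  · exact tendsto_of_tendsto_of_tendsto_of_le_of_le tendsto_const_nhds hpow
      (fun _ => zero_le) (fun n => hφ3 n i)

theorem IsElement.isTrace_trace (hd : 0 < d) (hK : IsElement K) (he : e ∈ facets K) {v : E d → ℝ}
    (hv : MemH1 (openElement K) v) : IsTrace K e v (trace K e v) := by
  have h := hK.exists_isTrace hd he hv
  rw [trace, dif_pos h]
  exact h.choose_spec

/-- The trace inequality in `H¹(K)`. -/
theorem IsElement.trace_inequality (hd : 0 < d) (hK : IsElement K) (he : e ∈ facets K)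
    {v : E d → ℝ} (hv : MemH1 (openElement K) v) :
    inballDiam K * ∫ x, trace K e v x ^ 2 ∂faceMeasure e ≤
      (d + 1) * (∫ x in openElement K, v x ^ 2) + size K ^ 2 * h1SemiSq (openElement K) v := by
  obtain ⟨hτ, φ, hφ, h1, h2, h3⟩ := hK.isTrace_trace hd he hv
  have hφd : ∀ n, ContDiff ℝ 1 (φ n) := fun n => (hφ n).of_le (by exact_mod_cast le_top)
  have hfi : ∀ n i, Continuous fun x => fderiv ℝ (φ n) x (EuclideanSpace.single i 1) := fun n i =>
    ((hφd n).continuous_fderiv one_ne_zero).clm_apply continuous_const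
  have t1 := tendsto_integral_sq
    (fun n => memLp_openElement_of_continuous (hφd n).continuous K) hv.1 h1
  have t2 := fun i => tendsto_integral_sq
    (fun n => memLp_openElement_of_continuous (hfi n i) K) (hv.2 i).memLp (h2 i)
  have t3 := tendsto_integral_sq (fun n => memLp_face hd hK he (hφd n).continuous) hτ h3
  refine le_of_tendsto_of_tendsto' (t3.const_mul _)
    ((t1.const_mul _).add ((tendsto_finsetSum Finset.univ fun i _ => t2 i).const_mul _))
    fun n => hK.smooth_trace_inequality hd he (hφd n)

end Trace

/-! ### Inverse inequality: equivalence of norms on polynomials, and scaling -/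

section Polynomials

variable {d : ℕ}

/-- S composed with the inverse of T is a linear map on the finite-dimensional range of T, hence
bounded. No norm on V itself is required. -/
theorem exists_norm_le_of_injective {V F G : Type*} [AddCommGroup V] [Module ℝ V]
    [FiniteDimensional ℝ V] [NormedAddCommGroup F] [NormedSpace ℝ F] [NormedAddCommGroup G]
    [NormedSpace ℝ G] (T : V →ₗ[ℝ] F) (hT : Function.Injective T) (S : V →ₗ[ℝ] G) :
    ∃ C : ℝ, 0 ≤ C ∧ ∀ x, ‖S x‖ ≤ C * ‖T x‖ := by
  let e := LinearEquiv.ofInjective T hT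
  have : FiniteDimensional ℝ (LinearMap.range T) := LinearMap.finiteDimensional_range T
  let L : LinearMap.range T →L[ℝ] G := (S ∘ₗ e.symm.toLinearMap).toContinuousLinearMap
  refine ⟨‖L‖, L.opNorm_nonneg, fun x => ?_⟩
  have h1 : L (e x) = S x := by simp [L]
  have h2 : ‖e x‖ = ‖T x‖ := rfl
  rw [← h1, ← h2]
  exact L.le_opNorm _

theorem memLp_polyFun_closedBall (p : MvPolynomial (Fin d) ℝ) (ρ : ℝ) :
    MemLp (polyFun p) 2 (volume.restrict (Metric.closedBall (0 : E d) ρ)) := by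
  have hc : Continuous (polyFun p) := (contDiff_polyFun p (n := 0)).continuous
  have : IsFiniteMeasure (volume.restrict (Metric.closedBall (0 : E d) ρ)) :=
    isFiniteMeasure_restrict.2 (isCompact_closedBall _ _).measure_lt_top.ne
  obtain ⟨C, hC⟩ := (isCompact_closedBall (0 : E d) ρ).exists_bound_of_continuousOn hc.continuousOn
  exact MemLp.of_bound hc.aestronglyMeasurable C ((ae_restrict_iff' measurableSet_closedBall).2
    (Eventually.of_forall fun x hx => hC x hx))

/-- Polynomials as elements of `L²` of a ball. -/
noncomputable def polyToLp (d : ℕ) (ρ : ℝ) :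
    MvPolynomial (Fin d) ℝ →ₗ[ℝ] Lp ℝ 2 (volume.restrict (Metric.closedBall (0 : E d) ρ)) where
  toFun p := (memLp_polyFun_closedBall p ρ).toLp (polyFun p)
  map_add' p q := by
    rw [← MemLp.toLp_add]
    exact MemLp.toLp_congr _ _ (Eventually.of_forall fun x => by simp [polyFun])
  map_smul' a p := by
    rw [RingHom.id_apply, ← MemLp.toLp_const_smul]
    exact MemLp.toLp_congr _ _ (Eventually.of_forall fun x => by simp [polyFun, MvPolynomial.smul_eval])

theorem norm_polyToLp_sq (p : MvPolynomial (Fin d) ℝ) (ρ : ℝ) :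
    ‖polyToLp d ρ p‖ ^ 2 = ∫ x in Metric.closedBall (0 : E d) ρ, polyFun p x ^ 2 := by
  rw [integral_sq_eq (memLp_polyFun_closedBall p ρ)]
  congr 1
  exact Lp.norm_toLp _ (memLp_polyFun_closedBall p ρ)

theorem polyToLp_injective {ρ : ℝ} (hρ : 0 < ρ) : Function.Injective (polyToLp d ρ) := by
  rw [injective_iff_map_eq_zero]
  intro p hp
  have hc : Continuous (polyFun p) := (contDiff_polyFun p (n := 0)).continuous
  have h1 : polyFun p =ᵐ[volume.restrict (Metric.closedBall (0 : E d) ρ)] fun _ => 0 :=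
    (MemLp.toLp_eq_toLp_iff (memLp_polyFun_closedBall p ρ) MemLp.zero).1 hp
  have h2 : Set.EqOn (polyFun p) (fun _ => 0) (Metric.ball (0 : E d) ρ) :=
    Measure.eqOn_open_of_ae_eq (ae_restrict_of_ae_restrict_of_subset Metric.ball_subset_closedBall h1)
      Metric.isOpen_ball hc.continuousOn continuousOn_const
  -- A polynomial vanishing on a ball vanishes on a box inside it, a product of infinite sets, and
  -- is therefore zero.
  have hopen : (WithLp.toLp 2 : (Fin d → ℝ) → E d) ⁻¹' Metric.ball 0 ρ ∈ 𝓝 (0 : Fin d → ℝ) := by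
    refine (PiLp.continuous_toLp 2 _).continuousAt.preimage_mem_nhds ?_
    simpa using Metric.ball_mem_nhds (0 : E d) hρ
  obtain ⟨δ, hδ, hb⟩ := Metric.mem_nhds_iff.1 hopen
  refine MvPolynomial.funext_set (fun _ => Metric.ball (0 : ℝ) δ) (fun _ => ?_) fun x hx => ?_
  · rw [Real.ball_eq_Ioo]
    exact Set.Ioo_infinite (by linarith)
  · have hx' : x ∈ Metric.ball (0 : Fin d → ℝ) δ := by
      rw [ball_pi _ hδ]; exact hx
    have := h2 (hb hx')
    simpa [polyFun] using this

/-- Equivalence of norms on polynomials of bounded degree. -/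
theorem exists_gradient_le (d k : ℕ) {ρ : ℝ} (hρ : 0 < ρ) :
    ∃ C : ℝ, 0 < C ∧ ∀ p : MvPolynomial (Fin d) ℝ, p.totalDegree ≤ k →
      ∑ i, ∫ x in Metric.closedBall (0 : E d) 1, polyFun (MvPolynomial.pderiv i p) x ^ 2 ≤
        C ^ 2 * ∫ x in Metric.closedBall (0 : E d) ρ, polyFun p x ^ 2 := by
  set V := MvPolynomial.restrictTotalDegree (Fin d) ℝ k
  have : FiniteDimensional ℝ V :=
    inferInstanceAs (Module.Finite ℝ (MvPolynomial.restrictTotalDegree (Fin d) ℝ k))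
  choose C hC0 hC using fun i : Fin d => exists_norm_le_of_injective
    ((polyToLp d ρ) ∘ₗ V.subtype) ((polyToLp_injective hρ).comp V.injective_subtype)
    ((polyToLp d 1) ∘ₗ ((MvPolynomial.pderiv i : Derivation ℝ _ _) : _ →ₗ[ℝ] _) ∘ₗ V.subtype)
  -- The summand 1 only secures positivity; for k = 0, for instance, all derivatives vanish.
  refine ⟨1 + ∑ i, C i, by have := Finset.sum_nonneg fun i (_ : i ∈ Finset.univ) => hC0 i; linarith,
    fun p hp => ?_⟩
  have hpV : p ∈ V := (MvPolynomial.mem_restrictTotalDegree _ _ _).2 hp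
  simp only [← norm_polyToLp_sq]
  have h1 : ∀ i, ‖polyToLp d 1 (MvPolynomial.pderiv i p)‖ ^ 2 ≤ C i ^ 2 * ‖polyToLp d ρ p‖ ^ 2 := by
    intro i
    rw [← mul_pow]
    exact pow_le_pow_left₀ (norm_nonneg _) (hC i ⟨p, hpV⟩) 2
  refine (Finset.sum_le_sum fun i _ => h1 i).trans ?_
  rw [← Finset.sum_mul]
  refine mul_le_mul_of_nonneg_right ?_ (sq_nonneg _)
  have h2 : ∑ i, C i ^ 2 ≤ (∑ i, C i) ^ 2 :=
    Finset.sum_sq_le_sq_sum_of_nonneg fun i _ => hC0 i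
  have h3 : 0 ≤ ∑ i, C i := Finset.sum_nonneg fun i _ => hC0 i
  nlinarith

/-- The polynomial `y ↦ p (c + h y)`. -/
noncomputable def rescale (c : E d) (h : ℝ) (p : MvPolynomial (Fin d) ℝ) : MvPolynomial (Fin d) ℝ :=
  MvPolynomial.aeval (fun i => MvPolynomial.C (c i) + MvPolynomial.C h * MvPolynomial.X i) p

theorem polyFun_rescale (c : E d) (h : ℝ) (p : MvPolynomial (Fin d) ℝ) (y : E d) :
    polyFun (rescale c h p) y = polyFun p (c + h • y) := by
  induction p using MvPolynomial.induction_on with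
  | C a => simp [polyFun, rescale]
  | add p q hp hq => simp only [polyFun, rescale, map_add] at *; rw [hp, hq]
  | mul_X p i hp =>
    simp only [polyFun, rescale, map_mul] at *
    rw [hp]; simp

theorem totalDegree_rescale_le (c : E d) (h : ℝ) (p : MvPolynomial (Fin d) ℝ) :
    (rescale c h p).totalDegree ≤ p.totalDegree := by
  rw [rescale, MvPolynomial.aeval_def, MvPolynomial.eval₂_eq']
  refine MvPolynomial.totalDegree_finsetSum_le fun s hs => ?_
  refine (MvPolynomial.totalDegree_mul _ _).trans ?_
  rw [MvPolynomial.algebraMap_eq, MvPolynomial.totalDegree_C, zero_add]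
  refine (MvPolynomial.totalDegree_finsetProd _ _).trans ?_
  refine le_trans ?_ (MvPolynomial.le_totalDegree hs)
  rw [Finsupp.sum_fintype _ _ fun _ => rfl]
  refine Finset.sum_le_sum fun i _ => (MvPolynomial.totalDegree_pow _ _).trans ?_
  refine (Nat.mul_le_mul_left _ ?_).trans_eq (mul_one _)
  refine (MvPolynomial.totalDegree_add _ _).trans (max_le ?_ ?_)
  · simp
  · refine (MvPolynomial.totalDegree_mul _ _).trans ?_
    simp

theorem polyFun_pderiv_rescale (c : E d) (h : ℝ) (p : MvPolynomial (Fin d) ℝ) (i : Fin d) (y : E d) :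
    polyFun (MvPolynomial.pderiv i (rescale c h p)) y =
      h * polyFun (MvPolynomial.pderiv i p) (c + h • y) := by
  rw [← fderiv_polyFun, ← fderiv_polyFun]
  have e : polyFun (rescale c h p) = polyFun p ∘ fun y => c + h • y := by
    ext y; exact polyFun_rescale c h p y
  have h1 : HasFDerivAt (fun y : E d => c + h • y) (h • ContinuousLinearMap.id ℝ (E d)) y :=
    ((hasFDerivAt_id y).const_smul h).const_add c
  have h2 := (((contDiff_polyFun p (n := 1)).differentiable one_ne_zero (c + h • y)).hasFDerivAt.comp
    y h1).fderiv
  rw [e, h2]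
  simp

theorem setIntegral_closedBall_rescale (F : E d → ℝ) (c : E d) {h : ℝ} (hh : 0 < h) {ρ : ℝ}
    (hρ : 0 ≤ ρ) : ∫ x in Metric.closedBall c (h * ρ), F x =
      h ^ d * ∫ y in Metric.closedBall (0 : E d) ρ, F (c + h • y) := by
  have h1 := Measure.setIntegral_comp_smul_of_pos volume (fun x => F (c + x))
    (Metric.closedBall (0 : E d) ρ) hh
  rw [finrank_euclideanSpace_fin, smul_closedBall _ _ hρ, smul_zero, Real.norm_eq_abs,
    abs_of_pos hh, smul_eq_mul] at h1
  have h2 := (measurePreserving_add_left (volume : Measure (E d)) c).setIntegral_preimage_emb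
    (measurableEmbedding_addLeft c) F (Metric.closedBall c (h * ρ))
  have h3 : (fun x => c + x) ⁻¹' Metric.closedBall c (h * ρ) = Metric.closedBall 0 (h * ρ) := by
    ext x; simp
  rw [h3] at h2
  rw [h1, h2, mul_inv_cancel_left₀ (by positivity)]

/-- The inverse inequality on a set between two balls. -/
theorem inverse_inequality {k : ℕ} {ρ C : ℝ} (hρ : 0 < ρ)
    (hC : ∀ p : MvPolynomial (Fin d) ℝ, p.totalDegree ≤ k →
      ∑ i, ∫ x in Metric.closedBall (0 : E d) 1, polyFun (MvPolynomial.pderiv i p) x ^ 2 ≤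
        C ^ 2 * ∫ x in Metric.closedBall (0 : E d) ρ, polyFun p x ^ 2)
    {S : Set (E d)} {c : E d} {h : ℝ} (hh : 0 < h) (h1 : Metric.closedBall c (h * ρ) ⊆ S)
    (h2 : S ⊆ Metric.closedBall c h) {p : MvPolynomial (Fin d) ℝ}
    (hp : p.totalDegree ≤ k) :
    ∑ i, ∫ x in S, polyFun (MvPolynomial.pderiv i p) x ^ 2 ≤
      (C * h⁻¹) ^ 2 * ∫ x in S, polyFun p x ^ 2 := by
  have hcont : ∀ q : MvPolynomial (Fin d) ℝ, Continuous fun x => polyFun q x ^ 2 := fun q =>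
    ((contDiff_polyFun q (n := 0)).continuous).pow 2
  have hint : ∀ q : MvPolynomial (Fin d) ℝ, IntegrableOn (fun x => polyFun q x ^ 2)
      (Metric.closedBall c h) := fun q =>
    (hcont q).continuousOn.integrableOn_compact (isCompact_closedBall _ _)
  -- On the reference balls the inequality is used for y ↦ p (c + h y). The chain rule contributes h
  -- ^ 2 on the left, and the Jacobian h ^ d is common to both sides.
  have key := hC (rescale c h p) ((totalDegree_rescale_le c h p).trans hp)
  simp only [polyFun_rescale, polyFun_pderiv_rescale, mul_pow, integral_const_mul] at key
  rw [← Finset.mul_sum] at key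
  have e1 : ∀ i, ∫ x in S, polyFun (MvPolynomial.pderiv i p) x ^ 2 ≤
      h ^ d * ∫ y in Metric.closedBall (0 : E d) 1, polyFun (MvPolynomial.pderiv i p) (c + h • y) ^ 2 := by
    intro i
    rw [← setIntegral_closedBall_rescale (fun x => polyFun (MvPolynomial.pderiv i p) x ^ 2) c hh
      zero_le_one, mul_one]
    exact setIntegral_mono_set (hint _) (Eventually.of_forall fun x => sq_nonneg _) h2.eventuallyLE
  have e2 : h ^ d * ∫ y in Metric.closedBall (0 : E d) ρ, polyFun p (c + h • y) ^ 2 ≤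
      ∫ x in S, polyFun p x ^ 2 := by
    rw [← setIntegral_closedBall_rescale (fun x => polyFun p x ^ 2) c hh hρ.le]
    exact setIntegral_mono_set ((hint _).mono_set h2) (Eventually.of_forall fun x => sq_nonneg _)
      h1.eventuallyLE
  refine (Finset.sum_le_sum fun i _ => e1 i).trans ?_
  rw [← Finset.mul_sum]
  have hd0 : 0 < h ^ d := by positivity
  set X := ∑ i, ∫ y in Metric.closedBall (0 : E d) 1, polyFun (MvPolynomial.pderiv i p) (c + h • y) ^ 2
  set Y := ∫ y in Metric.closedBall (0 : E d) ρ, polyFun p (c + h • y) ^ 2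
  calc h ^ d * X = h ^ d * h⁻¹ ^ 2 * (h ^ 2 * X) := by field_simp
    _ ≤ h ^ d * h⁻¹ ^ 2 * (C ^ 2 * Y) := by gcongr
    _ = (C * h⁻¹) ^ 2 * (h ^ d * Y) := by ring
    _ ≤ _ := by gcongr

end Polynomials

/-! ### The constants of the trace and the inverse inequality -/

section Constants

/-- The inner radius is dictated by the mesh: h_K ≤ max(ν, 1)² ρ_K, and K contains a ball of radius
ρ_K / 4, hence one of radius h_K / (4 max(ν, 1)²). -/
theorem exists_inverseConst (d k : ℕ) (ν : ℝ) : ∃ C : ℝ, 0 < C ∧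
    ∀ p : MvPolynomial (Fin d) ℝ, p.totalDegree ≤ k →
      ∑ i, ∫ x in Metric.closedBall (0 : E d) 1, polyFun (MvPolynomial.pderiv i p) x ^ 2 ≤
        C ^ 2 * ∫ x in Metric.closedBall (0 : E d) (1 / (4 * max ν 1 ^ 2)), polyFun p x ^ 2 :=
  exists_gradient_le d k (by positivity)

/-- A constant for the inverse inequality. -/
noncomputable def inverseConst (d k : ℕ) (ν : ℝ) : ℝ := (exists_inverseConst d k ν).choose

/-- A constant for the trace inequality. -/
noncomputable def traceConst (d : ℕ) (ν : ℝ) : ℝ := (d + 1) * max ν 1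

theorem traceConst_pos (d : ℕ) (ν : ℝ) : 0 < traceConst d ν := by
  rw [traceConst]; positivity

theorem inverseConst_pos (d k : ℕ) (ν : ℝ) : 0 < inverseConst d k ν :=
  (exists_inverseConst d k ν).choose_spec.1

variable {d : ℕ} {P : InterfaceProblem d} (F : MeshFamily P)

theorem size_facet_pos (hd : 2 ≤ d) {K e : Finset (E d)} (he : e ∈ facets K) : 0 < size e :=
  size_pos (by rw [(Finset.mem_powersetCard.1 he).2]; exact hd)

theorem MeshFamily.inv_inballDiam_le (hd : 2 ≤ d) {h : F.ι} {K e : Finset (E d)}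
    (hK : K ∈ (F.mesh h).elements) (he : e ∈ facets K) :
    (inballDiam K)⁻¹ ≤ max F.ν₁ 1 * (size e)⁻¹ := by
  have hρ := ((F.mesh h).isElement hK).inballDiam_pos (by omega)
  have hs := size_facet_pos hd he
  have h1 := (le_max_left _ _).trans ((F.ratio h K hK e he).trans (le_max_left F.ν₁ 1))
  rw [← div_eq_mul_inv, le_div_iff₀ hs, inv_mul_eq_div]
  exact h1

/-- The two ratio bounds are chained through an arbitrary face: h_K ≤ ν h_e ≤ ν² ρ_K. -/
theorem MeshFamily.size_le (hd : 2 ≤ d) {h : F.ι} {K : Finset (E d)}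
    (hK : K ∈ (F.mesh h).elements) : size K ≤ max F.ν₁ 1 ^ 2 * inballDiam K := by
  have hel := (F.mesh h).isElement hK
  have hρ := hel.inballDiam_pos (by omega)
  obtain ⟨e, he⟩ : (facets K).Nonempty := by
    rw [← Finset.card_pos, facets_card hel.1]; omega
  have hs := size_facet_pos hd he
  have hr := F.ratio h K hK e he
  have h1 := (le_max_left _ _).trans (hr.trans (le_max_left F.ν₁ 1))
  have h2 := (le_max_right _ _).trans (hr.trans (le_max_left F.ν₁ 1))
  rw [div_le_iff₀ hρ] at h1
  rw [div_le_iff₀ hs] at h2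
  have : 0 < max F.ν₁ 1 := by positivity
  calc size K ≤ max F.ν₁ 1 * size e := h2
    _ ≤ max F.ν₁ 1 * (max F.ν₁ 1 * inballDiam K) := by gcongr
    _ = _ := by ring

theorem integral_norm_traceGrad_sq (hd : 0 < d) {K e : Finset (E d)} (hK : IsElement K)
    (he : e ∈ facets K) {v : E d → ℝ} (hv : MemH2 (openElement K) v) :
    ∫ x, ‖traceGrad K e v x‖ ^ 2 ∂faceMeasure e =
      ∑ i, ∫ x, trace K e (weakPartial (openElement K) i v) x ^ 2 ∂faceMeasure e := by
  rw [← integral_finsetSum _ fun i _ => (hK.isTrace_trace hd he (hv.2 i)).1.integrable_sq]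
  refine integral_congr_ae (Eventually.of_forall fun x => ?_)
  simp [EuclideanSpace.norm_sq_eq, traceGrad]

/-- The H¹ trace inequality is applied to every component of ∇v; then ρ_K⁻¹ ≤ max(ν₁, 1) h_e⁻¹. -/
theorem MeshFamily.isTraceConst (hd : 2 ≤ d) : IsTraceConst F (traceConst d F.ν₁) := by
  intro h K hK e he v hv
  have hel := (F.mesh h).isElement hK
  have hd0 : 0 < d := by omega
  have hρ := hel.inballDiam_pos hd0
  rw [integral_norm_traceGrad_sq hd0 hel he hv]
  have h1 : inballDiam K * ∑ i, ∫ x, trace K e (weakPartial (openElement K) i v) x ^ 2 ∂faceMeasure e ≤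
      (d + 1) * h1SemiSq (openElement K) v + size K ^ 2 * h2SemiSq (openElement K) v := by
    rw [Finset.mul_sum, h1SemiSq, h2SemiSq, Finset.mul_sum, Finset.mul_sum, ← Finset.sum_add_distrib]
    exact Finset.sum_le_sum fun i _ => hel.trace_inequality hd0 he (hv.2 i)
  have hH1 : 0 ≤ h1SemiSq (openElement K) v :=
    Finset.sum_nonneg fun i _ => integral_nonneg fun x => sq_nonneg _
  have hH2 : 0 ≤ h2SemiSq (openElement K) v :=
    Finset.sum_nonneg fun i _ => Finset.sum_nonneg fun j _ => integral_nonneg fun x => sq_nonneg _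
  have h2 : inballDiam K * ∑ i, ∫ x, trace K e (weakPartial (openElement K) i v) x ^ 2 ∂faceMeasure e ≤
      (d + 1) * (h1SemiSq (openElement K) v + size K ^ 2 * h2SemiSq (openElement K) v) := by
    refine h1.trans ?_
    have : 0 ≤ (d : ℝ) * (size K ^ 2 * h2SemiSq (openElement K) v) := by positivity
    linarith
  have h3 := F.inv_inballDiam_le hd hK he
  rw [mul_comm, ← le_div_iff₀ hρ, div_eq_mul_inv] at h2
  refine h2.trans ?_
  calc _ ≤ (d + 1) * (h1SemiSq (openElement K) v + size K ^ 2 * h2SemiSq (openElement K) v) *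
        (max F.ν₁ 1 * (size e)⁻¹) := by gcongr
    _ = _ := by rw [traceConst]; ring

/-- K contains a ball of radius comparable to h_K, and the concentric ball of radius h_K contains K,
since its centre belongs to K. -/
theorem MeshFamily.isInverseConst (hd : 2 ≤ d) (k : ℕ) :
    IsInverseConst F k (inverseConst d k F.ν₁) := by
  intro h K hK v hv
  have hel := (F.mesh h).isElement hK
  have hd0 : 0 < d := by omega
  obtain ⟨p, hp, hvp⟩ := (hv.2 K hK).2
  have hvp' : v =ᵐ[volume.restrict (openElement K)] polyFun p := hvp
  obtain ⟨c, r, hr, hr0, hball⟩ := hel.exists_ball hd0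
  have hs : 0 < size K := size_pos (by rw [hel.1]; omega)
  set ρ := 1 / (4 * max F.ν₁ 1 ^ 2) with hρ
  have hρ0 : 0 < ρ := by positivity
  have hle : size K * ρ ≤ r := by
    have h1 := F.size_le hd hK
    rw [hρ, mul_one_div, div_le_iff₀ (by positivity)]
    have : 0 < max F.ν₁ 1 ^ 2 := by positivity
    nlinarith
  have hcK : c ∈ closedSimplex K := hball (Metric.mem_closedBall_self hr0.le)
  have key := inverse_inequality hρ0 (exists_inverseConst d k F.ν₁).choose_spec.2 hs
    ((Metric.closedBall_subset_closedBall hle).trans hball)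
    (fun x hx => by rw [Metric.mem_closedBall, dist_eq_norm]; exact norm_sub_le_size hx hcK) hp
  rw [h1SemiSq_polyFun hvp']
  have e1 : ∫ x in openElement K, v x ^ 2 = ∫ x in closedSimplex K, polyFun p x ^ 2 := by
    rw [← setIntegral_openElement]
    refine integral_congr_ae ?_
    filter_upwards [hvp'] with x hx; rw [hx]
  rw [e1]
  simp only [setIntegral_openElement]
  have hC : 0 ≤ inverseConst d k F.ν₁ * (size K)⁻¹ :=
    mul_nonneg (inverseConst_pos d k F.ν₁).le (inv_nonneg.2 hs.le)
  calc _ ≤ Real.sqrt ((inverseConst d k F.ν₁ * (size K)⁻¹) ^ 2 *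
        ∫ x in closedSimplex K, polyFun p x ^ 2) := Real.sqrt_le_sqrt key
    _ = _ := by rw [Real.sqrt_mul (sq_nonneg _), Real.sqrt_sq hC]

end Constants

/-! ### Bounds for the coefficient; position of the elements relative to the interface -/

section Coefficient

variable {d : ℕ} (P : InterfaceProblem d)

namespace InterfaceProblem

theorem subset₁ : P.Ω₁ ⊆ P.Ω := fun _ hx =>
  (P.divided.symm.subset (Or.inl hx)).1

theorem subset₂ : P.Ω₂ ⊆ P.Ω := fun _ hx =>
  (P.divided.symm.subset (Or.inr hx)).1

/-- For symmetric positive A, evaluate the quadratic form at ξ - t Aξ with t = 1/λ_max: its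
nonnegativity, with the upper ellipticity bound for ξ and for Aξ, gives the claim. This bound makes
the real suprema in `alpha` genuine. -/
theorem norm_A_le {x : E d} (hx : x ∈ P.Ω) (ξ : E d) : ‖P.A x ξ‖ ≤ P.lamMax * ‖ξ‖ := by
  have hl := P.lamMax_pos
  set η := P.A x ξ with hη
  set t := P.lamMax⁻¹ with ht
  have h1 := (P.elliptic x hx (ξ - t • η)).1
  have h2 := (P.elliptic x hx ξ).2
  have h3 := (P.elliptic x hx η).2
  have h4 : inner ℝ (ξ - t • η) (P.A x (ξ - t • η)) =
      inner ℝ ξ (P.A x ξ) - 2 * t * ‖η‖ ^ 2 + t ^ 2 * inner ℝ η (P.A x η) := by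
    simp only [map_sub, map_smul, inner_sub_left, inner_sub_right, real_inner_smul_left,
      real_inner_smul_right]
    rw [P.symm x hx ξ η, ← hη, real_inner_self_eq_norm_sq]
    ring
  have h0 : 0 ≤ P.lamMin * ‖ξ - t • η‖ ^ 2 := mul_nonneg P.lamMin_pos.le (sq_nonneg _)
  rw [h4] at h1
  have h5 : t ^ 2 * inner ℝ η (P.A x η) ≤ t ^ 2 * (P.lamMax * ‖η‖ ^ 2) := by gcongr
  have h6 : t ^ 2 * (P.lamMax * ‖η‖ ^ 2) = t * ‖η‖ ^ 2 := by rw [ht]; field_simp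
  have h7 : t * ‖η‖ ^ 2 ≤ P.lamMax * ‖ξ‖ ^ 2 := by linarith
  have h8 : ‖η‖ ^ 2 ≤ (P.lamMax * ‖ξ‖) ^ 2 := by
    rw [ht, inv_mul_le_iff₀ hl] at h7
    calc _ ≤ _ := h7
      _ = _ := by ring
  exact le_of_sq_le_sq h8 (by positivity)

theorem ratio_le {x : E d} (hx : x ∈ P.Ω) (ξ : E d) : ‖P.A x ξ‖ / ‖ξ‖ ≤ P.lamMax :=
  div_le_of_le_mul₀ (norm_nonneg _) P.lamMax_pos.le (P.norm_A_le hx ξ)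

theorem norm_A_le_iSup {U : Set (E d)} (hU : U ⊆ P.Ω) {x : E d} (hx : x ∈ U) (ξ : E d) :
    ‖P.A x ξ‖ ≤ (⨆ x : U, ⨆ ξ : E d, ‖P.A x ξ‖ / ‖ξ‖) * ‖ξ‖ := by
  by_cases hξ : ξ = 0
  · simp [hξ]
  · rw [← div_le_iff₀ (norm_pos_iff.2 hξ)]
    have h1 : BddAbove (Set.range fun ξ : E d => ‖P.A x ξ‖ / ‖ξ‖) :=
      ⟨P.lamMax, by rintro _ ⟨ζ, rfl⟩; exact P.ratio_le (hU hx) ζ⟩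
    have h2 : BddAbove (Set.range fun x : U => ⨆ ξ : E d, ‖P.A x ξ‖ / ‖ξ‖) :=
      ⟨P.lamMax, by rintro _ ⟨y, rfl⟩; exact ciSup_le fun ζ => P.ratio_le (hU y.2) ζ⟩
    exact (le_ciSup h1 ξ).trans (le_ciSup h2 ⟨x, hx⟩)

theorem norm_A_le_alpha {x : E d} (hx : x ∈ P.Ω₁ ∪ P.Ω₂) (ξ : E d) :
    ‖P.A x ξ‖ ≤ P.alpha * ‖ξ‖ := by
  rcases hx with hx | hx
  · exact (P.norm_A_le_iSup P.subset₁ hx ξ).trans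
      (mul_le_mul_of_nonneg_right (le_max_left _ _) (norm_nonneg _))
  · exact (P.norm_A_le_iSup P.subset₂ hx ξ).trans
      (mul_le_mul_of_nonneg_right (le_max_right _ _) (norm_nonneg _))

theorem alpha_nonneg : 0 ≤ P.alpha :=
  (Real.iSup_nonneg fun _ => Real.iSup_nonneg fun _ => by positivity).trans (le_max_left _ _)

end InterfaceProblem

variable {P}

theorem exists_tendsto_of_mem_closure {X Y : Type*} [TopologicalSpace X] [TopologicalSpace Y]
    {U : Set X} (hU : IsOpen U) {f : X → Y} (hf : ContinuousOn f U)
    (hb : ∀ x ∈ frontier U, ∃ M, Tendsto f (𝓝[U] x) (𝓝 M)) {x : X} (hx : x ∈ closure U) :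
    ∃ M, Tendsto f (𝓝[U] x) (𝓝 M) := by
  by_cases h : x ∈ U
  · exact ⟨f x, hf x h⟩
  · exact hb x ⟨hx, by rwa [hU.interior_eq]⟩

theorem Triangulation.mem_faces_of_mem_elements {Ω : Set (E d)} (T : Triangulation Ω)
    {K : Finset (E d)} (hK : K ∈ T.elements) : K ∈ T.complex.faces := by
  simpa using (Finset.mem_filter.1 hK).1

/-- In a simplicial complex two simplices meet within the hull of their common vertices, here a
proper subset of those of K, and such a hull misses the interior of K. -/
theorem Triangulation.disjoint_of_not_subset {Ω : Set (E d)} (T : Triangulation Ω)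
    {s K : Finset (E d)} (hs : s ∈ T.complex.faces) (hK : K ∈ T.elements) (hKs : ¬K ⊆ s) :
    Disjoint (closedSimplex s) (openElement K) := by
  have hK' := T.mem_faces_of_mem_elements hK
  rw [Set.disjoint_left]
  intro x hxs hxK
  have h1 := T.complex.inter_subset_convexHull hs hK' ⟨hxs, openElement_subset K hxK⟩
  have h2 : (s ∩ K : Set (E d)) ⊂ (K : Set (E d)) := by
    refine Set.ssubset_iff_subset_ne.2 ⟨Set.inter_subset_right, fun h => hKs ?_⟩
    have : (K : Set (E d)) ⊆ s := Set.inter_eq_right.1 h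
    exact_mod_cast this
  exact Set.disjoint_left.1 ((T.isElement hK).disjoint_openElement h2) h1 hxK

theorem Triangulation.disjoint_openElement {Ω : Set (E d)} (T : Triangulation Ω)
    {K K' : Finset (E d)} (hK : K ∈ T.elements) (hK' : K' ∈ T.elements) (hne : K' ≠ K) :
    Disjoint (openElement K') (openElement K) := by
  refine (T.disjoint_of_not_subset (T.mem_faces_of_mem_elements hK') hK fun h => hne ?_).mono_left
    (openElement_subset K')
  refine (Finset.eq_of_subset_of_card_le h ?_).symm
  rw [(T.isElement hK).1, (T.isElement hK').1]

variable (F : MeshFamily P) {h : F.ι} {K : Finset (E d)}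

/-- The interface is a union of faces with d vertices, which cannot contain the d + 1 vertices of K
and so avoid its interior. That the open element lies in Ω uses that Ω is the interior of its
closure. -/
theorem MeshFamily.openElement_subset_union (hd : 0 < d) (hK : K ∈ (F.mesh h).elements) :
    openElement K ⊆ P.Ω₁ ∪ P.Ω₂ := by
  rw [← P.divided]
  intro x hx
  refine ⟨?_, fun hΓ => ?_⟩
  · rw [← P.polyhedral.interior_closure, ← (F.mesh h).space_eq]
    exact interior_mono ((F.mesh h).complex.convexHull_subset_space
      ((F.mesh h).mem_faces_of_mem_elements hK)) hx
  · obtain ⟨EΓ, hEΓ, hΓe⟩ := F.resolves h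
    have hx' : x ∈ P.Γ := hΓ
    rw [hΓe] at hx'
    obtain ⟨e, he, hxe⟩ := Set.mem_iUnion₂.1 hx'
    obtain ⟨K', hK', heK'⟩ := hEΓ he
    have hc := (Finset.mem_powersetCard.1 heK').2
    have hef : e ∈ (F.mesh h).complex.faces :=
      (F.mesh h).complex.down_closed ((F.mesh h).mem_faces_of_mem_elements hK')
        (Finset.mem_powersetCard.1 heK').1 (Finset.card_pos.1 (by omega))
    have hKe : ¬K ⊆ e := fun hs => by
      have := Finset.card_le_card hs
      rw [((F.mesh h).isElement hK).1] at this
      omega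
    exact Set.disjoint_left.1 ((F.mesh h).disjoint_of_not_subset hef hK hKe) hxe hx

/-- A convex set is connected, so it cannot meet both of two disjoint open sets that cover it. -/
theorem MeshFamily.openElement_subset_one (hd : 0 < d) (hK : K ∈ (F.mesh h).elements) :
    openElement K ⊆ P.Ω₁ ∨ openElement K ⊆ P.Ω₂ :=
  isPreconnected_iff_subset_of_disjoint.1 (convex_openElement K).isPreconnected _ _
    P.polyhedral₁.isOpen P.polyhedral₂.isOpen (F.openElement_subset_union hd hK)
    (by rw [P.disjoint.inter_eq, Set.inter_empty])

theorem MeshFamily.openElement_subset_domain (hd : 0 < d) (hK : K ∈ (F.mesh h).elements) :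
    openElement K ⊆ P.Ω :=
  (F.openElement_subset_union hd hK).trans (Set.union_subset P.subset₁ P.subset₂)

theorem MeshFamily.continuousOn_A (hd : 0 < d) (hK : K ∈ (F.mesh h).elements) :
    ContinuousOn P.A (openElement K) := by
  rcases F.openElement_subset_one hd hK with hs | hs
  · exact P.contDiffOn₁.continuousOn.mono hs
  · exact P.contDiffOn₂.continuousOn.mono hs

/-- The one-sided boundary values of the coefficient are bounded by `α`. -/
theorem MeshFamily.norm_extendFrom_le (hd : 0 < d) (hK : K ∈ (F.mesh h).elements) {x : E d}
    (hx : x ∈ closedSimplex K) (ξ : E d) :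
    ‖extendFrom (openElement K) P.A x ξ‖ ≤ P.alpha * ‖ξ‖ := by
  have hxc : x ∈ closure (openElement K) := by
    rwa [((F.mesh h).isElement hK).closure_openElement]
  obtain ⟨M, hM⟩ : ∃ M, Tendsto P.A (𝓝[openElement K] x) (𝓝 M) := by
    rcases F.openElement_subset_one hd hK with hs | hs
    · obtain ⟨M, hM⟩ := exists_tendsto_of_mem_closure P.polyhedral₁.isOpen
        P.contDiffOn₁.continuousOn P.boundary₁ (closure_mono hs hxc)
      exact ⟨M, hM.mono_left (nhdsWithin_mono x hs)⟩
    · obtain ⟨M, hM⟩ := exists_tendsto_of_mem_closure P.polyhedral₂.isOpen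
        P.contDiffOn₂.continuousOn P.boundary₂ (closure_mono hs hxc)
      exact ⟨M, hM.mono_left (nhdsWithin_mono x hs)⟩
  rw [extendFrom_eq hxc hM]
  have hne : (𝓝[openElement K] x).NeBot := mem_closure_iff_nhdsWithin_neBot.1 hxc
  have h1 : Tendsto (fun y => ‖P.A y ξ‖) (𝓝[openElement K] x) (𝓝 ‖M ξ‖) :=
    ((((ContinuousLinearMap.apply ℝ (E d) ξ).continuous).tendsto M).comp hM).norm
  refine le_of_tendsto h1 ?_
  filter_upwards [self_mem_nhdsWithin] with y hy
  exact P.norm_A_le_alpha (F.openElement_subset_union hd hK hy) ξ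

/-- The estimates use only this bound on the normal, never its direction. It also covers a vanishing
vector, whose normalisation is zero. -/
theorem norm_outerNormal_le (K e : Finset (E d)) : ‖outerNormal K e‖ ≤ 1 := by
  rw [outerNormal, norm_smul, norm_inv, norm_norm]
  exact inv_mul_le_one

theorem MeshFamily.etaMin_le {e : Finset (E d)} (he : e ∈ (F.mesh h).edges) :
    F.etaMin ≤ F.η h e := by
  refine csInf_le ?_ ⟨h, e, he, rfl⟩
  -- A set unbounded below has real infimum 0 by convention, so positivity of the infimum already
  -- implies boundedness below.
  by_contra hb
  have := F.η_pos
  rw [Real.sInf_of_not_bddBelow hb] at this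
  exact lt_irrefl _ this

end Coefficient

/-! ### Cauchy-Schwarz inequalities and gradients in L² -/

section Estimates

/-- The quadratic t ↦ ∫ (t f + g)² is nonnegative, so its discriminant is not positive. -/
theorem integral_mul_sq_le {α : Type*} [MeasurableSpace α] {μ : Measure α} {f g : α → ℝ}
    (hf : MemLp f 2 μ) (hg : MemLp g 2 μ) :
    (∫ x, f x * g x ∂μ) ^ 2 ≤ (∫ x, f x ^ 2 ∂μ) * ∫ x, g x ^ 2 ∂μ := by
  have hfg : Integrable (fun x => f x * g x) μ := hf.integrable_mul hg
  have key : ∀ t : ℝ, 0 ≤ (∫ x, f x ^ 2 ∂μ) * (t * t) + (2 * ∫ x, f x * g x ∂μ) * t +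
      ∫ x, g x ^ 2 ∂μ := by
    intro t
    have h1 : 0 ≤ ∫ x, (t * t * f x ^ 2 + 2 * t * (f x * g x) + g x ^ 2) ∂μ := by
      refine integral_nonneg fun x => ?_
      have : t * t * f x ^ 2 + 2 * t * (f x * g x) + g x ^ 2 = (t * f x + g x) ^ 2 := by ring
      dsimp only
      rw [this]; exact sq_nonneg _
    have i1 : Integrable (fun x => t * t * f x ^ 2) μ := hf.integrable_sq.const_mul _
    have i2 : Integrable (fun x => 2 * t * (f x * g x)) μ := hfg.const_mul _
    have i3 : Integrable (fun x => t * t * f x ^ 2 + 2 * t * (f x * g x)) μ := i1.add i2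
    rw [integral_add i3 hg.integrable_sq, integral_add i1 i2, integral_const_mul,
      integral_const_mul] at h1
    linarith
  have := discrim_le_zero key
  rw [discrim] at this
  linarith

theorem integral_mul_le_sqrt {α : Type*} [MeasurableSpace α] {μ : Measure α} {f g : α → ℝ}
    (hf : MemLp f 2 μ) (hg : MemLp g 2 μ) :
    ∫ x, f x * g x ∂μ ≤ Real.sqrt (∫ x, f x ^ 2 ∂μ) * Real.sqrt (∫ x, g x ^ 2 ∂μ) := by
  rw [← Real.sqrt_mul (integral_nonneg fun x => sq_nonneg _)]
  exact (le_abs_self _).trans (Real.abs_le_sqrt (integral_mul_sq_le hf hg))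

/-- The Cauchy-Schwarz inequality for an integrand that is dominated by a product. -/
theorem abs_integral_le_of_abs_le {α : Type*} [MeasurableSpace α] {μ : Measure α} {F f g : α → ℝ}
    {a : ℝ} (ha : 0 ≤ a) (hf : MemLp f 2 μ) (hg : MemLp g 2 μ)
    (h : ∀ᵐ x ∂μ, |F x| ≤ a * (|f x| * |g x|)) :
    |∫ x, F x ∂μ| ≤ a * (Real.sqrt (∫ x, f x ^ 2 ∂μ) * Real.sqrt (∫ x, g x ^ 2 ∂μ)) := by
  have hi : Integrable (fun x => a * (|f x| * |g x|)) μ :=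
    (hf.abs.integrable_mul hg.abs).const_mul a
  -- This holds for any F, since a non-integrable function has integral 0 by convention. Hence no
  -- measurability of the boundary values of A is needed.
  have h1 := norm_integral_le_of_norm_le (f := F) hi h
  rw [integral_const_mul, Real.norm_eq_abs] at h1
  refine h1.trans (mul_le_mul_of_nonneg_left ?_ ha)
  have := integral_mul_le_sqrt hf.abs hg.abs
  simpa only [Pi.abs_apply, sq_abs] using this

variable {d : ℕ} {K e : Finset (E d)}

theorem aestronglyMeasurable_toLp {α : Type*} [MeasurableSpace α] {μ : Measure α}
    {f : Fin d → α → ℝ} (hf : ∀ i, AEStronglyMeasurable (f i) μ) :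
    AEStronglyMeasurable (fun x => (WithLp.toLp 2 fun i => f i x : E d)) μ :=
  (PiLp.continuous_toLp 2 _).comp_aestronglyMeasurable
    (aemeasurable_pi_lambda _ fun i => (hf i).aemeasurable).aestronglyMeasurable

theorem memLp_norm_toLp {α : Type*} [MeasurableSpace α] {μ : Measure α} {f : Fin d → α → ℝ}
    (hf : ∀ i, MemLp (f i) 2 μ) :
    MemLp (fun x => ‖(WithLp.toLp 2 fun i => f i x : E d)‖) 2 μ := by
  refine (memLp_two_iff_integrable_sq (aestronglyMeasurable_toLp fun i => (hf i).1).norm).2 ?_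
  simp only [EuclideanSpace.norm_sq_eq, Real.norm_eq_abs, sq_abs]
  exact integrable_finsetSum _ fun i _ => (hf i).integrable_sq

theorem memLp_norm_weakGrad {U : Set (E d)} {v : E d → ℝ} (hv : MemH1 U v) :
    MemLp (fun x => ‖weakGrad U v x‖) 2 (volume.restrict U) :=
  memLp_norm_toLp fun i => (hv.2 i).memLp

theorem integral_norm_weakGrad_sq {U : Set (E d)} {v : E d → ℝ} (hv : MemH1 U v) :
    ∫ x in U, ‖weakGrad U v x‖ ^ 2 = h1SemiSq U v := by
  rw [h1SemiSq, ← integral_finsetSum _ fun i _ => (hv.2 i).memLp.integrable_sq]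
  refine integral_congr_ae (Eventually.of_forall fun x => ?_)
  simp [EuclideanSpace.norm_sq_eq, weakGrad]

theorem memLp_norm_traceGrad (hd : 0 < d) (hK : IsElement K) (he : e ∈ facets K) {v : E d → ℝ}
    (hv : MemH2 (openElement K) v) :
    MemLp (fun x => ‖traceGrad K e v x‖) 2 (faceMeasure e) :=
  memLp_norm_toLp fun i => (hK.isTrace_trace hd he (hv.2 i)).1

theorem h1SemiSq_nonneg (U : Set (E d)) (v : E d → ℝ) : 0 ≤ h1SemiSq U v :=
  Finset.sum_nonneg fun _ _ => integral_nonneg fun _ => sq_nonneg _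

theorem h2SemiSq_nonneg (U : Set (E d)) (v : E d → ℝ) : 0 ≤ h2SemiSq U v :=
  Finset.sum_nonneg fun _ _ => h1SemiSq_nonneg _ _

end Estimates

/-! ### Estimates of the terms of the bilinear form, and boundedness -/

section Forms

variable {d : ℕ}

/-- The local energy `|v|²_{H¹(K)} + h_K² |v|²_{H²(K)}`. -/
noncomputable def energy (K : Finset (E d)) (v : E d → ℝ) : ℝ :=
  h1SemiSq (openElement K) v + size K ^ 2 * h2SemiSq (openElement K) v

/-- The squared `L²(e)`-norm of the jump `v̂ - v`, with `v` taken from inside `K`. -/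
noncomputable def jumpSq (K e : Finset (E d)) (v : HPair d) : ℝ :=
  ∫ x, (v.2 x - trace K e v.1 x) ^ 2 ∂faceMeasure e

/-- The pairs for which all terms of the bilinear form are meaningful. -/
def IsAdmissible {Ω : Set (E d)} (T : Triangulation Ω) (v : HPair d) : Prop :=
  (∀ K ∈ T.elements, MemH2 (openElement K) v.1) ∧ MemLp v.2 2 (surfaceOn T.skeleton)

theorem energy_nonneg (K : Finset (E d)) (v : E d → ℝ) : 0 ≤ energy K v :=
  add_nonneg (h1SemiSq_nonneg _ _) (mul_nonneg (sq_nonneg _) (h2SemiSq_nonneg _ _))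

theorem jumpSq_nonneg (K e : Finset (E d)) (v : HPair d) : 0 ≤ jumpSq K e v :=
  integral_nonneg fun _ => sq_nonneg _

theorem isAdmissible_of_mem_V2 {Ω : Set (E d)} {T : Triangulation Ω} {v : HPair d}
    (hv : v ∈ V2 T) : IsAdmissible T v :=
  ⟨hv.1.2, hv.2.1.1⟩

/-- Discrete skeleton functions may jump between faces and need not be in H^{1/2}. Admissibility
asks only for L² there, so the same estimates serve both spaces. -/
theorem isAdmissible_of_mem_Vh {Ω : Set (E d)} {T : Triangulation Ω} {k l : ℕ} {v : HPair d}
    (hv : v ∈ Vh T k l) : IsAdmissible T v := by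
  refine ⟨fun K hK => ?_, hv.2.1.1⟩
  obtain ⟨p, -, hp⟩ := (hv.1.2 K hK).2
  exact memH2_of_polyFun (p := p) hp

theorem IsAdmissible.memLp_jump {Ω : Set (E d)} {T : Triangulation Ω} {v : HPair d}
    (hv : IsAdmissible T v) (hd : 0 < d) {K e : Finset (E d)} (hK : K ∈ T.elements)
    (he : e ∈ facets K) : MemLp (fun x => v.2 x - trace K e v.1 x) 2 (faceMeasure e) := by
  have hsub : closedSimplex e ⊆ T.skeleton :=
    Set.subset_biUnion_of_mem (u := fun e => closedSimplex e) (show e ∈ T.edges from ⟨K, hK, he⟩)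
  have h1 : MemLp v.2 2 (faceMeasure e) :=
    hv.2.mono_measure (Measure.restrict_mono hsub le_rfl)
  exact h1.sub ((T.isElement hK).isTrace_trace hd he (hv.1 K hK).1).1

variable {P : InterfaceProblem d} (F : MeshFamily P) (h : F.ι)

/-- The sum of the local energies. -/
noncomputable def meshEnergy (v : HPair d) : ℝ := ∑ K ∈ (F.mesh h).elements, energy K v.1

/-- The penalty part of the squared norm. -/
noncomputable def penalty (v : HPair d) : ℝ :=
  ∑ K ∈ (F.mesh h).elements, ∑ e ∈ facets K, F.η h e / size e * jumpSq K e v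

variable {F h}

theorem norm2Sq_eq (v : HPair d) : norm2Sq F h v = meshEnergy F h v + penalty F h v := by
  simp only [norm2Sq, meshEnergy, penalty, energy, jumpSq, Finset.sum_add_distrib]

theorem MeshFamily.eta_pos {K e : Finset (E d)} (hK : K ∈ (F.mesh h).elements)
    (he : e ∈ facets K) : 0 < F.η h e :=
  lt_of_lt_of_le F.η_pos (F.etaMin_le ⟨K, hK, he⟩)

theorem penalty_term_nonneg {K e : Finset (E d)} (hK : K ∈ (F.mesh h).elements)
    (he : e ∈ facets K) (v : HPair d) : 0 ≤ F.η h e / size e * jumpSq K e v :=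
  mul_nonneg (div_nonneg (F.eta_pos hK he).le (size_nonneg e)) (jumpSq_nonneg K e v)

theorem meshEnergy_nonneg (v : HPair d) : 0 ≤ meshEnergy F h v :=
  Finset.sum_nonneg fun K _ => energy_nonneg K v.1

theorem penalty_nonneg (v : HPair d) : 0 ≤ penalty F h v :=
  Finset.sum_nonneg fun _ hK => Finset.sum_nonneg fun _ he => penalty_term_nonneg hK he v

theorem norm2_sq (v : HPair d) : norm2 F h v ^ 2 = meshEnergy F h v + penalty F h v := by
  rw [norm2, norm2Sq_eq, Real.sq_sqrt (add_nonneg (meshEnergy_nonneg v) (penalty_nonneg v))]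

theorem sqrt_meshEnergy_le (v : HPair d) : Real.sqrt (meshEnergy F h v) ≤ norm2 F h v := by
  rw [norm2, norm2Sq_eq]
  exact Real.sqrt_le_sqrt (le_add_of_nonneg_right (penalty_nonneg v))

theorem sqrt_penalty_le (v : HPair d) : Real.sqrt (penalty F h v) ≤ norm2 F h v := by
  rw [norm2, norm2Sq_eq]
  exact Real.sqrt_le_sqrt (le_add_of_nonneg_left (meshEnergy_nonneg v))

theorem sum_mul_sqrt_le {ι : Type*} (s : Finset ι) {f g : ι → ℝ} (hf : ∀ i ∈ s, 0 ≤ f i)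
    (hg : ∀ i ∈ s, 0 ≤ g i) :
    ∑ i ∈ s, Real.sqrt (f i) * Real.sqrt (g i) ≤
      Real.sqrt (∑ i ∈ s, f i) * Real.sqrt (∑ i ∈ s, g i) := by
  have h := Finset.sum_mul_sq_le_sq_mul_sq s (fun i => Real.sqrt (f i)) (fun i => Real.sqrt (g i))
  rw [← Real.sqrt_mul (Finset.sum_nonneg hf)]
  refine Real.le_sqrt_of_sq_le (h.trans (le_of_eq ?_))
  rw [Finset.sum_congr rfl fun i hi => Real.sq_sqrt (hf i hi),
    Finset.sum_congr rfl fun i hi => Real.sq_sqrt (hg i hi)]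

/-- Cauchy-Schwarz on e with |A| ≤ α and |n| ≤ 1; the factor h_e⁻¹ from the trace inequality is then
moved to the jump. -/
theorem abs_fluxTerm_le (hd : 2 ≤ d) {c₁ : ℝ} (hc₁ : 0 < c₁) (hF : IsTraceConst F c₁) {w v : HPair d}
    (hw : IsAdmissible (F.mesh h) w) (hv : IsAdmissible (F.mesh h) v) {K e : Finset (E d)}
    (hK : K ∈ (F.mesh h).elements) (he : e ∈ facets K) :
    |fluxTerm P.A K e w.1 v| ≤ P.alpha * Real.sqrt (c₁ / F.etaMin) *
      (Real.sqrt (energy K w.1) * Real.sqrt (F.η h e / size e * jumpSq K e v)) := by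
  have hd0 : 0 < d := by omega
  have hel := (F.mesh h).isElement hK
  have hη := F.eta_pos hK he
  have hηm : 0 < F.etaMin := F.η_pos
  have hs := size_facet_pos hd he
  have hα := P.alpha_nonneg
  have h1 : |fluxTerm P.A K e w.1 v| ≤ P.alpha *
      (Real.sqrt (∫ x, ‖traceGrad K e w.1 x‖ ^ 2 ∂faceMeasure e) * Real.sqrt (jumpSq K e v)) := by
    refine abs_integral_le_of_abs_le hα (memLp_norm_traceGrad hd0 hel he (hw.1 K hK))
      (hv.memLp_jump hd0 hK he) ?_
    refine (ae_restrict_iff' (measurableSet_closedSimplex e)).2 (Eventually.of_forall fun x hx => ?_)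
    have hxK : x ∈ closedSimplex K :=
      convexHull_mono (by exact_mod_cast (Finset.mem_powersetCard.1 he).1) hx
    have h2 := abs_real_inner_le_norm (extendFrom (openElement K) P.A x (traceGrad K e w.1 x))
      (outerNormal K e)
    have h3 := F.norm_extendFrom_le hd0 hK hxK (traceGrad K e w.1 x)
    have h4 := norm_outerNormal_le K e
    rw [abs_mul, abs_sub_comm, abs_norm, ← mul_assoc]
    refine mul_le_mul_of_nonneg_right (h2.trans ?_) (abs_nonneg _)
    calc _ ≤ P.alpha * ‖traceGrad K e w.1 x‖ * 1 :=
          mul_le_mul h3 h4 (norm_nonneg _) (by positivity)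
      _ = _ := mul_one _
  refine h1.trans ?_
  rw [mul_assoc]
  refine mul_le_mul_of_nonneg_left ?_ hα
  have hE := energy_nonneg K w.1
  have hJ := jumpSq_nonneg K e v
  rw [← Real.sqrt_mul (integral_nonneg fun x => sq_nonneg _), ← Real.sqrt_mul hE,
    ← Real.sqrt_mul (by positivity)]
  refine Real.sqrt_le_sqrt ?_
  have h5 : ∫ x, ‖traceGrad K e w.1 x‖ ^ 2 ∂faceMeasure e ≤ c₁ * (size e)⁻¹ * energy K w.1 :=
    hF h K hK e he w.1 (hw.1 K hK)
  -- Inserting this factor turns the weight 1/h_e of the jump into η_e/h_e and leaves 1/η_min in the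
  -- constant.
  have h6 : 1 ≤ F.η h e / F.etaMin := by
    rw [one_le_div hηm]; exact F.etaMin_le ⟨K, hK, he⟩
  calc _ ≤ c₁ * (size e)⁻¹ * energy K w.1 * jumpSq K e v := by gcongr
    _ ≤ c₁ * (size e)⁻¹ * energy K w.1 * jumpSq K e v * (F.η h e / F.etaMin) :=
        le_mul_of_one_le_right (by positivity) h6
    _ = _ := by ring

/-- The energy of K is used once for each of its d + 1 faces, which costs the factor √(d + 1). A
discrete Cauchy-Schwarz inequality over the elements finishes. -/
theorem sum_abs_fluxTerm_le (hd : 2 ≤ d) {c₁ : ℝ} (hc₁ : 0 < c₁) (hF : IsTraceConst F c₁)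
    {w v : HPair d} (hw : IsAdmissible (F.mesh h) w) (hv : IsAdmissible (F.mesh h) v) :
    |∑ K ∈ (F.mesh h).elements, ∑ e ∈ facets K, fluxTerm P.A K e w.1 v| ≤
      P.alpha * Real.sqrt (c₁ / F.etaMin) * (Real.sqrt (d + 1) *
        (Real.sqrt (meshEnergy F h w) * Real.sqrt (penalty F h v))) := by
  have h1 : |∑ K ∈ (F.mesh h).elements, ∑ e ∈ facets K, fluxTerm P.A K e w.1 v| ≤
      ∑ K ∈ (F.mesh h).elements, ∑ e ∈ facets K, P.alpha * Real.sqrt (c₁ / F.etaMin) *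
      (Real.sqrt (energy K w.1) * Real.sqrt (F.η h e / size e * jumpSq K e v)) := by
    refine (Finset.abs_sum_le_sum_abs _ _).trans (Finset.sum_le_sum fun K hK => ?_)
    refine (Finset.abs_sum_le_sum_abs _ _).trans (Finset.sum_le_sum fun e he => ?_)
    exact abs_fluxTerm_le hd hc₁ hF hw hv hK he
  refine h1.trans ?_
  simp only [← Finset.mul_sum]
  have hα := P.alpha_nonneg
  refine mul_le_mul_of_nonneg_left ?_ (by positivity)
  have h2 : ∀ K ∈ (F.mesh h).elements, Real.sqrt (energy K w.1) *
      ∑ e ∈ facets K, Real.sqrt (F.η h e / size e * jumpSq K e v) ≤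
      Real.sqrt (d + 1) * (Real.sqrt (energy K w.1) *
        Real.sqrt (∑ e ∈ facets K, F.η h e / size e * jumpSq K e v)) := by
    intro K hK
    have h3 : ∑ e ∈ facets K, Real.sqrt (F.η h e / size e * jumpSq K e v) ≤
        Real.sqrt (d + 1) * Real.sqrt (∑ e ∈ facets K, F.η h e / size e * jumpSq K e v) := by
      rw [← Real.sqrt_mul (by positivity)]
      refine Real.le_sqrt_of_sq_le ?_
      have h4 := sq_sum_le_card_mul_sum_sq (s := facets K)
        (f := fun e => Real.sqrt (F.η h e / size e * jumpSq K e v))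
      rw [facets_card ((F.mesh h).isElement hK).1] at h4
      refine h4.trans (le_of_eq ?_)
      push_cast
      congr 1
      exact Finset.sum_congr rfl fun e he => Real.sq_sqrt (penalty_term_nonneg hK he v)
    calc _ ≤ Real.sqrt (energy K w.1) * (Real.sqrt (d + 1) *
          Real.sqrt (∑ e ∈ facets K, F.η h e / size e * jumpSq K e v)) := by gcongr
      _ = _ := by ring
  refine (Finset.sum_le_sum h2).trans ?_
  rw [← Finset.mul_sum]
  refine mul_le_mul_of_nonneg_left ?_ (Real.sqrt_nonneg _)
  exact sum_mul_sqrt_le _ (fun K _ => energy_nonneg K w.1)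
    fun K hK => Finset.sum_nonneg fun e he => penalty_term_nonneg hK he v

theorem sum_volume_le (hd : 0 < d) {w v : HPair d} (hw : IsAdmissible (F.mesh h) w)
    (hv : IsAdmissible (F.mesh h) v) :
    ∑ K ∈ (F.mesh h).elements, ∫ x in openElement K,
      inner ℝ (P.A x (weakGrad (openElement K) w.1 x)) (weakGrad (openElement K) v.1 x) ≤
      P.alpha * (Real.sqrt (meshEnergy F h w) * Real.sqrt (meshEnergy F h v)) := by
  have hα := P.alpha_nonneg
  have h1 : ∀ K ∈ (F.mesh h).elements, ∫ x in openElement K,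
      inner ℝ (P.A x (weakGrad (openElement K) w.1 x)) (weakGrad (openElement K) v.1 x) ≤
      P.alpha * (Real.sqrt (energy K w.1) * Real.sqrt (energy K v.1)) := by
    intro K hK
    have h2 := abs_integral_le_of_abs_le hα (memLp_norm_weakGrad (hw.1 K hK).1)
      (memLp_norm_weakGrad (hv.1 K hK).1)
      (F := fun x => inner ℝ (P.A x (weakGrad (openElement K) w.1 x))
        (weakGrad (openElement K) v.1 x)) (by
        refine (ae_restrict_iff' (isOpen_openElement K).measurableSet).2
          (Eventually.of_forall fun x hx => ?_)
        refine (abs_real_inner_le_norm _ _).trans ?_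
        rw [abs_norm, abs_norm, ← mul_assoc]
        exact mul_le_mul_of_nonneg_right
          (P.norm_A_le_alpha (F.openElement_subset_union hd hK hx) _) (norm_nonneg _))
    rw [integral_norm_weakGrad_sq (hw.1 K hK).1, integral_norm_weakGrad_sq (hv.1 K hK).1] at h2
    refine (le_abs_self _).trans (h2.trans ?_)
    have h3 : ∀ u : E d → ℝ, h1SemiSq (openElement K) u ≤ energy K u := fun u =>
      le_add_of_nonneg_right (mul_nonneg (sq_nonneg _) (h2SemiSq_nonneg _ _))
    gcongr <;> exact h3 _
  refine (Finset.sum_le_sum h1).trans ?_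
  rw [← Finset.mul_sum]
  exact mul_le_mul_of_nonneg_left (sum_mul_sqrt_le _ (fun K _ => energy_nonneg K _)
    fun K _ => energy_nonneg K _) hα

theorem sum_penalty_le (hd : 0 < d) {w v : HPair d} (hw : IsAdmissible (F.mesh h) w)
    (hv : IsAdmissible (F.mesh h) v) :
    ∑ K ∈ (F.mesh h).elements, ∑ e ∈ facets K, ∫ x, F.η h e / size e *
      ((trace K e w.1 x - w.2 x) * (trace K e v.1 x - v.2 x)) ∂faceMeasure e ≤
      Real.sqrt (penalty F h w) * Real.sqrt (penalty F h v) := by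
  refine le_trans (Finset.sum_le_sum fun K hK => ?_) (sum_mul_sqrt_le _
    (fun K hK => Finset.sum_nonneg fun e he => penalty_term_nonneg hK he w)
    (fun K hK => Finset.sum_nonneg fun e he => penalty_term_nonneg hK he v))
  refine le_trans (Finset.sum_le_sum fun e he => ?_) (sum_mul_sqrt_le _
    (fun e he => penalty_term_nonneg hK he w) (fun e he => penalty_term_nonneg hK he v))
  have h0 : 0 ≤ F.η h e / size e := div_nonneg (F.eta_pos hK he).le (size_nonneg e)
  have h1 := integral_mul_le_sqrt (hw.memLp_jump hd hK he) (hv.memLp_jump hd hK he)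
  rw [integral_const_mul, Real.sqrt_mul h0, Real.sqrt_mul h0]
  have e1 : ∫ x, (trace K e w.1 x - w.2 x) * (trace K e v.1 x - v.2 x) ∂faceMeasure e =
      ∫ x, (w.2 x - trace K e w.1 x) * (v.2 x - trace K e v.1 x) ∂faceMeasure e := by
    congr 1; ext x; ring
  rw [e1]
  calc _ ≤ F.η h e / size e * (Real.sqrt (jumpSq K e w) * Real.sqrt (jumpSq K e v)) :=
        mul_le_mul_of_nonneg_left h1 h0
    _ = (Real.sqrt (F.η h e / size e) * Real.sqrt (F.η h e / size e)) *
        (Real.sqrt (jumpSq K e w) * Real.sqrt (jumpSq K e v)) := by rw [Real.mul_self_sqrt h0]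
    _ = _ := by ring

/-- The constant of the boundedness estimate. -/
noncomputable def boundConst (α η : ℝ) (d : ℕ) (c₁ : ℝ) : ℝ :=
  |α| + 2 * (|α| * Real.sqrt (c₁ / η) * Real.sqrt (d + 1)) + 1

theorem boundConst_pos (α η : ℝ) (d : ℕ) (c₁ : ℝ) : 0 < boundConst α η d c₁ := by
  rw [boundConst]; positivity

/-- Of the constant, |α| pays for the volume term, the doubled product for the two flux sums, and 1
for the penalty term. -/
theorem B_le (hd : 2 ≤ d) {c₁ : ℝ} (hc₁ : 0 < c₁) (hF : IsTraceConst F c₁) {w v : HPair d}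
    (hw : IsAdmissible (F.mesh h) w) (hv : IsAdmissible (F.mesh h) v) :
    B F h w v ≤ boundConst P.alpha F.etaMin d c₁ * norm2 F h w * norm2 F h v := by
  have hα := P.alpha_nonneg
  have h1 := sum_volume_le (by omega) hw hv
  have h2 := neg_abs_le _ |>.trans' (neg_le_neg (sum_abs_fluxTerm_le hd hc₁ hF hw hv))
  have h3 := neg_abs_le _ |>.trans' (neg_le_neg (sum_abs_fluxTerm_le hd hc₁ hF hv hw))
  have h4 := sum_penalty_le (by omega) hw hv
  have hw0 : 0 ≤ norm2 F h w := Real.sqrt_nonneg _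
  have hv0 : 0 ≤ norm2 F h v := Real.sqrt_nonneg _
  have g1 : Real.sqrt (meshEnergy F h w) * Real.sqrt (meshEnergy F h v) ≤
      norm2 F h w * norm2 F h v :=
    mul_le_mul (sqrt_meshEnergy_le w) (sqrt_meshEnergy_le v) (Real.sqrt_nonneg _) hw0
  have g2 : Real.sqrt (meshEnergy F h w) * Real.sqrt (penalty F h v) ≤
      norm2 F h w * norm2 F h v :=
    mul_le_mul (sqrt_meshEnergy_le w) (sqrt_penalty_le v) (Real.sqrt_nonneg _) hw0
  have g3 : Real.sqrt (meshEnergy F h v) * Real.sqrt (penalty F h w) ≤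
      norm2 F h w * norm2 F h v := by
    rw [mul_comm]
    exact mul_le_mul (sqrt_penalty_le w) (sqrt_meshEnergy_le v) (Real.sqrt_nonneg _) hw0
  have g4 : Real.sqrt (penalty F h w) * Real.sqrt (penalty F h v) ≤
      norm2 F h w * norm2 F h v :=
    mul_le_mul (sqrt_penalty_le w) (sqrt_penalty_le v) (Real.sqrt_nonneg _) hw0
  set X := norm2 F h w * norm2 F h v
  set β := P.alpha * Real.sqrt (c₁ / F.etaMin) * Real.sqrt (d + 1) with hβ
  have hβ0 : 0 ≤ β := by positivity
  have k1 := mul_le_mul_of_nonneg_left g1 hα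
  have k2 := mul_le_mul_of_nonneg_left g2 hβ0
  have k3 := mul_le_mul_of_nonneg_left g3 hβ0
  rw [← mul_assoc, ← hβ] at h2 h3
  rw [mul_assoc, boundConst, abs_of_nonneg hα, ← hβ, B]
  change _ ≤ (P.alpha + 2 * β + 1) * X
  linarith

end Forms

/-! ### Coercivity on the discrete space -/

section Coercivity

variable {d : ℕ} {P : InterfaceProblem d} {F : MeshFamily P} {h : F.ι}

/-- The inverse inequality is postulated for global elements of V_{h,k}. Extension by zero makes it
available for a polynomial given on one element only. -/
theorem memVh_indicator {Ω : Set (E d)} (T : Triangulation Ω) {K : Finset (E d)}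
    (hK : K ∈ T.elements) {k : ℕ} {p : MvPolynomial (Fin d) ℝ} (hp : p.totalDegree ≤ k) :
    MemVh T k ((openElement K).indicator (polyFun p)) := by
  have hm := (isOpen_openElement K).measurableSet
  refine ⟨((memLp_indicator_iff_restrict hm).2 (memLp_polyFun p K)).restrict Ω, fun K' hK' => ?_⟩
  suffices ∃ q : MvPolynomial (Fin d) ℝ, q.totalDegree ≤ k ∧
      (openElement K).indicator (polyFun p) =ᵐ[volume.restrict (openElement K')] polyFun q by
    obtain ⟨q, hq, hqe⟩ := this
    exact ⟨memH1_of_polyFun hqe, q, hq, hqe⟩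
  have hm' := (isOpen_openElement K').measurableSet
  by_cases hKK : K' = K
  · subst hKK
    refine ⟨p, hp, (ae_restrict_iff' hm').2 (Eventually.of_forall fun x hx => ?_)⟩
    rw [Set.indicator_of_mem hx]
  · refine ⟨0, by simp, (ae_restrict_iff' hm').2 (Eventually.of_forall fun x hx => ?_)⟩
    rw [Set.indicator_of_notMem (Set.disjoint_left.1 (T.disjoint_openElement hK hK' hKK) hx)]
    simp [polyFun]

/-- Each partial derivative is again a polynomial of degree at most k on K, so the inverse
inequality applies to it, and the factor h_K² cancels. -/
theorem h2SemiSq_le (hd : 2 ≤ d) {k : ℕ} {c₂ : ℝ} (hF : IsInverseConst F k c₂)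
    {K : Finset (E d)} (hK : K ∈ (F.mesh h).elements) {v : E d → ℝ}
    (hv : MemVh (F.mesh h) k v) :
    size K ^ 2 * h2SemiSq (openElement K) v ≤ c₂ ^ 2 * h1SemiSq (openElement K) v := by
  obtain ⟨p, hp, hvp⟩ := (hv.2 K hK).2
  have hs : 0 < size K := size_pos (by rw [((F.mesh h).isElement hK).1]; omega)
  have hm := (isOpen_openElement K).measurableSet
  rw [h2SemiSq, h1SemiSq, Finset.mul_sum, Finset.mul_sum]
  refine Finset.sum_le_sum fun i _ => ?_
  set q := MvPolynomial.pderiv i p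
  have hq : weakPartial (openElement K) i v =ᵐ[volume.restrict (openElement K)] polyFun q :=
    weakPartial_polyFun hvp i
  have hu : (openElement K).indicator (polyFun q) =ᵐ[volume.restrict (openElement K)] polyFun q :=
    (ae_restrict_iff' hm).2 (Eventually.of_forall fun x hx => Set.indicator_of_mem hx _)
  have h1 := hF h K hK _ (memVh_indicator (F.mesh h) hK ((totalDegree_pderiv_le p i).trans hp))
  rw [h1SemiSq_polyFun hu, ← h1SemiSq_polyFun hq] at h1
  have h2 : ∫ x in openElement K, (openElement K).indicator (polyFun q) x ^ 2 =
      ∫ x in openElement K, weakPartial (openElement K) i v x ^ 2 :=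
    integral_congr_ae (by filter_upwards [hu, hq] with x hx hx'; rw [hx, hx'])
  rw [h2] at h1
  have h3 := pow_le_pow_left₀ (Real.sqrt_nonneg _) h1 2
  rw [Real.sq_sqrt (h1SemiSq_nonneg _ _), mul_pow, mul_pow,
    Real.sq_sqrt (integral_nonneg fun x => sq_nonneg _)] at h3
  calc _ ≤ size K ^ 2 * (c₂ ^ 2 * (size K)⁻¹ ^ 2 *
        ∫ x in openElement K, weakPartial (openElement K) i v x ^ 2) := by gcongr
    _ = _ := by field_simp

/-- Pointwise ellipticity gives the bound, but monotonicity of the integral requires an integrable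
integrand. Its measurability comes from the continuity of A on the open element. -/
theorem le_volume (hd : 0 < d) {K : Finset (E d)} (hK : K ∈ (F.mesh h).elements) {v : E d → ℝ}
    (hv : MemH1 (openElement K) v) :
    P.lamMin * h1SemiSq (openElement K) v ≤ ∫ x in openElement K,
      inner ℝ (P.A x (weakGrad (openElement K) v x)) (weakGrad (openElement K) v x) := by
  have hm := (isOpen_openElement K).measurableSet
  have hL := memLp_norm_weakGrad hv
  have hg : AEStronglyMeasurable (weakGrad (openElement K) v) (volume.restrict (openElement K)) :=
    aestronglyMeasurable_toLp fun i => (hv.2 i).memLp.1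
  have hA : AEStronglyMeasurable P.A (volume.restrict (openElement K)) :=
    (F.continuousOn_A hd hK).aestronglyMeasurable hm
  have hAg : AEStronglyMeasurable (fun x => P.A x (weakGrad (openElement K) v x))
      (volume.restrict (openElement K)) :=
    isBoundedBilinearMap_apply.continuous.comp_aestronglyMeasurable (hA.prodMk hg)
  have hint : Integrable (fun x => inner ℝ (P.A x (weakGrad (openElement K) v x))
      (weakGrad (openElement K) v x)) (volume.restrict (openElement K)) := by
    refine (hL.integrable_sq.const_mul P.alpha).mono' (hAg.inner hg) ?_
    refine (ae_restrict_iff' hm).2 (Eventually.of_forall fun x hx => ?_)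
    refine (norm_inner_le_norm _ _).trans ?_
    rw [sq, ← mul_assoc]
    exact mul_le_mul_of_nonneg_right
      (P.norm_A_le_alpha (F.openElement_subset_union hd hK hx) _) (norm_nonneg _)
  rw [← integral_norm_weakGrad_sq hv, ← integral_const_mul]
  refine integral_mono_ae (hL.integrable_sq.const_mul _) hint ?_
  refine (ae_restrict_iff' hm).2 (Eventually.of_forall fun x hx => ?_)
  dsimp only
  rw [real_inner_comm]
  exact (P.elliptic x (F.openElement_subset_domain hd hK hx) _).1

/-- The threshold for the penalty parameters. -/
noncomputable def penaltyThreshold (α lam : ℝ) (d : ℕ) (c₁ c₂ : ℝ) : ℝ :=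
  4 * α ^ 2 * (d + 1) * |c₁| * (1 + c₂ ^ 2) / |lam| + 1

/-- The coercivity constant. -/
noncomputable def coercConst (lam c₂ : ℝ) : ℝ := min (lam / (2 * (1 + c₂ ^ 2))) (1 / 2)

theorem penaltyThreshold_pos (α lam : ℝ) (d : ℕ) (c₁ c₂ : ℝ) :
    0 < penaltyThreshold α lam d c₁ c₂ := by
  rw [penaltyThreshold]; positivity

theorem coercConst_pos {lam : ℝ} (hlam : 0 < lam) (c₂ : ℝ) : 0 < coercConst lam c₂ := by
  rw [coercConst]; positivity

/-- With H the broken H¹ energy and J the penalty, the form is at least λ_min H - 2 √(M H J) + J.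
Young's inequality keeps half of H and half of J; since the full energy is at most (1 + c₂²) H, the
constant is the smaller of the two remaining coefficients. -/
theorem le_B (hd : 2 ≤ d) {k l : ℕ} {c₁ c₂ : ℝ} (hc₁ : 0 < c₁) (hF₁ : IsTraceConst F c₁)
    (hF₂ : IsInverseConst F k c₂)
    (hη : penaltyThreshold P.alpha P.lamMin d c₁ c₂ ≤ F.etaMin) {v : HPair d}
    (hv : v ∈ Vh (F.mesh h) k l) :
    coercConst P.lamMin c₂ * norm2 F h v ^ 2 ≤ B F h v v := by
  have hd0 : 0 < d := by omega
  have hα := P.alpha_nonneg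
  have hlam := P.lamMin_pos
  have hηm : 0 < F.etaMin := F.η_pos
  have hva := isAdmissible_of_mem_Vh hv
  set H := ∑ K ∈ (F.mesh h).elements, h1SemiSq (openElement K) v.1 with hH
  have hH0 : 0 ≤ H := Finset.sum_nonneg fun K _ => h1SemiSq_nonneg _ _
  have hN : meshEnergy F h v ≤ (1 + c₂ ^ 2) * H := by
    rw [meshEnergy, hH, Finset.mul_sum]
    refine Finset.sum_le_sum fun K hK => ?_
    have := h2SemiSq_le hd hF₂ hK hv.1
    rw [energy]; linarith
  have hJ0 : 0 ≤ penalty F h v := penalty_nonneg v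
  have hN0 : 0 ≤ meshEnergy F h v := meshEnergy_nonneg v
  have hvol : P.lamMin * H ≤ ∑ K ∈ (F.mesh h).elements, ∫ x in openElement K,
      inner ℝ (P.A x (weakGrad (openElement K) v.1 x)) (weakGrad (openElement K) v.1 x) := by
    rw [hH, Finset.mul_sum]
    exact Finset.sum_le_sum fun K hK => le_volume hd0 hK (hva.1 K hK).1
  have hflux := (le_abs_self _).trans (sum_abs_fluxTerm_le hd hc₁ hF₁ hva hva)
  have hpen : ∑ K ∈ (F.mesh h).elements, ∑ e ∈ facets K, ∫ x, F.η h e / size e *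
      ((trace K e v.1 x - v.2 x) * (trace K e v.1 x - v.2 x)) ∂faceMeasure e = penalty F h v := by
    refine Finset.sum_congr rfl fun K _ => Finset.sum_congr rfl fun e _ => ?_
    rw [integral_const_mul, jumpSq]
    congr 2; ext x; ring
  set J := penalty F h v with hJ
  set N := meshEnergy F h v
  -- M is the squared constant of one flux sum after the full energy has been replaced by (1 + c₂²)
  -- H. The threshold for η_min is chosen to make 4 M ≤ λ_min.
  set M := P.alpha ^ 2 * (c₁ / F.etaMin) * (d + 1) * (1 + c₂ ^ 2) with hM
  have hM0 : 0 ≤ M := by positivity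
  have hMle : 4 * M ≤ P.lamMin := by
    rw [penaltyThreshold, abs_of_pos hc₁, abs_of_pos hlam] at hη
    have h1 : 4 * P.alpha ^ 2 * (d + 1) * c₁ * (1 + c₂ ^ 2) / P.lamMin ≤ F.etaMin := by linarith
    rw [div_le_iff₀ hlam] at h1
    have h2 : 4 * M = 4 * P.alpha ^ 2 * (d + 1) * c₁ * (1 + c₂ ^ 2) / F.etaMin := by
      rw [hM]; ring
    rw [h2, div_le_iff₀ hηm]
    linarith
  have hflux2 : P.alpha * Real.sqrt (c₁ / F.etaMin) * (Real.sqrt (d + 1) *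
      (Real.sqrt N * Real.sqrt J)) ≤ Real.sqrt (M * (H * J)) := by
    refine Real.le_sqrt_of_sq_le ?_
    simp only [mul_pow]
    rw [Real.sq_sqrt (by positivity), Real.sq_sqrt (by positivity), Real.sq_sqrt hN0,
      Real.sq_sqrt hJ0]
    calc _ ≤ P.alpha ^ 2 * (c₁ / F.etaMin) * ((d + 1) * ((1 + c₂ ^ 2) * H * J)) := by gcongr
      _ = _ := by rw [hM]; ring
  -- The arithmetic-geometric mean inequality for λ_min H / 2 and J / 2, whose product λ_min H J / 4
  -- dominates M H J.
  have hyoung : 2 * Real.sqrt (M * (H * J)) ≤ P.lamMin / 2 * H + 1 / 2 * J := by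
    have h1 : M * (H * J) ≤ ((P.lamMin / 2 * H + 1 / 2 * J) / 2) ^ 2 := by
      have h2 : 4 * M * (H * J) ≤ P.lamMin * (H * J) :=
        mul_le_mul_of_nonneg_right hMle (mul_nonneg hH0 hJ0)
      nlinarith [sq_nonneg (P.lamMin / 2 * H - 1 / 2 * J)]
    have h3 := Real.sqrt_le_sqrt h1
    rw [Real.sqrt_sq (by positivity)] at h3
    linarith
  have hB : P.lamMin / 2 * H + 1 / 2 * J ≤ B F h v v := by
    rw [B, hpen]
    linarith
  refine le_trans ?_ hB
  rw [norm2_sq]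
  have c1 : coercConst P.lamMin c₂ * N ≤ P.lamMin / 2 * H := by
    calc _ ≤ P.lamMin / (2 * (1 + c₂ ^ 2)) * ((1 + c₂ ^ 2) * H) :=
          mul_le_mul (min_le_left _ _) hN hN0 (by positivity)
      _ = _ := by field_simp
  have c2 : coercConst P.lamMin c₂ * J ≤ 1 / 2 * J :=
    mul_le_mul_of_nonneg_right (min_le_right _ _) hJ0
  rw [mul_add]
  exact add_le_add c1 c2

end Coercivity

end HDG

/-- The constants are functions chosen before the dimension, the problem and the mesh family, so
their argument lists express exactly the claimed dependence. -/
theorem lemma7 :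
    ∃ (C1T : ℕ → ℝ → ℝ) (CIV : ℕ → ℕ → ℝ → ℝ) (Cb : ℝ → ℝ → ℕ → ℝ → ℝ)
      (etaStar : ℝ → ℝ → ℕ → ℝ → ℝ → ℝ) (Cc : ℝ → ℝ → ℝ),
      ∀ (d : ℕ), d = 2 ∨ d = 3 → ∀ (P : HDG.InterfaceProblem d) (F : HDG.MeshFamily P),
        -- admissible constants of the trace and the inverse inequality exist
        (0 < C1T d F.ν₁ ∧ HDG.IsTraceConst F (C1T d F.ν₁)) ∧
        (∀ k : ℕ, 1 ≤ k → 0 < CIV d k F.ν₁ ∧ HDG.IsInverseConst F k (CIV d k F.ν₁)) ∧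
        -- boundedness
        (∀ c₁ : ℝ, 0 < c₁ → HDG.IsTraceConst F c₁ →
          0 < Cb P.alpha F.etaMin d c₁ ∧
          ∀ (h : F.ι), ∀ w ∈ HDG.V2 (F.mesh h), ∀ v ∈ HDG.V2 (F.mesh h),
            HDG.B F h w v ≤
              Cb P.alpha F.etaMin d c₁ * HDG.norm2 F h w * HDG.norm2 F h v) ∧
        -- coercivity
        (∀ (k l : ℕ), 1 ≤ k → 1 ≤ l → ∀ c₁ c₂ : ℝ, 0 < c₁ → HDG.IsTraceConst F c₁ →
          0 < c₂ → HDG.IsInverseConst F k c₂ →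
          0 < etaStar P.alpha P.lamMin d c₁ c₂ ∧ 0 < Cc P.lamMin c₂ ∧
          (etaStar P.alpha P.lamMin d c₁ c₂ ≤ F.etaMin →
            ∀ (h : F.ι), ∀ v ∈ HDG.Vh (F.mesh h) k l,
              Cc P.lamMin c₂ * HDG.norm2 F h v ^ 2 ≤ HDG.B F h v v)) := by
  refine ⟨HDG.traceConst, HDG.inverseConst, HDG.boundConst, HDG.penaltyThreshold, HDG.coercConst,
    fun d hd P F => ?_⟩
  have hd2 : 2 ≤ d := by omega
  refine ⟨⟨HDG.traceConst_pos d F.ν₁, F.isTraceConst hd2⟩,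
    fun k _ => ⟨HDG.inverseConst_pos d k F.ν₁, F.isInverseConst hd2 k⟩,
    fun c₁ hc₁ hF => ⟨HDG.boundConst_pos _ _ _ _, fun h w hw v hv => ?_⟩,
    fun k l _ _ c₁ c₂ hc₁ hF₁ _ hF₂ => ⟨HDG.penaltyThreshold_pos _ _ _ _ _,
      HDG.coercConst_pos P.lamMin_pos c₂, fun hη h v hv => ?_⟩⟩
  · exact HDG.B_le hd2 hc₁ hF (HDG.isAdmissible_of_mem_V2 hw) (HDG.isAdmissible_of_mem_V2 hv)
  · exact HDG.le_B hd2 hc₁ hF₁ hF₂ hη hv
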